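/- A graph is an interval graph if closed intervals $I_v=[l_v,r_v]$ of the real line can be assigned to its vertices so that distinct vertices are adjacent exactly when their intervals intersect; such an assignment is an interval representation. A set of vertices is called connected if it is non-empty and induces a connected subgraph. In the Balanced Connected Subgraph problem (BCS) the input is a graph whose vertices are coloured blue or red, and the output is a connected vertex set of maximum size among those with as many blue as red vertices (or the empty set, reporting that there is no such connected set). (1) BCS on $n$-vertex interval graphs can be solved in $O(n^3)$ time: there is one program for a unit-cost random access machine with words of $O(\log n)$ bits that, given the adjacency matrix and the colouring of any $n$-vertex interval graph (no interval representation is given), outputs a solution of BCS after $O(n^3)$ steps. (2) Let $G$ be a finite graph with an interval representation, let $S$ be a connected vertex set of $G$, and let $v\in S$ have the largest left end point, $l_u\le l_v$ for all $u\in S$. Then $S\setminus\{v\}$ is empty or connected. (3) Let $G$ have vertices $v_1,\dots,v_n$, coloured blue or red, and an interval representation $I_{v_i}=[l_i,r_i]$ whose $2n$ end points are pairwise distinct integers in $\{1,\dots,2n\}$, with $l_1<\dots<l_n$. Let $f(v)=1$ if $v$ is blue and $f(v)=-1$ if $v$ is red. For $0\le i\le n$ and integers $k,d$ let $\mathrm{bcs}(i,k,d)$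 be the maximum size of a connected set $S\subseteq\{v_1,\dots,v_i\}$ with $\max_{v_j\in S}r_j=k$ and $\sum_{v\in S}f(v)=d$, and $-\infty$ if there is no such set. Then for $1\le i\le n$, $1\le k\le 2n$ and $-n\le d\le n$, $$\mathrm{bcs}(i,k,d)=\begin{cases}\max\{\mathrm{bcs}(i-1,k,d-f(v_i))+1,\ \mathrm{bcs}(i-1,k,d)\} & (k>r_i)\\ \max_{l_i<k'<r_i}\bigl(\mathrm{bcs}(i-1,k',d-f(v_i))+1\bigr) & (k=r_i,\ d\ne f(v_i))\\ \max\{1,\ \max_{l_i<k'<r_i}(\mathrm{bcs}(i-1,k',d-f(v_i))+1)\} & (k=r_i,\ d=f(v_i))\\ \mathrm{bcs}(i-1,k,d) & (k<r_i),\end{cases}$$ where a maximum over the empty set is $-\infty$. -/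

import Mathlib

open Filter Asymptotics

namespace BCS

/-! ## Interval graphs and balanced connected subgraphs -/

/-- The closed intervals `[l v, r v]` (all non-empty) form an interval representation of `G`:
distinct vertices are adjacent if and only if their intervals intersect. -/
structure IsIntervalRep {V α : Type*} [LinearOrder α] (G : SimpleGraph V) (l r : V → α) :
    Prop where
  le : ∀ v, l v ≤ r v
  adj_iff : ∀ u v, u ≠ v →
    (G.Adj u v ↔ (Set.Icc (l u) (r u) ∩ Set.Icc (l v) (r v)).Nonempty)

/-- A graph is interval if it has a representation by intervals of the real line. -/
def IsIntervalGraph {V : Type*} (G : SimpleGraph V) : Prop :=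
  ∃ l r : V → ℝ, IsIntervalRep G l r

/-- A normalized interval representation of a graph on `v₁, …, vₙ` (the vertex `v_{i+1}` is
`i : Fin n`): the end points are pairwise distinct integers between `1` and `2n`, and the vertices
are sorted in ascending order of their left end points. -/
structure IsSortedRep {n : ℕ} (G : SimpleGraph (Fin n)) (l r : Fin n → ℕ) : Prop where
  rep : IsIntervalRep G l r
  left_range : ∀ v, 1 ≤ l v ∧ l v ≤ 2 * n
  right_range : ∀ v, 1 ≤ r v ∧ r v ≤ 2 * n
  distinct : Function.Injective (Sum.elim l r)
  sorted : StrictMono l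

/-- The vertex set `S` induces a connected (in particular non-empty) subgraph. -/
def ConnectedSet {V : Type*} (G : SimpleGraph V) (S : Finset V) : Prop :=
  (G.induce (S : Set V)).Connected

/-- The number of blue vertices minus the number of red vertices of `S`, where `B` is the set of
blue vertices and every vertex outside `B` is red. -/
def colorDiff {V : Type*} [DecidableEq V] (B S : Finset V) : ℤ :=
  ((S ∩ B).card : ℤ) - ((S \ B).card : ℤ)

/-- The induced subgraph on `S` is connected and has as many blue as red vertices. -/
def IsBalancedConnected {V : Type*} [DecidableEq V] (G : SimpleGraph V) (B S : Finset V) : Prop :=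
  ConnectedSet G S ∧ (S ∩ B).card = (S \ B).card

/-- `S` is a correct answer to the instance `(G, B)` of the balanced connected subgraph problem:
a balanced connected vertex set of maximum size or, if there is no balanced connected
(non-empty) vertex set at all, the empty set, which reports this. -/
def IsBCSSolution {V : Type*} [DecidableEq V] (G : SimpleGraph V) (B S : Finset V) : Prop :=
  (IsBalancedConnected G B S ∧ ∀ T, IsBalancedConnected G B T → T.card ≤ S.card) ∨
    (S = ∅ ∧ ∀ T, ¬ IsBalancedConnected G B T)

/-- A non-empty set `S ⊆ {v₁, …, vᵢ}` is feasible for `(i, k, d)` if it is connected, its largest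
right end point is `k` and its colour difference is `d`. -/
structure Feasible {n : ℕ} (G : SimpleGraph (Fin n)) (B : Finset (Fin n)) (r : Fin n → ℕ)
    (i k : ℕ) (d : ℤ) (S : Finset (Fin n)) : Prop where
  nonempty : S.Nonempty
  subset : ∀ v ∈ S, (v : ℕ) < i
  connected : ConnectedSet G S
  right : S.sup r = k
  diff : colorDiff B S = d

open Classical in
/-- The maximum size of a set that is feasible for `(i, k, d)`, where `⊥` (that is, `-∞`) means
that there is none. -/
noncomputable def bcs {n : ℕ} (G : SimpleGraph (Fin n)) (B : Finset (Fin n)) (r : Fin n → ℕ)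
    (i k : ℕ) (d : ℤ) : WithBot ℕ :=
  (Finset.univ.filter (Feasible G B r i k d)).sup fun S => (S.card : WithBot ℕ)

/-- `1` for a blue vertex, `-1` for a red one. -/
def colorSign {V : Type*} [DecidableEq V] (B : Finset V) (v : V) : ℤ :=
  if v ∈ B then 1 else -1

/-! ## A unit-cost random access machine with bounded words -/

/-- Registers and main memory. -/
structure State where
  reg : ℕ → ℕ
  mem : ℕ → ℕ

/-- Overwrite register `x`. -/
def State.setReg (s : State) (x a : ℕ) : State :=
  { s with reg := Function.update s.reg x a }

/-- Overwrite memory cell `x`. -/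
def State.setMem (s : State) (x a : ℕ) : State :=
  { s with mem := Function.update s.mem x a }

/-- Programs of the machine: three-address arithmetic on registers, indirect memory access,
sequencing, and branching and looping on the comparison of two registers. The numbers `x y z` are
names of registers and are fixed in the program text, as are the constants. -/
inductive Prog where
  | skip : Prog
  | const (x a : ℕ) : Prog
  | add (x y z : ℕ) : Prog
  | sub (x y z : ℕ) : Prog
  | mul (x y z : ℕ) : Prog
  | load (x y : ℕ) : Prog
  | store (x y : ℕ) : Prog
  | seq (p q : Prog) : Prog
  | ite (x y : ℕ) (p q : Prog) : Prog
  | loop (x y : ℕ) (p : Prog) : Prog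

/-- `Run W p s t s'`: started in the state `s`, the program `p` halts in the state `s'` after
exactly `t` steps, on a machine whose words hold the numbers below `W`. Every elementary
instruction and every evaluation of a branching or looping test is one step. There is no rule for
an overflow, so a program that produces a number that is not below `W` has no run. -/
inductive Run (W : ℕ) : Prog → State → ℕ → State → Prop where
  | skip (s : State) : Run W .skip s 1 s
  | const (s : State) (x a : ℕ) (h : a < W) : Run W (.const x a) s 1 (s.setReg x a)
  | add (s : State) (x y z : ℕ) (h : s.reg y + s.reg z < W) :
      Run W (.add x y z) s 1 (s.setReg x (s.reg y + s.reg z))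
  | sub (s : State) (x y z : ℕ) : -- truncated subtraction
      Run W (.sub x y z) s 1 (s.setReg x (s.reg y - s.reg z))
  | mul (s : State) (x y z : ℕ) (h : s.reg y * s.reg z < W) :
      Run W (.mul x y z) s 1 (s.setReg x (s.reg y * s.reg z))
  | load (s : State) (x y : ℕ) : -- the address is the content of register `y`
      Run W (.load x y) s 1 (s.setReg x (s.mem (s.reg y)))
  | store (s : State) (x y : ℕ) : -- the address is the content of register `x`
      Run W (.store x y) s 1 (s.setMem (s.reg x) (s.reg y))
  | seq {p q : Prog} {s₁ s₂ s₃ : State} {t₁ t₂ : ℕ} (h₁ : Run W p s₁ t₁ s₂)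
      (h₂ : Run W q s₂ t₂ s₃) : Run W (.seq p q) s₁ (t₁ + t₂) s₃
  | ite_true {x y : ℕ} {p q : Prog} {s₁ s₂ : State} {t : ℕ} (h : s₁.reg x < s₁.reg y)
      (h₁ : Run W p s₁ t s₂) : Run W (.ite x y p q) s₁ (t + 1) s₂
  | ite_false {x y : ℕ} {p q : Prog} {s₁ s₂ : State} {t : ℕ} (h : ¬ s₁.reg x < s₁.reg y)
      (h₁ : Run W q s₁ t s₂) : Run W (.ite x y p q) s₁ (t + 1) s₂
  | loop_done {x y : ℕ} {p : Prog} {s : State} (h : ¬ s.reg x < s.reg y) :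
      Run W (.loop x y p) s 1 s
  | loop_step {x y : ℕ} {p : Prog} {s₁ s₂ s₃ : State} {t₁ t₂ : ℕ} (h : s₁.reg x < s₁.reg y)
      (h₁ : Run W p s₁ t₁ s₂) (h₂ : Run W (.loop x y p) s₂ t₂ s₃) :
      Run W (.loop x y p) s₁ (t₁ + t₂ + 1) s₃

open Classical in
/-- The initial state for a bicoloured graph on `n` vertices: register `0` holds `n`, the memory
cells `0, …, n² - 1` hold the adjacency matrix row by row, and the cells `n², …, n² + n - 1` hold
the colours (`1` for blue, `0` for red). Everything else is `0`. -/
noncomputable def inputState {n : ℕ} (G : SimpleGraph (Fin n)) (B : Finset (Fin n)) : State where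
  reg x := if x = 0 then n else 0
  mem a :=
    if (∃ u v : Fin n, a = u * n + v ∧ G.Adj u v) ∨ (∃ v ∈ B, a = n * n + v) then 1 else 0

/-- The memory cells `0, …, n - 1` hold the indicator vector of `S`. -/
def Outputs {n : ℕ} (s : State) (S : Finset (Fin n)) : Prop :=
  ∀ v : Fin n, s.mem v = if v ∈ S then 1 else 0

end BCS

/-! Connectivity rests on one observation. If `v` has the largest left end point in a connected set,
the interval of every neighbour of `v` in the set contains the left end point of `v`. These
neighbours are therefore pairwise adjacent, and walks can bypass `v`. Hence a connected subset of a
prefix omits the last vertex, or consists of it alone, or extends a connected subset of the shorter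
prefix whose largest right end point reaches the new interval. Only that end point, the colour
difference and the size matter for the extension, which gives the recurrence (`ConnectedSet.erase`,
`Feasible.erase`, `Feasible.insert_last`).

The algorithm must find a representation by itself. Being entirely to the left orients the
complement of an interval graph transitively. Conversely, since the graph has no induced four-cycle,
the predecessor sets of any transitive orientation are nested. In the order by their sizes, a vertex
adjacent to a later one is adjacent to everything in between (`adj_of_predCount_le`), and the
intervals from each vertex to the last member of its closed neighbourhood represent the graph
(`isIntervalRep_of_umbrella`).

The orientation comes from two sweeps of ordered partition refinement. A pivot splits the other
classes in the direction that transitivity forces. When no pivot splits anything, the classes are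
modules and a vertex is moved to the end of its class, which is harmless if this vertex can be
extremal in the module. The first sweep only serves to find such vertices: whatever it chooses, the
vertex it puts first in a module can precede the rest of the module (`Reach.frontInv`). The reason
is that split-off vertices are joined by paths avoiding the neighbours of a front vertex, so they
lie on one side of it. The second sweep chooses in the order of the first, and its labels orient the
complement (`Reach.exists_orient`, `isTransOrient_of_two_sweeps`).

The table of the dynamic programme is only required to bound all sizes from below; that its best
entry is attained follows by tracing parent pointers (`IsTable.card_lt`, `Tracing.isBCSSolution`).
The program is written in a small loop language that keeps stored values at most `4n + 4` and passes
per loop at most `2n + 1` by syntax alone. Compilation preserves meaning and cost (`Stmt.run_comp`),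
and nesting depth three gives cubic time (`exists_prog_of_stmt`). -/

namespace BCS

/-! ### Connected sets in interval graphs, and colour differences -/

section Connected

variable {V : Type*} {G : SimpleGraph V}

/-- Walks are expressed on `V` itself instead of the subtype of `S`, so that `S` can be enlarged or
shrunk without transporting vertices. -/
theorem connectedSet_iff {S : Finset V} : ConnectedSet G S ↔ S.Nonempty ∧ ∀ u ∈ S, ∀ v ∈ S,
    Relation.ReflTransGen (fun a b => G.Adj a b ∧ a ∈ S ∧ b ∈ S) u v := by
  unfold ConnectedSet
  rw [SimpleGraph.connected_iff, SimpleGraph.Preconnected]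
  constructor
  · rintro ⟨h, ⟨⟨x, hx⟩⟩⟩
    refine ⟨⟨x, hx⟩, fun u hu v hv => ?_⟩
    have := (SimpleGraph.reachable_iff_reflTransGen _ _).1 (h ⟨u, hu⟩ ⟨v, hv⟩)
    have key : ∀ z, Relation.ReflTransGen (G.induce (S : Set V)).Adj ⟨u, hu⟩ z →
        Relation.ReflTransGen (fun a b => G.Adj a b ∧ a ∈ S ∧ b ∈ S) u z := by
      intro z hz
      induction hz with
      | refl => exact .refl
      | @tail a b _ h2 ih => exact ih.tail ⟨h2, a.2, b.2⟩
    exact key _ this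
  · rintro ⟨⟨x, hx⟩, h⟩
    refine ⟨?_, ⟨⟨x, hx⟩⟩⟩
    rintro ⟨u, hu⟩ ⟨v, hv⟩
    rw [SimpleGraph.reachable_iff_reflTransGen]
    have := h u hu v hv
    induction this with
    | refl => exact .refl
    | tail _ h2 ih => exact (ih h2.2.1).tail h2.1

theorem ConnectedSet.nonempty {S : Finset V} (h : ConnectedSet G S) : S.Nonempty :=
  (connectedSet_iff.1 h).1

theorem connectedSet_singleton (v : V) : ConnectedSet G {v} := by
  rw [connectedSet_iff]
  refine ⟨⟨v, by simp⟩, ?_⟩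
  intro a ha b hb
  rw [Finset.mem_singleton] at ha hb
  subst ha hb
  exact .refl

variable {α : Type*} [LinearOrder α] {l r : V → α}

theorem IsIntervalRep.adj_iff_le (h : IsIntervalRep G l r) {u v : V} (huv : u ≠ v) :
    G.Adj u v ↔ l u ≤ r v ∧ l v ≤ r u := by
  rw [h.adj_iff u v huv]
  have hu := h.le u
  have hv := h.le v
  constructor
  · rintro ⟨x, ⟨h1, h2⟩, h3, h4⟩
    exact ⟨h1.trans h4, h3.trans h2⟩
  · rintro ⟨h1, h2⟩
    exact ⟨max (l u) (l v), ⟨le_max_left _ _, max_le hu h2⟩, le_max_right _ _, max_le h1 hv⟩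

variable [DecidableEq V]

theorem ConnectedSet.insert_of_adj {S : Finset V} (h : ConnectedSet G S) {u v : V} (hu : u ∈ S)
    (huv : G.Adj u v) : ConnectedSet G (insert v S) := by
  rw [connectedSet_iff] at h ⊢
  have mono : ∀ a b, Relation.ReflTransGen (fun a b => G.Adj a b ∧ a ∈ S ∧ b ∈ S) a b →
      Relation.ReflTransGen (fun a b => G.Adj a b ∧ a ∈ insert v S ∧ b ∈ insert v S) a b :=
    fun a b => Relation.ReflTransGen.mono (fun a b hab =>
      ⟨hab.1, Finset.mem_insert_of_mem hab.2.1, Finset.mem_insert_of_mem hab.2.2⟩) a b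
  refine ⟨⟨v, by simp⟩, ?_⟩
  have h_to : ∀ a ∈ insert v S, Relation.ReflTransGen
      (fun a b => G.Adj a b ∧ a ∈ insert v S ∧ b ∈ insert v S) a u := by
    intro a ha
    rcases Finset.mem_insert.1 ha with rfl | ha
    · exact .single ⟨huv.symm, by simp, by simp [hu]⟩
    · exact mono _ _ (h.2 a ha u hu)
  have from' : ∀ a ∈ insert v S, Relation.ReflTransGen
      (fun a b => G.Adj a b ∧ a ∈ insert v S ∧ b ∈ insert v S) u a := by
    intro a ha
    rcases Finset.mem_insert.1 ha with rfl | ha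
    · exact .single ⟨huv, by simp [hu], by simp⟩
    · exact mono _ _ (h.2 u hu a ha)
  exact fun a ha b hb => (h_to a ha).trans (from' b hb)

/-- A vertex of a connected set with a further vertex has a neighbour in the set. -/
theorem ConnectedSet.exists_adj {S : Finset V} (h : ConnectedSet G S) {v : V} (hv : v ∈ S)
    (hS : S ≠ {v}) : ∃ u ∈ S.erase v, G.Adj u v := by
  rw [connectedSet_iff] at h
  obtain ⟨w, hw, hwv⟩ : ∃ w ∈ S, w ≠ v := by
    by_contra! hc
    exact hS (Finset.eq_singleton_iff_unique_mem.2 ⟨hv, hc⟩)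
  rcases Relation.ReflTransGen.cases_tail (h.2 w hw v hv) with h1 | ⟨u, -, h2⟩
  · exact absurd h1.symm hwv
  · exact ⟨u, Finset.mem_erase.2 ⟨h2.1.ne, h2.2.1⟩, h2.1⟩

/-- A walk through `v` enters from some `x` and leaves to some `b`. Both intervals start at or
before `l v` and meet the interval of `v`, so both contain `l v`; thus `x` and `b` are equal or
adjacent, and `v` can be skipped. -/
theorem ConnectedSet.erase (h : IsIntervalRep G l r) {S : Finset V} {v : V}
    (hS : ConnectedSet G S) (hv : v ∈ S) (hmax : ∀ u ∈ S, l u ≤ l v) :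
    S = {v} ∨ ConnectedSet G (S.erase v) := by
  by_cases hSv : S = {v}
  · exact .inl hSv
  right
  obtain ⟨w, hw, -⟩ := hS.exists_adj hv hSv
  rw [connectedSet_iff] at hS ⊢
  refine ⟨⟨w, hw⟩, fun a ha b hb => ?_⟩
  -- The induction along the walk also treats walks that have just arrived at `v`: every remaining
  -- neighbour of `v` is then already reached without `v`.
  have key : ∀ x, Relation.ReflTransGen (fun a b => G.Adj a b ∧ a ∈ S ∧ b ∈ S) a x →
      (x ≠ v → Relation.ReflTransGen
        (fun a b => G.Adj a b ∧ a ∈ S.erase v ∧ b ∈ S.erase v) a x) ∧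
      (x = v → ∀ b ∈ S.erase v, G.Adj v b → Relation.ReflTransGen
        (fun a b => G.Adj a b ∧ a ∈ S.erase v ∧ b ∈ S.erase v) a b) := by
    intro x hx
    induction hx with
    | refl => exact ⟨fun _ => .refl, fun hav => absurd hav (Finset.ne_of_mem_erase ha)⟩
    | @tail x y _ hxy ih =>
      constructor
      · intro hyv
        have hy : y ∈ S.erase v := Finset.mem_erase.2 ⟨hyv, hxy.2.2⟩
        by_cases hxv : x = v
        · exact ih.2 hxv y hy (hxv ▸ hxy.1)
        · exact (ih.1 hxv).tail ⟨hxy.1, Finset.mem_erase.2 ⟨hxv, hxy.2.1⟩, hy⟩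
      · rintro rfl b hb hyb
        have hxv : x ≠ y := hxy.1.ne
        have hx : x ∈ S.erase y := Finset.mem_erase.2 ⟨hxv, hxy.2.1⟩
        by_cases hxb : x = b
        · exact hxb ▸ ih.1 hxv
        · refine (ih.1 hxv).tail ⟨?_, hx, hb⟩
          have h1 := (h.adj_iff_le hxv).1 hxy.1
          have h2 := (h.adj_iff_le hyb.ne).1 hyb
          exact (h.adj_iff_le hxb).2
            ⟨(hmax x hxy.2.1).trans h2.1, (hmax b (Finset.mem_of_mem_erase hb)).trans h1.2⟩
  exact (key b (hS.2 a (Finset.mem_of_mem_erase ha) b (Finset.mem_of_mem_erase hb))).1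
    (Finset.ne_of_mem_erase hb)

theorem colorDiff_insert {B S : Finset V} {v : V} (hv : v ∉ S) :
    colorDiff B (insert v S) = colorDiff B S + colorSign B v := by
  unfold colorDiff colorSign
  by_cases hB : v ∈ B
  · rw [Finset.insert_inter_of_mem hB, Finset.insert_sdiff_of_mem _ hB,
      Finset.card_insert_of_notMem (by simp [hv])]
    simp [hB]; ring
  · rw [Finset.insert_inter_of_notMem hB, Finset.insert_sdiff_of_notMem _ hB,
      Finset.card_insert_of_notMem (by simp [hv])]
    simp [hB]; ring

theorem colorDiff_erase {B S : Finset V} {v : V} (hv : v ∈ S) :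
    colorDiff B (S.erase v) = colorDiff B S - colorSign B v := by
  have := colorDiff_insert (B := B) (Finset.notMem_erase v S)
  rw [Finset.insert_erase hv] at this
  rw [this]; ring

@[simp] theorem colorDiff_empty {B : Finset V} : colorDiff B ∅ = 0 := by simp [colorDiff]

theorem colorDiff_eq_zero {B S : Finset V} :
    colorDiff B S = 0 ↔ (S ∩ B).card = (S \ B).card := by
  unfold colorDiff; omega

end Connected

/-! ### The recurrence for `bcs` -/

section Recurrence

variable {n : ℕ} {G : SimpleGraph (Fin n)} {B : Finset (Fin n)} {l r : Fin n → ℕ}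

theorem bcs_le_iff {i k : ℕ} {d : ℤ} {a : WithBot ℕ} :
    bcs G B r i k d ≤ a ↔ ∀ S, Feasible G B r i k d S → (S.card : WithBot ℕ) ≤ a := by
  classical
  unfold bcs
  rw [Finset.sup_le_iff]
  simp

theorem Feasible.card_le_bcs {i k : ℕ} {d : ℤ} {S : Finset (Fin n)}
    (h : Feasible G B r i k d S) : (S.card : WithBot ℕ) ≤ bcs G B r i k d :=
  bcs_le_iff.1 le_rfl S h

/-- The bound passes to the supremum because `⊥ + 1 = ⊥` when nothing is feasible, and the supremum
of a non-empty finite family is attained. -/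
theorem bcs_add_one_le {i k : ℕ} {d : ℤ} {a : WithBot ℕ}
    (h : ∀ S, Feasible G B r i k d S → ((S.card + 1 : ℕ) : WithBot ℕ) ≤ a) :
    bcs G B r i k d + 1 ≤ a := by
  classical
  rcases Finset.eq_empty_or_nonempty (Finset.univ.filter (Feasible G B r i k d)) with h0 | h0
  · simp [bcs, h0]
  · obtain ⟨S, hS, hS'⟩ := Finset.exists_mem_eq_sup _ h0 fun S => (S.card : WithBot ℕ)
    have := h S (by simpa using hS)
    unfold bcs
    rw [hS']
    exact_mod_cast this

theorem Feasible.add_one_le_bcs {i k : ℕ} {d : ℤ} {S : Finset (Fin n)}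
    (h : Feasible G B r i k d S) : ((S.card + 1 : ℕ) : WithBot ℕ) ≤ bcs G B r i k d + 1 := by
  have := add_le_add_left h.card_le_bcs 1
  exact_mod_cast this

theorem Feasible.mono {i k : ℕ} {d : ℤ} {S : Finset (Fin n)}
    (h : Feasible G B r i k d S) : Feasible G B r (i + 1) k d S :=
  ⟨h.nonempty, fun v hv => (h.subset v hv).trans (Nat.lt_succ_self i), h.connected, h.right, h.diff⟩

theorem Feasible.of_notMem {i : Fin n} {k : ℕ} {d : ℤ} {S : Finset (Fin n)}
    (h : Feasible G B r (i + 1) k d S) (hi : i ∉ S) : Feasible G B r i k d S := by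
  refine ⟨h.nonempty, fun v hv => ?_, h.connected, h.right, h.diff⟩
  have h1 := h.subset v hv
  have h2 : v ≠ i := fun hc => hi (hc ▸ hv)
  have h3 : (v : ℕ) ≠ i := fun hc => h2 (Fin.ext hc)
  omega

/-- Adding the vertex of largest left end point to a feasible set that reaches it. -/
theorem Feasible.insert_last (h : IsSortedRep G l r) {i : Fin n} {k : ℕ} {d : ℤ} {S : Finset (Fin n)}
    (hS : Feasible G B r i k d S) (hk : l i ≤ k) :
    Feasible G B r (i + 1) (max k (r i)) (d + colorSign B i) (insert i S) := by
  have hi : i ∉ S := fun hc => lt_irrefl _ (hS.subset i hc)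
  refine ⟨by simp, ?_, ?_, ?_, ?_⟩
  · intro v hv
    rcases Finset.mem_insert.1 hv with rfl | hv
    · omega
    · have := hS.subset v hv; omega
  · obtain ⟨u, hu, hur⟩ := Finset.exists_mem_eq_sup S hS.nonempty r
    rw [hS.right] at hur
    have hui : u < i := hS.subset u hu
    -- The member `u` that attains the largest right end point starts before `i` and ends at or
    -- after `l i`, so it meets the interval of `i`.
    refine hS.connected.insert_of_adj hu ((h.rep.adj_iff_le hui.ne).2 ⟨?_, hur ▸ hk⟩)
    exact (h.sorted hui).le.trans (h.rep.le i)
  · rw [Finset.sup_insert, hS.right]; exact max_comm _ _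
  · rw [colorDiff_insert hi, hS.diff]

/-- A feasible set that contains the last vertex is a singleton or extends a feasible set of the
previous prefix that reaches the last vertex. -/
theorem Feasible.erase (h : IsSortedRep G l r) {i : Fin n} {k : ℕ} {d : ℤ} {S : Finset (Fin n)}
    (hS : Feasible G B r (i + 1) k d S) (hi : i ∈ S) :
    (S = {i} ∧ k = r i ∧ d = colorSign B i) ∨
      ∃ k', l i < k' ∧ k = max k' (r i) ∧ k' ≠ r i ∧
        Feasible G B r i k' (d - colorSign B i) (S.erase i) := by
  have hlt : ∀ v ∈ S.erase i, v < i := by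
    intro v hv
    have h1 := hS.subset v (Finset.mem_of_mem_erase hv)
    have h2 : (v : ℕ) ≠ i := fun hc => Finset.ne_of_mem_erase hv (Fin.ext hc)
    exact Fin.lt_def.2 (by omega)
  have hmax : ∀ u ∈ S, l u ≤ l i := by
    intro u hu
    by_cases hui : u = i
    · rw [hui]
    · exact (h.sorted (hlt u (Finset.mem_erase.2 ⟨hui, hu⟩))).le
  rcases hS.connected.erase h.rep hi hmax with hc | hc
  · subst hc
    left
    refine ⟨rfl, ?_, ?_⟩
    · rw [← hS.right]; simp
    · rw [← hS.diff]
      have := colorDiff_insert (B := B) (S := ∅) (v := i) (by simp)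
      rw [← insert_empty_eq, this]; simp
  · right
    have hSi : S ≠ {i} := by
      rintro rfl
      have := hc.nonempty
      simp at this
    obtain ⟨u, hu, hui⟩ := hS.connected.exists_adj hi hSi
    obtain ⟨w, hw, hwr⟩ := Finset.exists_mem_eq_sup _ hc.nonempty r
    refine ⟨(S.erase i).sup r, ?_, ?_, ?_, hc.nonempty, fun v hv => hlt v hv, hc, rfl, ?_⟩
    · have h1 := ((h.rep.adj_iff_le hui.ne).1 hui).2
      -- Adjacency only gives `l i ≤ r u`. Distinct end points make it strict, which is why `k'`
      -- ranges over an open interval.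
      have h2 : l i ≠ r u := fun hc => by
        have := h.distinct (a₁ := Sum.inl i) (a₂ := Sum.inr u) hc
        cases this
      have h3 : r u ≤ (S.erase i).sup r := Finset.le_sup hu
      omega
    · rw [← hS.right, ← Finset.insert_erase hi, Finset.sup_insert, Finset.erase_insert (by simp)]
      exact max_comm _ _
    · rw [hwr]
      intro hc
      have := h.distinct (a₁ := Sum.inr w) (a₂ := Sum.inr i) hc
      exact Finset.ne_of_mem_erase hw (Sum.inr_injective this)
    · rw [colorDiff_erase hi, hS.diff]

theorem feasible_singleton (i : Fin n) :
    Feasible G B r (i + 1) (r i) (colorSign B i) {i} := by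
  refine ⟨by simp, by simp, connectedSet_singleton i, by simp, ?_⟩
  have := colorDiff_insert (B := B) (S := ∅) (v := i) (by simp)
  rw [← insert_empty_eq, this]; simp

/-- When `k` exceeds `r i`, vertex `i` does not determine the largest right end point, so removing
it leaves `k` unchanged. Conversely `l i ≤ r i < k` guarantees that `i` can be attached to any set
with end point `k`. -/
theorem bcs_succ_of_lt (h : IsSortedRep G l r) (i : Fin n) {k : ℕ} {d : ℤ} (hk : r i < k) :
    bcs G B r (i + 1) k d = max (bcs G B r i k (d - colorSign B i) + 1) (bcs G B r i k d) := by
  apply le_antisymm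
  · rw [bcs_le_iff]
    intro S hS
    by_cases hi : i ∈ S
    · rcases hS.erase h hi with ⟨-, h1, -⟩ | ⟨k', -, h2, -, h3⟩
      · omega
      · obtain rfl : k = k' := by omega
        refine le_max_of_le_left ?_
        have := h3.add_one_le_bcs
        rwa [Finset.card_erase_add_one hi] at this
    · exact le_max_of_le_right (hS.of_notMem hi).card_le_bcs
  · refine max_le (bcs_add_one_le fun S hS => ?_) (bcs_le_iff.2 fun S hS => hS.mono.card_le_bcs)
    have hl := h.rep.le i
    have h1 := (hS.insert_last h (i := i) (by omega)).card_le_bcs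
    rw [sub_add_cancel, max_eq_left hk.le, Finset.card_insert_of_notMem
      fun hc => lt_irrefl _ (hS.subset i hc)] at h1
    exact h1

theorem le_bcs_of_Ioo (h : IsSortedRep G l r) (i : Fin n) (d : ℤ) :
    ((Finset.Ioo (l i) (r i)).sup fun k' => bcs G B r i k' (d - colorSign B i) + 1) ≤
      bcs G B r (i + 1) (r i) d := by
  rw [Finset.sup_le_iff]
  intro k' hk'
  rw [Finset.mem_Ioo] at hk'
  refine bcs_add_one_le fun S hS => ?_
  have h1 := (hS.insert_last h (i := i) hk'.1.le).card_le_bcs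
  rw [sub_add_cancel, max_eq_right hk'.2.le, Finset.card_insert_of_notMem
    fun hc => lt_irrefl _ (hS.subset i hc)] at h1
  exact h1

/-- Right end points are distinct, so a set whose largest one is `r i` contains `i`. The rest, if
there is any, then ends strictly between `l i` and `r i`. -/
theorem Feasible.singleton_or_le (h : IsSortedRep G l r) {i : Fin n} {d : ℤ} {S : Finset (Fin n)}
    (hS : Feasible G B r (i + 1) (r i) d S) : (S = {i} ∧ d = colorSign B i) ∨
      (S.card : WithBot ℕ) ≤
        (Finset.Ioo (l i) (r i)).sup fun k' => bcs G B r i k' (d - colorSign B i) + 1 := by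
  have hi : i ∈ S := by
    obtain ⟨u, hu, hur⟩ := Finset.exists_mem_eq_sup S hS.nonempty r
    rw [hS.right] at hur
    have := h.distinct (a₁ := Sum.inr i) (a₂ := Sum.inr u) hur
    exact Sum.inr_injective this ▸ hu
  rcases hS.erase h hi with ⟨h1, -, h2⟩ | ⟨k', h1, h2, h2', h3⟩
  · exact .inl ⟨h1, h2⟩
  · right
    have h4 := h3.add_one_le_bcs
    rw [Finset.card_erase_add_one hi] at h4
    have hk' : k' ∈ Finset.Ioo (l i) (r i) := Finset.mem_Ioo.2 ⟨h1, by omega⟩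
    exact h4.trans (Finset.le_sup (f := fun k' => bcs G B r i k' (d - colorSign B i) + 1) hk')

theorem bcs_succ_of_eq_of_ne (h : IsSortedRep G l r) (i : Fin n) {d : ℤ}
    (hd : d ≠ colorSign B i) : bcs G B r (i + 1) (r i) d =
      (Finset.Ioo (l i) (r i)).sup fun k' => bcs G B r i k' (d - colorSign B i) + 1 := by
  refine le_antisymm (bcs_le_iff.2 fun S hS => ?_) (le_bcs_of_Ioo h i d)
  rcases hS.singleton_or_le h with h1 | h1
  · exact absurd h1.2 hd
  · exact h1

theorem bcs_succ_of_eq_of_eq (h : IsSortedRep G l r) (i : Fin n) :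
    bcs G B r (i + 1) (r i) (colorSign B i) = max 1 ((Finset.Ioo (l i) (r i)).sup
      fun k' => bcs G B r i k' (colorSign B i - colorSign B i) + 1) := by
  refine le_antisymm (bcs_le_iff.2 fun S hS => ?_) (max_le ?_ (le_bcs_of_Ioo h i _))
  · rcases hS.singleton_or_le h with h1 | h1
    · refine le_max_of_le_left ?_
      rw [h1.1]; simp
    · exact le_max_of_le_right h1
  · have := (feasible_singleton (G := G) (B := B) (r := r) i).card_le_bcs
    simpa using this

/-- A set containing `i` has largest right end point at least `r i`, so here `i` is never used. -/
theorem bcs_succ_of_gt (i : Fin n) {k : ℕ} {d : ℤ} (hk : k < r i) :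
    bcs G B r (i + 1) k d = bcs G B r i k d := by
  refine le_antisymm (bcs_le_iff.2 fun S hS => ?_) (bcs_le_iff.2 fun S hS => hS.mono.card_le_bcs)
  refine (hS.of_notMem fun hi => ?_).card_le_bcs
  have h1 : r i ≤ S.sup r := Finset.le_sup hi
  rw [hS.right] at h1
  omega

end Recurrence

end BCS

namespace BCS

/-! ### Transitive orientations of the complement, and modules -/

section Orientation

variable {V : Type*} {G : SimpleGraph V}

/-- `lt` restricts to a transitive orientation of the complement of the subgraph induced on `M`. -/
structure IsTransOrient (G : SimpleGraph V) (M : Set V) (lt : V → V → Prop) : Prop where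
  ne_adj : ∀ a ∈ M, ∀ b ∈ M, lt a b → a ≠ b ∧ ¬ G.Adj a b
  total : ∀ a ∈ M, ∀ b ∈ M, a ≠ b → ¬ G.Adj a b → lt a b ∨ lt b a
  trans : ∀ a ∈ M, ∀ b ∈ M, ∀ c ∈ M, lt a b → lt b c → lt a c

/-- No vertex of `M` outside `N` distinguishes two vertices of `N ⊆ M`. -/
structure IsModuleIn (G : SimpleGraph V) (M N : Set V) : Prop where
  subset : N ⊆ M
  adj_iff : ∀ p ∈ M, p ∉ N → ∀ u ∈ N, ∀ w ∈ N, (G.Adj p u ↔ G.Adj p w)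

/-- All vertices of `X` precede the vertices of `M \ X` they are not adjacent to. -/
def Below (G : SimpleGraph V) (lt : V → V → Prop) (M X : Set V) : Prop :=
  ∀ u ∈ X, ∀ w ∈ M, w ∉ X → ¬ G.Adj u w → lt u w

namespace IsTransOrient

variable {M N X : Set V} {lt lt' : V → V → Prop}

theorem mono (h : IsTransOrient G M lt) (hN : N ⊆ M) : IsTransOrient G N lt :=
  ⟨fun a ha b hb => h.ne_adj a (hN ha) b (hN hb), fun a ha b hb => h.total a (hN ha) b (hN hb),
    fun a ha b hb c hc => h.trans a (hN ha) b (hN hb) c (hN hc)⟩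

theorem asymm (h : IsTransOrient G M lt) {a b : V} (ha : a ∈ M) (hb : b ∈ M) (hab : lt a b) :
    ¬ lt b a :=
  fun hba => (h.ne_adj a ha a ha (h.trans a ha b hb a ha hab hba)).1 rfl

theorem reverse (h : IsTransOrient G M lt) : IsTransOrient G M fun a b => lt b a :=
  ⟨fun a ha b hb hab => ⟨(h.ne_adj b hb a ha hab).1.symm,
      fun hc => (h.ne_adj b hb a ha hab).2 hc.symm⟩,
    fun a ha b hb hab hn => (h.total a ha b hb hab hn).symm,
    fun a ha b hb c hc hab hbc => h.trans c hc b hb a ha hbc hab⟩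

/-- Nonadjacent pairs that share a neighbour of one end are oriented the same way. -/
theorem lt_of_adj_right (h : IsTransOrient G M lt) {u p w : V} (hu : u ∈ M) (hp : p ∈ M)
    (hw : w ∈ M) (hup : lt u p) (hpw : G.Adj p w) (hne : u ≠ w) (huw : ¬ G.Adj u w) : lt u w := by
  rcases h.total u hu w hw hne huw with h1 | h1
  · exact h1
  · exact absurd hpw.symm (h.ne_adj w hw p hp (h.trans w hw u hu p hp h1 hup)).2

theorem lt_of_adj_left (h : IsTransOrient G M lt) {u p w : V} (hu : u ∈ M) (hp : p ∈ M)
    (hw : w ∈ M) (hpu : lt p u) (hpw : G.Adj p w) (hne : u ≠ w) (huw : ¬ G.Adj u w) : lt w u :=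
  h.reverse.lt_of_adj_right hu hp hw hpu hpw hne huw

open Classical in
/-- Reorienting the inside of a module, whose position is that of its member `u₀`. -/
theorem subst (h : IsTransOrient G M lt) (hN : IsModuleIn G M N) (h' : IsTransOrient G N lt')
    {u₀ : V} (hu₀ : u₀ ∈ N) : IsTransOrient G M fun a b =>
      if a ∈ N then (if b ∈ N then lt' a b else lt u₀ b)
      else (if b ∈ N then lt a u₀ else lt a b) := by
  have hM := hN.subset hu₀
  have irr : ∀ a ∈ M, ¬ lt a a := fun a ha hc => (h.ne_adj a ha a ha hc).1 rfl
  refine ⟨?_, ?_, ?_⟩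
  · intro a ha b hb hab
    by_cases haN : a ∈ N <;> by_cases hbN : b ∈ N <;> simp only [haN, hbN, if_true, if_false] at hab
    · exact h'.ne_adj a haN b hbN hab
    · refine ⟨fun hc => hbN (hc ▸ haN), fun hc => (h.ne_adj u₀ hM b hb hab).2 ?_⟩
      exact ((hN.adj_iff b hb hbN a haN u₀ hu₀).1 hc.symm).symm
    · refine ⟨fun hc => haN (hc ▸ hbN), fun hc => (h.ne_adj a ha u₀ hM hab).2 ?_⟩
      exact (hN.adj_iff a ha haN b hbN u₀ hu₀).1 hc
    · exact h.ne_adj a ha b hb hab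
  · intro a ha b hb hab hn
    by_cases haN : a ∈ N <;> by_cases hbN : b ∈ N <;> simp only [haN, hbN, if_true, if_false]
    · exact h'.total a haN b hbN hab hn
    · refine h.total u₀ hM b hb (fun hc => hbN (hc ▸ hu₀)) (fun hc => hn ?_)
      exact ((hN.adj_iff b hb hbN u₀ hu₀ a haN).1 hc.symm).symm
    · refine h.total a ha u₀ hM (fun hc => haN (hc ▸ hu₀)) (fun hc => hn ?_)
      exact (hN.adj_iff a ha haN u₀ hu₀ b hbN).1 hc
    · exact h.total a ha b hb hab hn
  · intro a ha b hb c hc hab hbc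
    by_cases haN : a ∈ N <;> by_cases hbN : b ∈ N <;> by_cases hcN : c ∈ N <;>
      simp only [haN, hbN, hcN, if_true, if_false] at hab hbc ⊢
    · exact h'.trans a haN b hbN c hcN hab hbc
    · exact hbc
    -- Here `a` and `c` lie in the module and `b` does not: `b` would come both after and before
    -- `u₀`.
    · exact absurd hbc (h.asymm hM hb hab)
    · exact h.trans u₀ hM b hb c hc hab hbc
    · exact hab
    · exact h.trans a ha u₀ hM c hc hab hbc
    · exact h.trans a ha b hb u₀ hM hab hbc
    · exact h.trans a ha b hb c hc hab hbc

open Classical in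
/-- If the vertices outside the module `X` and not adjacent to it follow one of its members,
then `X` can be moved to the front. -/
theorem move_front (h : IsTransOrient G N lt) (hX : IsModuleIn G N X) {u₁ : V} (h1 : u₁ ∈ X)
    (hz : ∀ z ∈ N, z ∉ X → ¬ G.Adj u₁ z → lt u₁ z) :
    IsTransOrient G N fun a b =>
      if a ∈ X then (if b ∈ X then lt a b else ¬ G.Adj a b)
      else (if b ∈ X then False else lt a b) := by
  have nadj : ∀ u ∈ X, ∀ z ∈ N, z ∉ X → ¬ G.Adj u z → ¬ G.Adj u₁ z := fun u hu z hzN hzX hn hc =>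
    hn ((hX.adj_iff z hzN hzX u₁ h1 u hu).1 hc.symm).symm
  refine ⟨?_, ?_, ?_⟩
  · intro a ha b hb hab
    by_cases haX : a ∈ X <;> by_cases hbX : b ∈ X <;> simp only [haX, hbX, if_true, if_false] at hab
    · exact h.ne_adj a ha b hb hab
    · exact ⟨fun hc => hbX (hc ▸ haX), hab⟩
    · exact h.ne_adj a ha b hb hab
  · intro a ha b hb hab hn
    by_cases haX : a ∈ X <;> by_cases hbX : b ∈ X <;> simp only [haX, hbX, if_true, if_false]
    · exact h.total a ha b hb hab hn
    · exact .inl hn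
    · exact .inr fun hc => hn hc.symm
    · exact h.total a ha b hb hab hn
  · intro a ha b hb c hc hab hbc
    by_cases haX : a ∈ X <;> by_cases hbX : b ∈ X <;> by_cases hcX : c ∈ X <;>
      simp only [haX, hbX, hcX, if_true, if_false] at hab hbc ⊢
    · exact h.trans a ha b hb c hc hab hbc
    · intro hac
      exact hbc ((hX.adj_iff c hc hcX a haX b hbX).1 hac.symm).symm
    · intro hac
      -- `b` is not adjacent to the module, so it follows `u₁`, and hence so does `c`. Thus `c` is
      -- not adjacent to `u₁`, nor to any other member of the module.
      have hb1 := hz b hb hbX (nadj a haX b hb hbX hab)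
      have h3 := h.trans u₁ (hX.subset h1) b hb c hc hb1 hbc
      exact (h.ne_adj u₁ (hX.subset h1) c hc h3).2
        ((hX.adj_iff c hc hcX a haX u₁ h1).1 hac.symm).symm
    · exact h.trans a ha b hb c hc hab hbc

end IsTransOrient

/-- There is a transitive orientation of the complement on `M` in which `X` precedes the
nonadjacent rest of `M`. -/
def CanPrecede (G : SimpleGraph V) (M X : Set V) : Prop :=
  ∃ lt, IsTransOrient G M lt ∧ Below G lt M X

theorem IsModuleIn.mono {M M' N : Set V} (h : IsModuleIn G M N) (hM : M' ⊆ M) (hN : N ⊆ M') :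
    IsModuleIn G M' N := ⟨hN, fun p hp => h.adj_iff p (hM hp)⟩

/-- Since `N` is a module, its inner orientation can be replaced by one with `X` in front, without
disturbing the position of `N` in front of the rest of `M`. -/
theorem CanPrecede.trans {M N X : Set V} (h : CanPrecede G M N) (hN : IsModuleIn G M N)
    (hX : X ⊆ N) (hne : X.Nonempty) (h' : CanPrecede G N X) : CanPrecede G M X := by
  obtain ⟨lt, ho, hb⟩ := h
  obtain ⟨lt', ho', hb'⟩ := h'
  obtain ⟨x, hx⟩ := hne
  refine ⟨_, ho.subst hN ho' (hX hx), ?_⟩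
  intro u hu w hw hwX hn
  by_cases hwN : w ∈ N
  · simp only [hX hu, hwN, if_true]
    exact hb' u hu w hwN hwX hn
  · simp only [hX hu, hwN, if_true, if_false]
    refine hb x (hX hx) w hw hwN fun hc => hn ?_
    exact ((hN.adj_iff w hw hwN x (hX hx) u (hX hu)).1 hc.symm).symm

/-- `w` is reached from `v` by a path in `N \ X` that avoids the neighbours of `u`. -/
def Linked (G : SimpleGraph V) (N X : Set V) (u v w : V) : Prop :=
  (v ∈ N ∧ v ∉ X ∧ ¬ G.Adj u v) ∧
    Relation.ReflTransGen (fun a b => G.Adj a b ∧ b ∈ N ∧ b ∉ X ∧ ¬ G.Adj u b) v w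

theorem Linked.mono {N X X' : Set V} {u v w : V} (h : Linked G N X u v w) (hX : X' ⊆ X) :
    Linked G N X' u v w :=
  ⟨⟨h.1.1, fun hc => h.1.2.1 (hX hc), h.1.2.2⟩, Relation.ReflTransGen.mono
    (fun _ _ hab => ⟨hab.1, hab.2.1, fun hc => hab.2.2.1 (hX hc), hab.2.2.2⟩) _ _ h.2⟩

theorem Linked.induct {N X : Set V} {u v w : V} (h : Linked G N X u v w) {P : V → Prop}
    (h0 : P v) (hs : ∀ a b : V, a ∈ N → a ∉ X → P a → G.Adj a b → b ∈ N → b ∉ X → ¬ G.Adj u b → P b) :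
    P w := by
  have : P w ∧ w ∈ N ∧ w ∉ X := by
    have h2 := h.2
    induction h2 with
    | refl => exact ⟨h0, h.1.1, h.1.2.1⟩
    | tail _ hab ih =>
      have ih := ih ⟨h.1, by assumption⟩
      exact ⟨hs _ _ ih.2.1 ih.2.2 ih.1 hab.1 hab.2.1 hab.2.2.1 hab.2.2.2, hab.2.1, hab.2.2.1⟩
  exact this.1

/-- A module all of whose nonadjacent rest is linked to one vertex can be moved to the front. -/
theorem canPrecede_of_linked {N X : Set V} {v : V} (hN : ∃ lt, IsTransOrient G N lt)
    (hX : IsModuleIn G N X)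
    (hl : ∀ u ∈ X, ∀ w ∈ N, w ∉ X → ¬ G.Adj u w → Linked G N X u v w) : CanPrecede G N X := by
  obtain ⟨lt, ho⟩ := hN
  by_cases hex : ∃ u ∈ X, ∃ w ∈ N, w ∉ X ∧ ¬ G.Adj u w
  swap
  · push Not at hex
    exact ⟨lt, ho, fun u hu w hw hwX hn => absurd (hex u hu w hw hwX) hn⟩
  obtain ⟨u, hu, w, hw, hwX, hn⟩ := hex
  obtain ⟨hv, hvX, huv⟩ := (hl u hu w hw hwX hn).1
  have hne : ∀ a ∈ X, ∀ b, b ∉ X → a ≠ b := fun a ha b hb hc => hb (hc ▸ ha)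
  have front : ∀ lt, IsTransOrient G N lt → lt u v → CanPrecede G N X := by
    intro lt ho hlt
    refine ⟨_, ho.move_front hX hu (fun z hz hzX hn => ?_), ?_⟩
    -- No vertex of the linking path is adjacent to `u`, and consecutive ones are adjacent to each
    -- other, so the whole path stays on the side of `u` on which `v` lies.
    · refine (hl u hu z hz hzX hn).induct (P := fun z => lt u z) hlt ?_
      intro p q hp _ hup hpq hq hqX huq
      exact ho.lt_of_adj_right (hX.subset hu) hp hq hup hpq (hne u hu q hqX) huq
    · intro a ha w _ hwX hn
      simp only [ha, hwX, if_true, if_false]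
      exact hn
  -- If `v` precedes `u`, the reversed orientation serves instead.
  rcases ho.total u (hX.subset hu) v hv (hne u hu v hvX) huv with h1 | h1
  · exact front lt ho h1
  · exact front _ ho.reverse h1

end Orientation

/-! ### Partition refinement and the invariants of the two sweeps -/

section Sweep

variable {V : Type*} [Fintype V] {G : SimpleGraph V}

open Classical in
/-- Split the classes of `c`, moving the vertices that satisfy `B` to the end of their class. The
label of a vertex is the number of vertices of earlier classes. -/
noncomputable def split (c : V → ℕ) (B : V → Prop) (u : V) : ℕ :=
  c u + if B u then (Finset.univ.filter fun x => c x = c u ∧ ¬ B x).card else 0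

-- Such labels leave a gap of the size of the class before the next label. A split uses only this
-- gap, so classes never collide, and injective labels are positions.
open Classical in
def ValidLabel (c : V → ℕ) : Prop := ∀ u, c u = (Finset.univ.filter fun x => c x < c u).card

theorem ValidLabel.add_le {c : V → ℕ} (h : ValidLabel c) {u w : V} (huw : c u < c w) :
    c u + Nat.card {x // c x = c u} ≤ c w := by
  classical
  rw [Nat.card_eq_fintype_card, Fintype.card_subtype]
  have h1 : (Finset.univ.filter fun x => c x < c u).card +
      (Finset.univ.filter fun x => c x = c u).card ≤
      (Finset.univ.filter fun x => c x < c w).card := by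
    rw [← Finset.card_union_of_disjoint]
    · apply Finset.card_le_card
      intro x
      simp only [Finset.mem_union, Finset.mem_filter, Finset.mem_univ, true_and]
      omega
    · rw [Finset.disjoint_left]
      intro x
      simp only [Finset.mem_filter, Finset.mem_univ, true_and]
      omega
  rwa [← h u, ← h w] at h1

theorem split_lt {c : V → ℕ} {B : V → Prop} (u : V) :
    split c B u < c u + Nat.card {x // c x = c u} := by
  classical
  rw [Nat.card_eq_fintype_card, Fintype.card_subtype]
  unfold split
  split_ifs with hB
  · refine Nat.add_lt_add_left (Finset.card_lt_card ?_) _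
    rw [Finset.ssubset_iff_of_subset]
    · exact ⟨u, by simp, by simp [hB]⟩
    · intro x
      simp only [Finset.mem_filter, Finset.mem_univ, true_and]
      exact fun h => h.1
  · refine Nat.add_lt_add_left (Finset.card_pos.2 ⟨u, by simp⟩) _

theorem le_split {c : V → ℕ} {B : V → Prop} (u : V) : c u ≤ split c B u := Nat.le_add_right _ _

/-- New labels stay inside the gap of their old class, so the order of the classes is refined
lexicographically by the flag `B`. -/
theorem ValidLabel.split_lt_split {c : V → ℕ} (h : ValidLabel c) {B : V → Prop} {u w : V} :
    split c B u < split c B w ↔ c u < c w ∨ (c u = c w ∧ ¬ B u ∧ B w) := by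
  classical
  have key : ∀ u w, c u < c w → split c B u < split c B w := fun u w huw =>
    (split_lt u).trans_le ((h.add_le huw).trans (le_split w))
  rcases lt_trichotomy (c u) (c w) with h1 | h1 | h1
  · simp [h1, key u w h1]
  · unfold split
    rw [h1]
    by_cases hu : B u <;> by_cases hw : B w <;> simp [hu, hw]
    exact ⟨u, by simp [h1, hu]⟩
  · have := key w u h1
    constructor
    · omega
    · omega

theorem ValidLabel.split_eq_split {c : V → ℕ} (h : ValidLabel c) {B : V → Prop} {u w : V} :
    split c B u = split c B w ↔ c u = c w ∧ (B u ↔ B w) := by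
  have h1 := h.split_lt_split (B := B) (u := u) (w := w)
  have h2 := h.split_lt_split (B := B) (u := w) (w := u)
  have : split c B u = split c B w ↔ ¬ split c B u < split c B w ∧ ¬ split c B w < split c B u := by
    omega
  rw [this, h1, h2]
  constructor
  · rintro ⟨h3, h4⟩
    refine ⟨by omega, ?_⟩
    by_cases hu : B u <;> by_cases hw : B w <;> simp [hu, hw] at h3 h4 ⊢ <;> omega
  · rintro ⟨h3, h4⟩
    simp [h3, h4]

theorem ValidLabel.split {c : V → ℕ} (h : ValidLabel c) (B : V → Prop) :
    ValidLabel (split c B) := by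
  classical
  intro u
  have h1 : (Finset.univ.filter fun x => BCS.split c B x < BCS.split c B u) =
      (Finset.univ.filter fun x => c x < c u) ∪
        (Finset.univ.filter fun x => c x = c u ∧ ¬ B x ∧ B u) := by
    ext x
    simp [h.split_lt_split]
  rw [h1, Finset.card_union_of_disjoint, ← h u]
  · unfold BCS.split
    congr 1
    split_ifs with hB <;> simp [hB]
  · rw [Finset.disjoint_left]
    intro x
    simp only [Finset.mem_filter, Finset.mem_univ, true_and]
    omega

/-- The vertices of a class that a pivot `p` of another class moves to the end of the class: its
neighbours if the class precedes `p`, its non-neighbours if the class follows `p`. -/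
def Later (G : SimpleGraph V) (c : V → ℕ) (p u : V) : Prop :=
  (c u < c p ∧ G.Adj u p) ∨ (c p < c u ∧ ¬ G.Adj u p)

/-- Labellings obtained from the trivial one by splitting with pivots and by moving a vertex `v`
with `ok c v` to the end of its class, provided that no pivot splits this class. -/
inductive Reach (G : SimpleGraph V) (ok : (V → ℕ) → V → Prop) : (V → ℕ) → Prop
  | zero : Reach G ok fun _ => 0
  | pivot {c : V → ℕ} (h : Reach G ok c) (p : V) : Reach G ok (split c (Later G c p))
  | fresh {c : V → ℕ} (h : Reach G ok c) (v : V) (hv : ok c v)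
      (hs : IsModuleIn G Set.univ {u | c u = c v}) : Reach G ok (split c (· = v))

variable {ok : (V → ℕ) → V → Prop}

theorem Reach.valid {c : V → ℕ} (h : Reach G ok c) : ValidLabel c := by
  induction h with
  | zero => intro u; simp
  | pivot h p ih => exact ih.split _
  | fresh h v hv hs ih => exact ih.split _

/-- The first class of `M`. -/
def firstClass (c : V → ℕ) (M : Set V) : Set V := {u | u ∈ M ∧ ∀ w ∈ M, c u ≤ c w}

theorem firstClass_nonempty (c : V → ℕ) {M : Set V} (hM : M.Nonempty) :
    (firstClass c M).Nonempty := by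
  obtain ⟨u, hu, hmin⟩ := Set.exists_min_image M c (Set.toFinite M) hM
  exact ⟨u, hu, hmin⟩

theorem firstClass_split_of_forall {c : V → ℕ} (h : ValidLabel c) {M : Set V} {B : V → Prop}
    (hB : ∀ u ∈ firstClass c M, ∀ w ∈ firstClass c M, B u → B w) :
    firstClass (split c B) M = firstClass c M := by
  ext u
  simp only [firstClass, Set.mem_ofPred_eq]
  constructor
  · rintro ⟨hu, hmin⟩
    refine ⟨hu, fun w hw => ?_⟩
    have := hmin w hw
    rw [← not_lt, h.split_lt_split] at this
    push Not at this
    omega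
  · rintro ⟨hu, hmin⟩
    refine ⟨hu, fun w hw => ?_⟩
    rw [← not_lt, h.split_lt_split]
    rintro (h1 | ⟨h1, h2, h3⟩)
    · have := hmin w hw; omega
    · exact h2 (hB u ⟨hu, hmin⟩ w ⟨hw, fun x hx => h1 ▸ hmin x hx⟩ h3)

theorem firstClass_split_of_exists {c : V → ℕ} (h : ValidLabel c) {M : Set V} {B : V → Prop}
    (hB : ∃ u ∈ firstClass c M, ¬ B u) :
    firstClass (split c B) M = {u | u ∈ firstClass c M ∧ ¬ B u} := by
  obtain ⟨a, ha, haB⟩ := hB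
  ext u
  simp only [firstClass, Set.mem_ofPred_eq]
  constructor
  · rintro ⟨hu, hmin⟩
    have h1 : ∀ w ∈ M, c u ≤ c w := by
      intro w hw
      have := hmin w hw
      rw [← not_lt, h.split_lt_split] at this
      push Not at this
      omega
    refine ⟨⟨hu, h1⟩, fun hBu => ?_⟩
    have := hmin a ha.1
    rw [← not_lt, h.split_lt_split] at this
    push Not at this
    exact this.2 (le_antisymm (ha.2 u hu) (h1 a ha.1)) haB hBu
  · rintro ⟨⟨hu, hmin⟩, hBu⟩
    refine ⟨hu, fun w hw => ?_⟩
    rw [← not_lt, h.split_lt_split]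
    rintro (h1 | ⟨h1, h2, h3⟩)
    · have := hmin w hw; omega
    · exact hBu h3

/-- The invariant of the first sweep for a module `M`. -/
def FrontInv (G : SimpleGraph V) (c : V → ℕ) (M : Set V) : Prop :=
  ∃ (N : Set V) (v : V), firstClass c M ⊆ N ∧ IsModuleIn G M N ∧ CanPrecede G M N ∧
    ∀ u ∈ firstClass c M, ∀ w ∈ N, w ∉ firstClass c M → ¬ G.Adj u w →
      Linked G N (firstClass c M) u v w

/-- The links move the first class to the front of `N`, and `N` can itself be put in front of the
rest of `M`. -/
theorem FrontInv.canPrecede {c : V → ℕ} {M : Set V} (h : FrontInv G c M) (hM : M.Nonempty)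
    (hX : IsModuleIn G M (firstClass c M)) : CanPrecede G M (firstClass c M) := by
  obtain ⟨N, v, h1, h2, h3, h4⟩ := h
  obtain ⟨lt, ho, -⟩ := id h3
  exact h3.trans h2 h1 (firstClass_nonempty c hM)
    (canPrecede_of_linked ⟨lt, ho.mono h2.subset⟩ (hX.mono h2.subset h1) h4)

/-- A pivot `p` that splits the first class distinguishes two of its vertices. Hence `p` lies in the
module `M`, in its module `N`, and behind the first class, so the vertices moved away are the
neighbours of `p`. A vertex `u` that stays is not adjacent to `p`, so `p` was linked to `v` with
respect to `u`, and one more step links the moved vertices. A chosen vertex splits the first class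
only when that class is a module of `M`. The class then becomes the new `N`, and the chosen vertex,
the only one moved, becomes the new `v`. The choice itself is irrelevant: `ok` plays no role. -/
theorem Reach.frontInv {c : V → ℕ} (h : Reach G ok c) {M : Set V} (hM : IsModuleIn G Set.univ M)
    (hne : M.Nonempty) {lt : V → V → Prop} (ho : IsTransOrient G Set.univ lt) :
    FrontInv G c M := by
  induction h with
  | zero =>
    have hf : firstClass (fun _ => 0) M = M := by ext; simp [firstClass]
    refine ⟨M, hne.some, hf.subset, ⟨subset_rfl, fun p hp hn => absurd hp hn⟩,
      ⟨lt, ho.mono (Set.subset_univ _), fun u _ w hw hn => absurd hw hn⟩, ?_⟩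
    rw [hf]
    exact fun u _ w hw hn => absurd hw hn
  | @pivot c h p ih =>
    have hval := h.valid
    by_cases hall : ∀ u ∈ firstClass c M, ∀ w ∈ firstClass c M, Later G c p u → Later G c p w
    · unfold FrontInv
      rwa [firstClass_split_of_forall hval hall]
    push Not at hall
    obtain ⟨b, hb, a, ha, hbB, haB⟩ := hall
    obtain ⟨N, v, h1, h2, h3, h4⟩ := ih
    have hcab : c a = c b := le_antisymm (ha.2 b hb.1) (hb.2 a ha.1)
    have hnadj : ¬ (G.Adj p a ↔ G.Adj p b) := by
      rw [G.adj_comm p a, G.adj_comm p b]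
      unfold Later at hbB haB
      rw [hcab] at haB
      tauto
    have hpX : p ∉ firstClass c M := by
      intro hc
      have : c p = c b := le_antisymm (hc.2 b hb.1) (hb.2 p hc.1)
      unfold Later at hbB
      omega
    have hpM : p ∈ M := by
      by_contra hc
      exact hnadj (hM.adj_iff p trivial hc a ha.1 b hb.1)
    have hpN : p ∈ N := by
      by_contra hc
      exact hnadj (h2.adj_iff p hpM hc a (h1 ha) b (h1 hb))
    have hlater : ∀ u ∈ firstClass c M, (Later G c p u ↔ G.Adj u p) := by
      intro u hu
      have h5 : c u = c b := le_antisymm (hu.2 b hb.1) (hb.2 u hu.1)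
      have h6 : c b ≤ c p := hb.2 p hpM
      unfold Later at hbB ⊢
      rw [h5]
      have : c b < c p := by omega
      simp [this, this.le]
    have hX := firstClass_split_of_exists hval ⟨a, ha, haB⟩
    have hsub : firstClass (split c (Later G c p)) M ⊆ firstClass c M := by
      rw [hX]; exact fun u hu => hu.1
    refine ⟨N, v, hsub.trans h1, h2, h3, ?_⟩
    intro u hu w hw hwX hn
    have hu' := hu
    rw [hX] at hu'
    have hup : ¬ G.Adj u p := fun hc => hu'.2 ((hlater u hu'.1).2 hc)
    by_cases hwX' : w ∈ firstClass c M
    · have hpw : G.Adj p w := by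
        by_contra hc
        refine hwX ?_
        rw [hX]
        exact ⟨hwX', fun hl => hc ((hlater w hwX').1 hl).symm⟩
      have h5 := (h4 u hu'.1 p hpN hpX hup).mono hsub
      exact ⟨h5.1, h5.2.tail ⟨hpw, hw, hwX, hn⟩⟩
    · exact (h4 u hu'.1 w hw hwX' hn).mono hsub
  | @fresh c h v hv hs ih =>
    have hval := h.valid
    by_cases hall : ∀ u ∈ firstClass c M, ∀ w ∈ firstClass c M, u = v → w = v
    · unfold FrontInv
      rwa [firstClass_split_of_forall hval hall]
    push Not at hall
    obtain ⟨b, hb, a, ha, rfl, hab⟩ := hall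
    have hX := firstClass_split_of_exists (B := (· = b)) hval ⟨a, ha, hab⟩
    have hsub : firstClass (split c (· = b)) M ⊆ firstClass c M := by
      rw [hX]; exact fun u hu => hu.1
    -- The first class of `M` is the trace on `M` of the class of `b`, which is a module of the
    -- whole graph.
    have hmod : IsModuleIn G M (firstClass c M) := by
      refine ⟨fun u hu => hu.1, fun p hp hpX u hu w hw => ?_⟩
      have h5 : ∀ x ∈ firstClass c M, c x = c b := fun x hx =>
        le_antisymm (hx.2 b hb.1) (hb.2 x hx.1)
      refine hs.adj_iff p trivial (fun hc => hpX ⟨hp, fun x hx => ?_⟩) u (h5 u hu) w (h5 w hw)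
      rw [hc]
      exact hb.2 x hx
    refine ⟨firstClass c M, b, hsub, hmod, ih.canPrecede hne hmod, ?_⟩
    intro u hu w hw hwX hn
    obtain rfl : w = b := by
      by_contra hc
      refine hwX ?_
      rw [hX]
      exact ⟨hw, hc⟩
    exact ⟨⟨hw, hwX, hn⟩, .refl⟩

/-- The vertex that the first sweep puts first in a module can precede the rest of the module. -/
theorem Reach.canPrecede_singleton {c : V → ℕ} (h : Reach G ok c) (hc : Function.Injective c)
    {M : Set V} (hM : IsModuleIn G Set.univ M) {lt : V → V → Prop}
    (ho : IsTransOrient G Set.univ lt) {v : V} (hv : v ∈ M) (hmin : ∀ u ∈ M, c v ≤ c u) :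
    CanPrecede G M {v} := by
  have hX : firstClass c M = {v} := by
    ext u
    simp only [firstClass, Set.mem_ofPred_eq, Set.mem_singleton_iff]
    constructor
    · exact fun hu => hc (le_antisymm (hu.2 v hv) (hmin u hu.1))
    · rintro rfl; exact ⟨hv, hmin⟩
  rw [← hX]
  refine (h.frontInv hM ⟨v, hv⟩ ho).canPrecede ⟨v, hv⟩ ?_
  rw [hX]
  refine ⟨by simpa using hv, fun p hp hpv u hu w hw => ?_⟩
  rw [Set.mem_singleton_iff] at hu hw
  rw [hu, hw]

/-- If every chosen vertex can precede its class, then the labels are compatible with some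
transitive orientation of the complement. -/
theorem Reach.exists_orient {c : V → ℕ} (h : Reach G ok c)
    (hok : ∀ c v, ok c v → IsModuleIn G Set.univ {u | c u = c v} →
      CanPrecede G {u | c u = c v} {v})
    {lt : V → V → Prop} (ho : IsTransOrient G Set.univ lt) :
    ∃ lt, IsTransOrient G Set.univ lt ∧ ∀ u w, c u < c w → ¬ G.Adj u w → lt u w := by
  induction h with
  | zero => exact ⟨lt, ho, fun u w h => absurd h (lt_irrefl 0)⟩
  | @pivot c h p ih =>
    obtain ⟨lt, ho, hlt⟩ := ih
    refine ⟨lt, ho, fun u w huw hn => ?_⟩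
    have hne : u ≠ w := by rintro rfl; exact lt_irrefl _ huw
    rw [h.valid.split_lt_split] at huw
    -- Of two vertices separated by `p`, one is not adjacent to `p` and is already ordered relative
    -- to it. The other is adjacent to `p`, so it lies on the same side of the first one as `p`
    -- does.
    rcases huw with h1 | ⟨h1, h2, h3 | h3⟩
    · exact hlt u w h1 hn
    · have hup : ¬ G.Adj u p := fun hc => h2 (.inl ⟨by omega, hc⟩)
      exact ho.lt_of_adj_right trivial trivial trivial (hlt u p (by omega) hup) h3.2.symm hne hn
    · have hup : G.Adj u p := by
        by_contra hc
        exact h2 (.inr ⟨by omega, hc⟩)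
      have h4 := hlt p w h3.1 fun hc => h3.2 hc.symm
      exact ho.lt_of_adj_left trivial trivial trivial h4 hup.symm hne.symm fun hc => hn hc.symm
  | @fresh c h v hv hs ih =>
    obtain ⟨lt, ho, hlt⟩ := ih
    obtain ⟨lt', ho', hb⟩ := hok c v hv hs
    -- The orientation with `v` in front is reversed because the sweep moves `v` to the end of its
    -- class.
    refine ⟨_, ho.subst hs ho'.reverse (u₀ := v) rfl, fun u w huw hn => ?_⟩
    rw [h.valid.split_lt_split] at huw
    simp only [Set.mem_ofPred_eq]
    rcases huw with h1 | ⟨h1, h2, rfl⟩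
    · by_cases hu : c u = c v <;> by_cases hw : c w = c v <;> simp only [hu, hw, if_true, if_false]
      · omega
      · refine hlt v w (by omega) fun hc => hn ?_
        exact ((hs.adj_iff w trivial hw v rfl u hu).1 hc.symm).symm
      · refine hlt u v (by omega) fun hc => hn ?_
        exact (hs.adj_iff u trivial hu v rfl w hw).1 hc
      · exact hlt u w h1 hn
    · simp only [h1, if_true]
      exact hb w rfl u h1 h2 fun hc => hn hc.symm

end Sweep

end BCS

namespace BCS

/-! ### Progress of the refinement -/

section Progress

variable {V : Type*} [Fintype V] {G : SimpleGraph V} {c : V → ℕ}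

/-- No label is lost: vertices that stay keep it, and if the whole class is flagged then nobody
stays and the shift is zero. -/
theorem image_subset_image_split (B : V → Prop) :
    Finset.univ.image c ⊆ Finset.univ.image (split c B) := by
  classical
  intro a ha
  simp only [Finset.mem_image, Finset.mem_univ, true_and] at ha ⊢
  obtain ⟨u, rfl⟩ := ha
  by_cases h : ∃ w, c w = c u ∧ ¬ B w
  · obtain ⟨w, hw, hB⟩ := h
    exact ⟨w, by simp [split, hB, hw]⟩
  · push Not at h
    refine ⟨u, ?_⟩
    simp only [split, Nat.add_eq_left]
    split_ifs with hu
    · rw [Finset.card_eq_zero, Finset.filter_eq_empty_iff]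
      exact fun x _ hx => hx.2 (h x hx.1)
    · rfl

/-- A changed label lies strictly between the old label of its class and the next one, so it was not
in use. -/
theorem ValidLabel.card_image_lt (h : ValidLabel c) {B : V → Prop} (hne : BCS.split c B ≠ c) :
    (Finset.univ.image c).card < (Finset.univ.image (BCS.split c B)).card := by
  classical
  refine Finset.card_lt_card ((Finset.ssubset_iff_of_subset (image_subset_image_split B)).2 ?_)
  obtain ⟨u, hu⟩ := Function.ne_iff.1 hne
  refine ⟨BCS.split c B u, by simp, ?_⟩
  simp only [Finset.mem_image, Finset.mem_univ, true_and, not_exists]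
  intro w hw
  have h1 := le_split (c := c) (B := B) u
  have h2 := split_lt (c := c) (B := B) u
  have h3 := h.add_le (u := u) (w := w) (by omega)
  omega

/-- If a pivot moves a vertex of a class without changing its label, then no vertex of the class
stays behind. So the pivot is adjacent to all of the class or to none of it. -/
theorem isModuleIn_of_split_eq (h : ∀ p, split c (Later G c p) = c) (v : V) :
    IsModuleIn G Set.univ {u | c u = c v} := by
  classical
  refine ⟨Set.subset_univ _, fun p _ hp u hu w hw => ?_⟩
  simp only [Set.mem_ofPred_eq] at hp hu hw
  have key : ∀ u w, c u = c v → c w = c v → Later G c p u → Later G c p w := by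
    intro u w hu hw hl
    by_contra hl'
    have h1 := congrFun (h p) u
    simp only [split, hl, if_true, Nat.add_eq_left, Finset.card_eq_zero,
      Finset.filter_eq_empty_iff] at h1
    exact h1 (Finset.mem_univ w) ⟨by omega, hl'⟩
  have h1 := key u w hu hw
  have h2 := key w u hw hu
  unfold Later at h1 h2
  rw [G.adj_comm p u, G.adj_comm p w]
  rw [hu, hw] at h1 h2
  rcases lt_or_gt_of_ne hp with h3 | h3
  · simp only [h3, h3.not_gt, false_and, true_and, false_or] at h1 h2
    tauto
  · simp only [h3, h3.not_gt, false_and, true_and, or_false] at h1 h2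
    tauto

/-- `c v` is the number of vertices with a smaller label, so injective labels are positions. -/
theorem ValidLabel.lt_card (h : ValidLabel c) (v : V) : c v < Fintype.card V := by
  have h1 : c v < c v + Nat.card {x // c x = c v} := by
    have : Nonempty {x // c x = c v} := ⟨v, rfl⟩
    have := Nat.card_pos (α := {x // c x = c v})
    omega
  classical
  refine lt_of_lt_of_le (b := c v + 1) (Nat.lt_succ_self _) ?_
  rw [h v]
  have : (Finset.univ.filter fun x => c x < c v) ⊂ Finset.univ := by
    rw [Finset.ssubset_iff_of_subset (Finset.subset_univ _)]
    exact ⟨v, by simp, by simp⟩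
  exact Finset.card_lt_card this

end Progress

section Rank

variable {V : Type*} [Fintype V]

/-- The number of vertices of smaller key. -/
def rank (key : V → ℕ) (v : V) : ℕ := (Finset.univ.filter fun u => key u < key v).card

theorem rank_lt_rank {key : V → ℕ} {u v : V} : rank key u < rank key v ↔ key u < key v := by
  have h1 : ∀ u v, key u ≤ key v → rank key u ≤ rank key v := by
    intro u v huv
    refine Finset.card_le_card fun x => ?_
    simp only [Finset.mem_filter, Finset.mem_univ, true_and]
    omega
  constructor
  · intro h
    by_contra hc
    have := h1 v u (not_lt.1 hc)
    omega
  · intro h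
    refine Finset.card_lt_card ?_
    rw [Finset.ssubset_iff_of_subset]
    · exact ⟨u, by simpa using h, by simp⟩
    · intro x
      simp only [Finset.mem_filter, Finset.mem_univ, true_and]
      omega

theorem rank_lt_card (key : V → ℕ) (v : V) : rank key v < Fintype.card V := by
  have : (Finset.univ.filter fun u => key u < key v) ⊂ Finset.univ := by
    rw [Finset.ssubset_iff_of_subset (Finset.subset_univ _)]
    exact ⟨v, by simp, by simp⟩
  exact Finset.card_lt_card this

theorem rank_injective {key : V → ℕ} (h : Function.Injective key) :
    Function.Injective (rank key) := by
  intro u v huv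
  have h1 := rank_lt_rank (key := key) (u := u) (v := v)
  have h2 := rank_lt_rank (key := key) (u := v) (v := u)
  exact h (by omega)

end Rank

/-! ### From an orientation to an interval representation -/

section Order

variable {V : Type*} {G : SimpleGraph V}

theorem IsIntervalRep.isTransOrient {α : Type*} [LinearOrder α] {l r : V → α}
    (h : IsIntervalRep G l r) : IsTransOrient G Set.univ fun u v => r u < l v := by
  refine ⟨fun a _ b _ hab => ?_, fun a _ b _ hab hn => ?_, fun a _ b _ c _ hab hbc =>
    hab.trans_le ((h.le b).trans hbc.le)⟩
  · have hne : a ≠ b := by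
      rintro rfl
      exact absurd (h.le a) (not_le.2 hab)
    exact ⟨hne, fun hadj => absurd ((h.adj_iff_le hne).1 hadj).2 (not_le.2 hab)⟩
  · rw [h.adj_iff_le hab, not_and_or, not_le, not_le] at hn
    exact hn.symm

/-- Interval graphs have no induced cycle of length four. -/
theorem IsIntervalGraph.no_square (h : IsIntervalGraph G) {x b a y : V} (hxb : G.Adj x b)
    (hba : G.Adj b a) (hay : G.Adj a y) (hyx : G.Adj y x) (hxa : x ≠ a) (hby : b ≠ y) :
    G.Adj x a ∨ G.Adj b y := by
  obtain ⟨l, r, h⟩ := h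
  rw [h.adj_iff_le hxa, h.adj_iff_le hby]
  have h1 := (h.adj_iff_le hxb.ne).1 hxb
  have h2 := (h.adj_iff_le hba.ne).1 hba
  have h3 := (h.adj_iff_le hay.ne).1 hay
  have h4 := (h.adj_iff_le hyx.ne).1 hyx
  by_contra! hc
  rcases le_or_gt (l x) (r a) with h5 | h5
  · have h6 := hc.1 h5
    rcases le_or_gt (l b) (r y) with h7 | h7
    · have := hc.2 h7; linarith
    · linarith
  · rcases le_or_gt (l b) (r y) with h7 | h7
    · have := hc.2 h7; linarith
    · linarith

variable [Fintype V]

open Classical in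
/-- The number of vertices that precede `v` in the orientation of the complement given by `c`. -/
noncomputable def predCount (G : SimpleGraph V) (c : V → ℕ) (v : V) : ℕ :=
  (Finset.univ.filter fun u => c u < c v ∧ ¬ G.Adj u v).card

/-- Predecessor sets are nested in the order of their sizes. If `a` and `b` were not adjacent, then
either `a` precedes `b` and hence also `d`, against the adjacency of `a` and `d`, or `b` precedes
`a` and hence itself. -/
theorem adj_of_predCount_le (hG : IsIntervalGraph G) {c : V → ℕ}
    (ho : IsTransOrient G Set.univ fun u w => c u < c w ∧ ¬ G.Adj u w) {a b d : V}
    (hab : predCount G c a ≤ predCount G c b) (hbd : predCount G c b ≤ predCount G c d)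
    (hne : a ≠ b) (had : G.Adj a d) : G.Adj a b := by
  classical
  have nested : ∀ a b, predCount G c a ≤ predCount G c b → ∀ x, c x < c a → ¬ G.Adj x a →
      c x < c b ∧ ¬ G.Adj x b := by
    intro a b hab x hxa hnxa
    by_contra hxb
    -- `a` has at most as many predecessors as `b`, but one that `b` lacks, so `b` has a predecessor
    -- `y` that `a` lacks. Transitivity then makes `x`, `b`, `a`, `y` an induced four-cycle.
    have hex : ∃ y, (c y < c b ∧ ¬ G.Adj y b) ∧ ¬ (c y < c a ∧ ¬ G.Adj y a) := by
      by_contra! hc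
      refine absurd hab (not_le.2 (Finset.card_lt_card ?_))
      rw [Finset.ssubset_iff_of_subset]
      · exact ⟨x, by simp [hxa, hnxa], by simpa using hxb⟩
      · intro y
        simp only [Finset.mem_filter, Finset.mem_univ, true_and]
        exact fun hy => hc y hy
    obtain ⟨y, hyb, hya⟩ := hex
    have hx : c x < c a ∧ ¬ G.Adj x a := ⟨hxa, hnxa⟩
    have tr : ∀ p q r : V, (c p < c q ∧ ¬ G.Adj p q) → (c q < c r ∧ ¬ G.Adj q r) →
        (c p < c r ∧ ¬ G.Adj p r) := fun p q r =>
      ho.trans p trivial q trivial r trivial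
    have tot : ∀ p q : V, p ≠ q → ¬ G.Adj p q →
        (c p < c q ∧ ¬ G.Adj p q) ∨ (c q < c p ∧ ¬ G.Adj q p) := fun p q =>
      ho.total p trivial q trivial
    have adj_xb : G.Adj x b := by
      by_contra hn
      rcases eq_or_ne x b with rfl | hne
      · exact hya (tr _ _ _ hyb hx)
      · rcases tot x b hne hn with h1 | h1
        · exact hxb h1
        · exact hya (tr _ _ _ (tr _ _ _ hyb h1) hx)
    have adj_ya : G.Adj y a := by
      by_contra hn
      rcases eq_or_ne y a with rfl | hne
      · exact hxb (tr _ _ _ hx hyb)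
      · rcases tot y a hne hn with h1 | h1
        · exact hya h1
        · exact hxb (tr _ _ _ (tr _ _ _ hx h1) hyb)
    have adj_xy : G.Adj y x := by
      by_contra hn
      rcases eq_or_ne y x with rfl | hne
      · exact hya hx
      · rcases tot y x hne hn with h1 | h1
        · exact hya (tr _ _ _ h1 hx)
        · exact hxb (tr _ _ _ h1 hyb)
    have adj_ab : G.Adj b a := by
      by_contra hn
      rcases eq_or_ne b a with rfl | hne
      · exact hya hyb
      · rcases tot b a hne hn with h1 | h1
        · exact hya (tr _ _ _ hyb h1)
        · exact hxb (tr _ _ _ hx h1)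
    have hxa' : x ≠ a := by rintro rfl; omega
    have hby' : b ≠ y := by rintro rfl; omega
    rcases hG.no_square adj_xb adj_ab adj_ya.symm adj_xy hxa' hby' with h1 | h1
    · exact hnxa h1
    · exact hyb.2 h1.symm
  by_contra hn
  rcases ho.total a trivial b trivial hne hn with h1 | h1
  · exact (nested b d hbd a h1.1 h1.2).2 had
  · have := (nested a b hab b h1.1 h1.2).1
    omega

open Classical in
/-- The largest position in the closed neighbourhood. -/
noncomputable def reachPos (G : SimpleGraph V) (pos : V → ℕ) (v : V) : ℕ :=
  (Finset.univ.filter fun u => u = v ∨ G.Adj v u).sup pos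

/-- If the position of `v` lies in the interval of `u`, then `v` lies between `u` and the last
member of the closed neighbourhood of `u`, and the hypothesis makes `v` adjacent to `u`. -/
theorem isIntervalRep_of_umbrella {pos : V → ℕ} (hpos : Function.Injective pos)
    (h : ∀ a b d, pos a ≤ pos b → pos b ≤ pos d → a ≠ b → G.Adj a d → G.Adj a b) :
    IsIntervalRep G pos (reachPos G pos) := by
  classical
  have hself : ∀ v, pos v ≤ reachPos G pos v := fun v =>
    Finset.le_sup (f := pos) (by simp)
  have hadj : ∀ u v, G.Adj u v → pos v ≤ reachPos G pos u := fun u v huv =>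
    Finset.le_sup (f := pos) (by simp [huv])
  have key : ∀ u v, u ≠ v → pos u ≤ pos v → pos v ≤ reachPos G pos u → G.Adj u v := by
    intro u v hne huv hv
    obtain ⟨w, hw, hwr⟩ := Finset.exists_mem_eq_sup
      (Finset.univ.filter fun w => w = u ∨ G.Adj u w) ⟨u, by simp⟩ pos
    change reachPos G pos u = pos w at hwr
    rw [hwr] at hv
    simp only [Finset.mem_filter, Finset.mem_univ, true_and] at hw
    rcases hw with rfl | hw
    · exact absurd (hpos (le_antisymm huv hv)) hne
    · exact h u v w huv hv hne hw
  refine ⟨hself, fun u v hne => ⟨fun huv => ?_, ?_⟩⟩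
  · exact ⟨max (pos u) (pos v), ⟨le_max_left _ _, max_le (hself u) (hadj u v huv)⟩,
      le_max_right _ _, max_le (hadj v u huv.symm) (hself v)⟩
  · rintro ⟨x, ⟨h1, h2⟩, h3, h4⟩
    rcases le_total (pos u) (pos v) with h5 | h5
    · exact key u v hne h5 (h3.trans h2)
    · exact (key v u hne.symm h5 (h1.trans h4)).symm

end Order

/-! ### Two sweeps give a transitive orientation -/

section TwoSweeps

variable {n : ℕ} {G : SimpleGraph (Fin n)}

/-- `v` has the smallest key in its class. -/
def IsFirstByKey {V : Type*} (key : V → ℕ) (c : V → ℕ) (v : V) : Prop :=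
  ∀ u, c u = c v → key v ≤ key u

/-- The vertex of a module with the smallest label of the first sweep can precede the module, so
every choice of the second sweep is admissible. Its labels agree with a transitive orientation and,
being injective, decide every non-adjacent pair, so they are that orientation. -/
theorem isTransOrient_of_two_sweeps (hG : IsIntervalGraph G)
    {ok : (Fin n → ℕ) → Fin n → Prop} {c₁ c₂ : Fin n → ℕ} (h₁ : Reach G ok c₁)
    (hc₁ : Function.Injective c₁) (h₂ : Reach G (IsFirstByKey c₁) c₂)
    (hc₂ : Function.Injective c₂) :
    IsTransOrient G Set.univ fun u w => c₂ u < c₂ w ∧ ¬ G.Adj u w := by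
  obtain ⟨l, r, hrep⟩ := hG
  obtain ⟨lt, ho, hlt⟩ := h₂.exists_orient (fun c v hv hm =>
    h₁.canPrecede_singleton hc₁ hm hrep.isTransOrient (by rfl) hv) hrep.isTransOrient
  have hiff : ∀ u w, (c₂ u < c₂ w ∧ ¬ G.Adj u w) ↔ lt u w := by
    intro u w
    refine ⟨fun h => hlt u w h.1 h.2, fun h => ?_⟩
    obtain ⟨hne, hn⟩ := ho.ne_adj u trivial w trivial h
    refine ⟨?_, hn⟩
    by_contra hc
    have h3 : c₂ w ≠ c₂ u := fun h => hne (hc₂ h).symm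
    exact ho.asymm trivial trivial h (hlt w u (by omega) fun hc => hn hc.symm)
  have : (fun u w => c₂ u < c₂ w ∧ ¬ G.Adj u w) = lt := by
    ext u w; exact hiff u w
  rwa [this]

/-- The position of a vertex in the order by `predCount`, ties being broken by the index. -/
noncomputable def position (G : SimpleGraph (Fin n)) (c : Fin n → ℕ) : Fin n → ℕ :=
  rank fun v => predCount G c v * n + v

theorem predCount_le_of_key_lt {c : Fin n → ℕ} {u v : Fin n}
    (h : predCount G c u * n + u < predCount G c v * n + v) :
    predCount G c u ≤ predCount G c v := by
  by_contra hc
  have h1 : (predCount G c v + 1) * n ≤ predCount G c u * n := Nat.mul_le_mul_right _ (by omega)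
  have := v.2
  rw [Nat.add_mul] at h1
  omega

theorem position_injective (c : Fin n → ℕ) : Function.Injective (position G c) := by
  refine rank_injective fun u v huv => ?_
  have h1 : (predCount G c u * n + u) % n = (predCount G c v * n + v) % n := congrArg (· % n) huv
  rw [Nat.mul_add_mod_self_right, Nat.mul_add_mod_self_right, Nat.mod_eq_of_lt u.2,
    Nat.mod_eq_of_lt v.2] at h1
  exact Fin.ext h1

theorem isIntervalRep_position (hG : IsIntervalGraph G) {c : Fin n → ℕ}
    (ho : IsTransOrient G Set.univ fun u w => c u < c w ∧ ¬ G.Adj u w) :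
    IsIntervalRep G (position G c) (reachPos G (position G c)) := by
  have key : ∀ u v, position G c u ≤ position G c v → predCount G c u ≤ predCount G c v := by
    intro u v huv
    rcases eq_or_ne u v with rfl | hne
    · rfl
    · have h1 : position G c u ≠ position G c v := fun h => hne (position_injective c h)
      exact predCount_le_of_key_lt (rank_lt_rank.1 (lt_of_le_of_ne huv h1))
  exact isIntervalRep_of_umbrella (position_injective c) fun a b d hab hbd hne had =>
    adj_of_predCount_le hG ho (key a b hab) (key b d hbd) hne had

end TwoSweeps

end BCS

namespace BCS

/-! ### The dynamic programming table and its parent pointers -/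

section Table

variable {n : ℕ} {G : SimpleGraph (Fin n)} {B : Finset (Fin n)} {pos r : Fin n → ℕ}

/-- `S` is empty, with `k = n`, or a connected set of vertices of positions below `i` with largest
right end point `k`; its colour difference is `d - n`. -/
def PrefixSet (G : SimpleGraph (Fin n)) (B : Finset (Fin n)) (pos r : Fin n → ℕ)
    (i k d : ℕ) (S : Finset (Fin n)) : Prop :=
  ((S = ∅ ∧ k = n) ∨ (ConnectedSet G S ∧ S.sup r = k)) ∧ (∀ v ∈ S, pos v < i) ∧
    colorDiff B S + n = d

/-- The largest right end point after adding an interval with right end point `ρ`. -/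
def mergeEnd (n k ρ : ℕ) : ℕ := if k = n then ρ else max k ρ

/-- The shifted colour difference after adding `v`. -/
def shiftDiff (B : Finset (Fin n)) (v : Fin n) (d : ℕ) : ℕ := if v ∈ B then d + 1 else d - 1

theorem PrefixSet.mono {i k d : ℕ} {S : Finset (Fin n)} (h : PrefixSet G B pos r i k d S) :
    PrefixSet G B pos r (i + 1) k d S :=
  ⟨h.1, fun v hv => (h.2.1 v hv).trans (Nat.lt_succ_self i), h.2.2⟩

theorem sup_lt_of_connected (hr : ∀ v, r v < n) {S : Finset (Fin n)} (hS : S.Nonempty) :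
    S.sup r < n := by
  obtain ⟨v, -, hv⟩ := Finset.exists_mem_eq_sup S hS r
  rw [hv]; exact hr v

theorem natAbs_colorDiff_le (B S : Finset (Fin n)) :
    -(S.card : ℤ) ≤ colorDiff B S ∧ colorDiff B S ≤ S.card := by
  have := Finset.card_inter_add_card_sdiff S B
  unfold colorDiff
  omega

/-- End points may coincide in the computed representation, so the test is the weak inequality `i ≤
k`. The code `k = n` of the empty set exceeds every right end point and passes the test. Positivity
of `d` avoids truncation in `shiftDiff`. -/
theorem PrefixSet.insert_vertex (h : IsIntervalRep G pos r) (hr : ∀ v, r v < n) {i k d : ℕ}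
    {S : Finset (Fin n)} (hS : PrefixSet G B pos r i k d S) {v : Fin n} (hv : pos v = i)
    (hk : i ≤ k) (hd : 0 < d) :
    v ∉ S ∧ PrefixSet G B pos r (i + 1) (mergeEnd n k (r v)) (shiftDiff B v d) (insert v S) := by
  have hvS : v ∉ S := fun hc => by have := hS.2.1 v hc; omega
  refine ⟨hvS, .inr ?_, ?_, ?_⟩
  · rcases hS.1 with ⟨rfl, rfl⟩ | ⟨h1, h2⟩
    · simp [mergeEnd, connectedSet_singleton]
    · have h3 : k ≠ n := by have := sup_lt_of_connected hr h1.nonempty; omega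
      obtain ⟨u, hu, hur⟩ := Finset.exists_mem_eq_sup S h1.nonempty r
      have hui := hS.2.1 u hu
      have hne : u ≠ v := by rintro rfl; exact hvS hu
      constructor
      · have h5 := h.le v
        exact h1.insert_of_adj hu ((h.adj_iff_le hne).2 ⟨by omega, by omega⟩)
      · rw [Finset.sup_insert, h2, mergeEnd, if_neg h3]; exact max_comm _ _
  · intro u hu
    rcases Finset.mem_insert.1 hu with rfl | hu
    · omega
    · have := hS.2.1 u hu; omega
  · rw [colorDiff_insert hvS]
    have := hS.2.2
    unfold colorSign shiftDiff
    split_ifs <;> omega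

theorem PrefixSet.of_notMem (hpos : Function.Injective pos) {i k d : ℕ} {S : Finset (Fin n)}
    (hS : PrefixSet G B pos r (i + 1) k d S) {v : Fin n} (hv : pos v = i) (hvS : v ∉ S) :
    PrefixSet G B pos r i k d S := by
  refine ⟨hS.1, fun u hu => ?_, hS.2.2⟩
  have h1 := hS.2.1 u hu
  have h2 : pos u ≠ pos v := fun hc => hvS (hpos hc ▸ hu)
  omega

theorem PrefixSet.erase_vertex (h : IsIntervalRep G pos r) (hpos : Function.Injective pos)
    (hr : ∀ v, r v < n) {i k d : ℕ} {S : Finset (Fin n)}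
    (hS : PrefixSet G B pos r (i + 1) k d S) {v : Fin n} (hv : pos v = i) (hvS : v ∈ S) :
    ∃ k' d', i ≤ k' ∧ mergeEnd n k' (r v) = k ∧ shiftDiff B v d' = d ∧
      PrefixSet G B pos r i k' d' (S.erase v) := by
  have hin : i < n := by have := h.le v; have := hr v; omega
  -- At most `n` vertices have colour difference at least `-n`, so the shifted difference is a
  -- natural number.
  obtain ⟨d', hd'⟩ : ∃ d' : ℕ, colorDiff B (S.erase v) + n = d' := by
    have h1 := (natAbs_colorDiff_le B (S.erase v)).1
    have h2 := Finset.card_le_univ (S.erase v)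
    rw [Fintype.card_fin] at h2
    exact ⟨(colorDiff B (S.erase v) + n).toNat, by omega⟩
  have hlt : ∀ u ∈ S.erase v, pos u < i := by
    intro u hu
    have h1 := hS.2.1 u (Finset.mem_of_mem_erase hu)
    have h2 : pos u ≠ pos v := fun hc => Finset.ne_of_mem_erase hu (hpos hc)
    omega
  have hshift : shiftDiff B v d' = d := by
    have h1 := hS.2.2
    rw [colorDiff_erase hvS] at hd'
    unfold colorSign at hd'
    unfold shiftDiff
    split_ifs at hd' ⊢ <;> omega
  have hmax : ∀ u ∈ S, pos u ≤ pos v := fun u hu => by have := hS.2.1 u hu; omega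
  obtain ⟨hc, hsup⟩ : ConnectedSet G S ∧ S.sup r = k :=
    hS.1.resolve_left fun h0 => by rw [h0.1] at hvS; simp at hvS
  rcases hc.erase h hvS hmax with h1 | h1
  · subst h1
    refine ⟨n, d', hin.le, ?_, hshift, .inl ⟨by simp, rfl⟩, hlt, hd'⟩
    rw [← hsup]; simp [mergeEnd]
  · have hne : S ≠ {v} := by
      rintro rfl
      have := h1.nonempty
      simp at this
    obtain ⟨u, hu, huv⟩ := hc.exists_adj hvS hne
    refine ⟨(S.erase v).sup r, d', ?_, ?_, hshift, .inr ⟨h1, rfl⟩, hlt, hd'⟩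
    · have h2 := ((h.adj_iff_le huv.ne).1 huv).2
      have h3 : r u ≤ (S.erase v).sup r := Finset.le_sup hu
      omega
    · have := sup_lt_of_connected hr h1.nonempty
      rw [mergeEnd, if_neg (by omega), ← hsup]
      conv_rhs => rw [← Finset.insert_erase hvS, Finset.sup_insert]
      exact max_comm _ _

/-- The correctness conditions for the row `i + 1` of the table `D` of sizes (plus one) and of the
table `P` of parent pointers, where `v` is the vertex at position `i`. -/
structure TableRow (n : ℕ) (B : Finset (Fin n)) (r : Fin n → ℕ) (v : Fin n) (i : ℕ)
    (D D' P : ℕ → ℕ → ℕ) : Prop where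
  mono : ∀ k < 2 * n + 1, ∀ d < 2 * n + 1, D k d ≤ D' k d
  extend : ∀ k < 2 * n + 1, i ≤ k → ∀ d < 2 * n + 1, 0 < D k d →
    D k d + 1 ≤ D' (mergeEnd n k (r v)) (shiftDiff B v d)
  keep : ∀ k < 2 * n + 1, ∀ d < 2 * n + 1, P k d = 0 → D' k d = D k d
  parent : ∀ k < 2 * n + 1, ∀ d < 2 * n + 1, ∀ q, P k d = q + 1 → i ≤ q ∧ q < 2 * n + 1 ∧
    mergeEnd n q (r v) = k ∧
    ∃ d' < 2 * n + 1, shiftDiff B v d' = d ∧ 0 < D q d' ∧ D' k d = D q d' + 1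

/-- The entries of row `i` are positive only where there can be a set. -/
def RowSupport (n i : ℕ) (D : ℕ → ℕ → ℕ) : Prop :=
  ∀ k < 2 * n + 1, ∀ d < 2 * n + 1, 0 < D k d → k ≤ n ∧ n ≤ d + i ∧ d ≤ n + i ∧ D k d ≤ i + 1

theorem TableRow.support {D D' P : ℕ → ℕ → ℕ} {v : Fin n} {i : ℕ}
    (h : TableRow n B r v i D D' P) (hr : ∀ v, r v < n) (hD : RowSupport n i D) :
    RowSupport n (i + 1) D' := by
  intro k hk d hd hpos
  rcases hP : P k d with _ | q
  · rw [h.keep k hk d hd hP] at hpos ⊢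
    have := hD k hk d hd hpos
    omega
  · obtain ⟨-, h2, h3, d', h4, h5, h6, h7⟩ := h.parent k hk d hd q hP
    have h8 := hD q h2 d' h4 h6
    have := hr v
    unfold shiftDiff at h5
    unfold mergeEnd at h3
    refine ⟨?_, ?_⟩
    · split_ifs at h3 <;> omega
    · split_ifs at h5 <;> omega

/-- Entries are sizes plus one, so that `0` can stand for the absence of a set; the single initial
entry `1` is the empty set. That entries are attained is not demanded but follows from the pointers.
-/
structure IsTable (n : ℕ) (B : Finset (Fin n)) (pos r : Fin n → ℕ) (D P : ℕ → ℕ → ℕ → ℕ) :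
    Prop where
  start : ∀ k < 2 * n + 1, ∀ d < 2 * n + 1, D 0 k d = if k = n ∧ d = n then 1 else 0
  row : ∀ v : Fin n, TableRow n B r v (pos v) (D (pos v)) (D (pos v + 1)) (P (pos v + 1))

variable {D P : ℕ → ℕ → ℕ → ℕ}

theorem PrefixSet.le_two_mul (hr : ∀ v, r v < n) {i k d : ℕ} {S : Finset (Fin n)}
    (hS : PrefixSet G B pos r i k d S) : k ≤ n ∧ d < 2 * n + 1 := by
  have h1 := (natAbs_colorDiff_le B S).2
  have h2 := Finset.card_le_univ S
  rw [Fintype.card_fin] at h2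
  have h3 := hS.2.2
  refine ⟨?_, by omega⟩
  rcases hS.1 with ⟨-, h4⟩ | ⟨h4, h5⟩
  · exact h4.le
  · have := sup_lt_of_connected hr h4.nonempty; omega

theorem exists_pos_eq (hpos : Function.Injective pos) (hlt : ∀ v, pos v < n) {i : ℕ}
    (hi : i < n) : ∃ v, pos v = i := by
  have h1 : Function.Injective fun v : Fin n => (⟨pos v, hlt v⟩ : Fin n) := fun u v huv =>
    hpos (Fin.mk.inj_iff.1 huv)
  obtain ⟨v, hv⟩ := (Finite.injective_iff_surjective.1 h1) ⟨i, hi⟩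
  exact ⟨v, Fin.mk.inj_iff.1 hv⟩

theorem IsTable.support (h : IsTable n B pos r D P) (hpos : Function.Injective pos)
    (hlt : ∀ v, pos v < n) (hr : ∀ v, r v < n) {i : ℕ} (hi : i ≤ n) : RowSupport n i (D i) := by
  induction i with
  | zero =>
    intro k hk d hd hp
    rw [h.start k hk d hd] at hp ⊢
    split_ifs at hp ⊢ <;> omega
  | succ i ih =>
    obtain ⟨v, rfl⟩ := exists_pos_eq hpos hlt hi
    exact (h.row v).support hr (ih (by omega))

/-- By induction on the prefix: `mono` covers sets that omit the last vertex, and `extend` covers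
those that contain it. -/
theorem IsTable.card_lt (h : IsTable n B pos r D P) (hrep : IsIntervalRep G pos r)
    (hpos : Function.Injective pos) (hlt : ∀ v, pos v < n) (hr : ∀ v, r v < n) {i k d : ℕ}
    (hi : i ≤ n) {S : Finset (Fin n)} (hS : PrefixSet G B pos r i k d S) : S.card < D i k d := by
  induction i generalizing k d S with
  | zero =>
    have hb := hS.le_two_mul hr
    obtain rfl : S = ∅ := Finset.eq_empty_of_forall_notMem fun v hv => absurd (hS.2.1 v hv) (by omega)
    have hk : k = n := by
      rcases hS.1 with ⟨-, h1⟩ | ⟨h1, -⟩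
      · exact h1
      · have := h1.nonempty; simp at this
    have hd : d = n := by have := hS.2.2; simp at this; omega
    rw [h.start k (by omega) d hb.2]
    simp [hk, hd]
  | succ i ih =>
    obtain ⟨v, rfl⟩ := exists_pos_eq hpos hlt hi
    have hb := hS.le_two_mul hr
    by_cases hvS : v ∈ S
    · obtain ⟨k', d', h1, rfl, rfl, h4⟩ := hS.erase_vertex hrep hpos hr rfl hvS
      have hb' := h4.le_two_mul hr
      have h5 := ih (by omega) h4
      have h6 := (h.row v).extend k' (by omega) h1 d' hb'.2 (by omega)
      rw [Finset.card_erase_of_mem hvS] at h5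
      omega
    · exact (ih (by omega) (hS.of_notMem hpos rfl hvS)).trans_le
        ((h.row v).mono k (by omega) d hb.2)

/-- The state `(i, k, d, T)` of following the parent pointers from the entry `(n, k₀, n)`. -/
structure Tracing (G : SimpleGraph (Fin n)) (B : Finset (Fin n)) (pos r : Fin n → ℕ)
    (D : ℕ → ℕ → ℕ → ℕ) (k₀ i k d : ℕ) (T : Finset (Fin n)) : Prop where
  pos_entry : 0 < D i k d
  k_lt : k < 2 * n + 1
  d_lt : d < 2 * n + 1
  card : D i k d + T.card = D n k₀ n
  extends_to : ∀ S, PrefixSet G B pos r i k d S →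
    PrefixSet G B pos r n k₀ n (S ∪ T)
  le_pos : ∀ u ∈ T, i ≤ pos u

theorem Tracing.keep {k₀ k d : ℕ} {v : Fin n} {T : Finset (Fin n)} (h : IsTable n B pos r D P)
    (ht : Tracing G B pos r D k₀ (pos v + 1) k d T) (hP : P (pos v + 1) k d = 0) :
    Tracing G B pos r D k₀ (pos v) k d T := by
  have h1 := (h.row v).keep k ht.k_lt d ht.d_lt hP
  exact ⟨h1 ▸ ht.pos_entry, ht.k_lt, ht.d_lt, h1 ▸ ht.card, fun S hS => ht.extends_to S hS.mono,
    fun u hu => (Nat.le_succ _).trans (ht.le_pos u hu)⟩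

theorem Tracing.step {k₀ k d q : ℕ} {v : Fin n} {T : Finset (Fin n)} (h : IsTable n B pos r D P)
    (hrep : IsIntervalRep G pos r) (hpos : Function.Injective pos) (hlt : ∀ v, pos v < n)
    (hr : ∀ v, r v < n) (ht : Tracing G B pos r D k₀ (pos v + 1) k d T)
    (hP : P (pos v + 1) k d = q + 1) :
    Tracing G B pos r D k₀ (pos v) q (if v ∈ B then d - 1 else d + 1) (insert v T) := by
  obtain ⟨h1, h2, h3, d', h4, h5, h6, h7⟩ := (h.row v).parent k ht.k_lt d ht.d_lt q hP
  have hv := hlt v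
  have h8 := h.support hpos hlt hr hv.le q h2 d' h4 h6
  -- By `RowSupport` the previous difference `d'` is positive, so the truncated subtraction in
  -- `shiftDiff` can be undone from the colour of `v`.
  have hd' : (if v ∈ B then d - 1 else d + 1) = d' := by
    unfold shiftDiff at h5
    split_ifs at h5 ⊢ <;> omega
  rw [hd']
  have hext : ∀ S, PrefixSet G B pos r (pos v) q d' S → v ∉ S ∧
      PrefixSet G B pos r (pos v + 1) k d (insert v S) := by
    intro S hS
    have := hS.insert_vertex hrep hr (v := v) rfl h1 (by omega)
    rwa [h3, h5] at this
  have hun : ∀ S : Finset (Fin n), S ∪ insert v T = insert v S ∪ T := by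
    intro S; ext x; simp
  have hvT : v ∉ T := fun hc => by have := ht.le_pos v hc; omega
  refine ⟨h6, h2, h4, ?_, fun S hS => ?_, ?_⟩
  · have := ht.card
    rw [h7] at this
    rw [Finset.card_insert_of_notMem hvT]
    omega
  · rw [hun]
    exact ht.extends_to _ (hext S hS).2
  · intro u hu
    rcases Finset.mem_insert.1 hu with rfl | hu
    · rfl
    · exact (Nat.le_succ _).trans (ht.le_pos u hu)

theorem Tracing.init (h : IsTable n B pos r D P) (hrep : IsIntervalRep G pos r)
    (hpos : Function.Injective pos) (hlt : ∀ v, pos v < n) (hr : ∀ v, r v < n) {k₀ : ℕ}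
    (hk₀ : k₀ < 2 * n + 1) (hmax : ∀ k ≤ n, D n k n ≤ D n k₀ n) :
    Tracing G B pos r D k₀ n k₀ n ∅ := by
  have h1 : PrefixSet G B pos r n n n ∅ := ⟨.inl ⟨rfl, rfl⟩, by simp, by simp⟩
  have h2 := h.card_lt hrep hpos hlt hr le_rfl h1
  have h3 := hmax n le_rfl
  exact ⟨by omega, hk₀, by omega, by simp, fun S hS => by simpa using hS, by simp⟩

/-- A positive entry of row `0` is the `1` of the empty set, so the traced set `T` has one vertex
less than the best entry says, and `IsTable.card_lt` bounds every balanced connected set by this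
number. If `T` is empty, such a set would have no vertex. -/
theorem Tracing.isBCSSolution (h : IsTable n B pos r D P) (hrep : IsIntervalRep G pos r)
    (hpos : Function.Injective pos) (hlt : ∀ v, pos v < n) (hr : ∀ v, r v < n) {k₀ k d : ℕ}
    {T : Finset (Fin n)} (hmax : ∀ k ≤ n, D n k n ≤ D n k₀ n)
    (ht : Tracing G B pos r D k₀ 0 k d T) : IsBCSSolution G B T := by
  have h1 := ht.pos_entry
  have h2 := h.start k ht.k_lt d ht.d_lt
  rw [h2] at h1
  obtain ⟨rfl, rfl⟩ : k = n ∧ d = n := by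
    by_contra hc
    rw [if_neg hc] at h1
    omega
  rw [if_pos ⟨rfl, rfl⟩] at h2
  have h3 := ht.extends_to ∅ ⟨.inl ⟨rfl, rfl⟩, by simp, by simp⟩
  rw [Finset.empty_union] at h3
  have h4 : ∀ S, IsBalancedConnected G B S → S.card ≤ T.card := by
    intro S hS
    have h5 : PrefixSet G B pos r d (S.sup r) d S :=
      ⟨.inr ⟨hS.1, rfl⟩, fun v _ => hlt v, by rw [colorDiff_eq_zero.2 hS.2]; simp⟩
    have h6 := h.card_lt hrep hpos hlt hr le_rfl h5
    have h7 := hmax _ (h5.le_two_mul hr).1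
    have h8 := ht.card
    omega
  rcases h3.1 with ⟨h5, -⟩ | ⟨h5, -⟩
  · subst h5
    refine .inr ⟨rfl, fun S hS => ?_⟩
    have h5 := h4 S hS
    rw [Finset.card_empty, Nat.le_zero, Finset.card_eq_zero] at h5
    have := hS.1.nonempty
    rw [h5] at this
    simp at this
  · refine .inl ⟨⟨h5, colorDiff_eq_zero.1 ?_⟩, h4⟩
    have := h3.2.2
    omega

end Table

end BCS

namespace BCS

/-! ## A structured language and its compilation to the machine -/

/-- Variables and arrays. -/
structure Env where
  reg : ℕ → ℕ
  arr : ℕ → ℕ → ℕ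

def Env.setReg (s : Env) (x a : ℕ) : Env := { s with reg := Function.update s.reg x a }

def Env.setArr (s : Env) (a i v : ℕ) : Env :=
  { s with arr := Function.update s.arr a (Function.update (s.arr a) i v) }

/-- Expressions; `sadd` is addition that saturates at a bound `V`. -/
inductive Exp where
  | lit (a : ℕ) : Exp
  | var (x : ℕ) : Exp
  | add (e f : Exp) : Exp
  | sub (e f : Exp) : Exp
  | mul (e f : Exp) : Exp
  | sadd (e f : Exp) : Exp
  | read (a : ℕ) (e : Exp) : Exp

/-- Statements; `loop i m p` runs `p` for all values of the variable `i` below the variable `m`. -/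
inductive Stmt where
  | skip : Stmt
  | assign (x : ℕ) (e : Exp) : Stmt
  | write (a : ℕ) (i e : Exp) : Stmt
  | seq (p q : Stmt) : Stmt
  | ite (e f : Exp) (p q : Stmt) : Stmt
  | loop (i m : ℕ) (p : Stmt) : Stmt

namespace Exp

def eval (V : ℕ) (s : Env) : Exp → ℕ
  | lit a => a
  | var x => s.reg x
  | add e f => e.eval V s + f.eval V s
  | sub e f => e.eval V s - f.eval V s
  | mul e f => e.eval V s * f.eval V s
  | sadd e f => min (e.eval V s + f.eval V s) V
  | read a e => s.arr a (e.eval V s)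

def wf : Exp → Bool
  | lit _ => true
  | var x => decide (x < 20)
  | add e f => e.wf && f.wf
  | sub e f => e.wf && f.wf
  | mul e f => e.wf && f.wf
  | sadd e f => e.wf && f.wf
  | read a e => decide (a < 16) && e.wf

/-- The value does not exceed the saturation bound. -/
def small : Exp → Bool
  | lit a => decide (a ≤ 4)
  | var _ => true
  | add _ _ => false
  | sub e _ => e.small
  | mul _ _ => false
  | sadd _ _ => true
  | read _ _ => true

/-- A bound for all intermediate results. -/
def bound (V b : ℕ) : Exp → ℕ
  | lit a => a
  | var _ => V
  | add e f => e.bound V b + f.bound V b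
  | sub e f => e.bound V b + f.bound V b
  | mul e f => (e.bound V b + 1) * (f.bound V b + 1)
  | sadd e f => e.bound V b + f.bound V b + V
  | read _ e => V + b + 16 * e.bound V b + 16

def cost : Exp → ℕ
  | lit _ => 1
  | var _ => 1
  | add e f => e.cost + f.cost + 1
  | sub e f => e.cost + f.cost + 1
  | mul e f => e.cost + f.cost + 1
  | sadd e f => e.cost + f.cost + 3
  | read _ e => e.cost + 5

/-- Code that leaves the value in register `k`. The registers `20, …, 24` hold the saturation
bound, the length of the input, and the constants `16`, `1`, `0`. -/
def comp : Exp → ℕ → Prog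
  | lit a, k => .const k a
  | var x, k => .add k x 24
  | add e f, k => .seq (e.comp k) (.seq (f.comp (k + 1)) (.add k k (k + 1)))
  | sub e f, k => .seq (e.comp k) (.seq (f.comp (k + 1)) (.sub k k (k + 1)))
  | mul e f, k => .seq (e.comp k) (.seq (f.comp (k + 1)) (.mul k k (k + 1)))
  | sadd e f, k => .seq (e.comp k) (.seq (f.comp (k + 1)) (.seq (.add k k (k + 1))
      (.ite 20 k (.add k 20 24) .skip)))
  | read a e, k =>
    if a = 0 then .seq (e.comp k) (.ite k 21 (.load k k) (.const k 0))
    else .seq (e.comp k) (.seq (.mul k k 22) (.seq (.add k k 21) (.seq (.const (k + 1) a)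
      (.seq (.add k k (k + 1)) (.load k k)))))

end Exp

namespace Stmt

/-- Array `0` shares its addresses with the input of length `n² + n`, beyond which the other arrays
begin; writes to it outside this range are therefore dropped. -/
def eval (V : ℕ) : Stmt → Env → Env
  | skip, s => s
  | assign x e, s => s.setReg x (e.eval V s)
  | write a i e, s =>
    if a = 0 ∧ ¬ i.eval V s < s.reg 0 * s.reg 0 + s.reg 0 then s
    else s.setArr a (i.eval V s) (e.eval V s)
  | seq p q, s => q.eval V (p.eval V s)
  | ite e f p q, s => if e.eval V s < f.eval V s then p.eval V s else q.eval V s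
  | loop i m p, s =>
    (fun s => (p.eval V s).setReg i ((p.eval V s).reg i + 1))^[s.reg m] (s.setReg i 0)

def modReg : Stmt → ℕ → Bool
  | skip, _ => false
  | assign x _, y => decide (x = y)
  | write _ _ _, _ => false
  | seq p q, y => p.modReg y || q.modReg y
  | ite _ _ p q, y => p.modReg y || q.modReg y
  | loop i _ p, y => decide (i = y) || p.modReg y

def modArr : Stmt → ℕ → Bool
  | skip, _ => false
  | assign _ _, _ => false
  | write a _ _, y => decide (a = y)
  | seq p q, y => p.modArr y || q.modArr y
  | ite _ _ p q, y => p.modArr y || q.modArr y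
  | loop _ _ p, y => p.modArr y

/-- Only `small` expressions may be stored, and the variables `0` and `1`, the only loop bounds, are
never assigned. Bounds on values and running times therefore need no program-specific invariant. -/
def wf : Stmt → Bool
  | skip => true
  | assign x e => decide (2 ≤ x) && decide (x < 20) && e.wf && e.small
  | write a i e => decide (a < 16) && i.wf && e.wf && e.small
  | seq p q => p.wf && q.wf
  | ite e f p q => e.wf && f.wf && p.wf && q.wf
  | loop i m p => decide (2 ≤ i) && decide (i < 20) && decide (m < 2) && !p.modReg i && p.wf

def bound (V b : ℕ) : Stmt → ℕ
  | skip => 0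
  | assign _ e => e.bound V b
  | write _ i e => 16 * i.bound V b + b + 16 + e.bound V b
  | seq p q => p.bound V b + q.bound V b
  | ite e f p q => e.bound V b + f.bound V b + p.bound V b + q.bound V b
  | loop _ _ p => p.bound V b + V

def cost (N : ℕ) : Stmt → ℕ
  | skip => 1
  | assign _ e => e.cost + 1
  | write _ i e => i.cost + e.cost + 5
  | seq p q => p.cost N + q.cost N
  | ite e f p q => e.cost + f.cost + 1 + p.cost N + q.cost N
  | loop _ _ p => N * (p.cost N + 2) + 2

def depth : Stmt → ℕ
  | skip => 0
  | assign _ _ => 0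
  | write _ _ _ => 0
  | seq p q => max p.depth q.depth
  | ite _ _ p q => max p.depth q.depth
  | loop _ _ p => p.depth + 1

/-- Cell `i` of an array `a ≠ 0` has address `16 * i + b + a`: the arrays are interleaved behind the
`b` input cells, so their length need not be known. Register `25` keeps the address while `26`
receives the value. -/
def comp : Stmt → Prog
  | skip => .skip
  | assign x e => .seq (e.comp 25) (.add x 25 24)
  | write a i e =>
    if a = 0 then .seq (i.comp 25) (.seq (e.comp 26) (.ite 25 21 (.store 25 26) .skip))
    else .seq (i.comp 25) (.seq (.mul 25 25 22) (.seq (.add 25 25 21) (.seq (.const 26 a)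
      (.seq (.add 25 25 26) (.seq (e.comp 26) (.store 25 26))))))
  | seq p q => .seq p.comp q.comp
  | ite e f p q => .seq (e.comp 25) (.seq (f.comp 26) (.ite 25 26 p.comp q.comp))
  | loop i m p => .seq (.const i 0) (.loop i m (.seq p.comp (.add i i 23)))

end Stmt

/-! ### Frame properties -/

@[simp] theorem Env.setReg_reg (s : Env) (x a : ℕ) :
    (s.setReg x a).reg = Function.update s.reg x a := rfl

@[simp] theorem Env.setReg_arr (s : Env) (x a : ℕ) : (s.setReg x a).arr = s.arr := rfl

@[simp] theorem Env.setArr_reg (s : Env) (a i v : ℕ) : (s.setArr a i v).reg = s.reg := rfl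

@[simp] theorem Env.setArr_arr (s : Env) (a i v : ℕ) :
    (s.setArr a i v).arr = Function.update s.arr a (Function.update (s.arr a) i v) := rfl

theorem Stmt.eval_reg {V : ℕ} (p : Stmt) {x : ℕ} (h : p.modReg x = false) (s : Env) :
    (p.eval V s).reg x = s.reg x := by
  induction p generalizing s with
  | skip => rfl
  | assign y e =>
    simp only [modReg, decide_eq_false_iff_not] at h
    simp [eval, Function.update_of_ne (Ne.symm h)]
  | write a i e => simp only [eval]; split_ifs <;> simp
  | seq p q ihp ihq =>
    simp only [modReg, Bool.or_eq_false_iff] at h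
    simp [eval, ihp h.1, ihq h.2]
  | ite e f p q ihp ihq =>
    simp only [modReg, Bool.or_eq_false_iff] at h
    simp only [eval]
    split_ifs
    · exact ihp h.1 s
    · exact ihq h.2 s
  | loop i m p ih =>
    simp only [modReg, Bool.or_eq_false_iff, decide_eq_false_iff_not] at h
    simp only [eval]
    generalize s.reg m = N
    induction N with
    | zero => simp [Function.update_of_ne (Ne.symm h.1)]
    | succ N ihN =>
      rw [Function.iterate_succ_apply', Env.setReg_reg, Function.update_of_ne (Ne.symm h.1),
        ih h.2, ihN]

theorem Stmt.eval_arr {V : ℕ} (p : Stmt) {a : ℕ} (h : p.modArr a = false) (s : Env) :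
    (p.eval V s).arr a = s.arr a := by
  induction p generalizing s with
  | skip => rfl
  | assign y e => rfl
  | write b i e =>
    simp only [modArr, decide_eq_false_iff_not] at h
    simp only [eval]; split_ifs <;> simp [Function.update_of_ne (Ne.symm h)]
  | seq p q ihp ihq =>
    simp only [modArr, Bool.or_eq_false_iff] at h
    simp [eval, ihp h.1, ihq h.2]
  | ite e f p q ihp ihq =>
    simp only [modArr, Bool.or_eq_false_iff] at h
    simp only [eval]
    split_ifs
    · exact ihp h.1 s
    · exact ihq h.2 s
  | loop i m p ih =>
    simp only [modArr] at h
    simp only [eval]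
    generalize s.reg m = N
    induction N with
    | zero => rfl
    | succ N ihN => rw [Function.iterate_succ_apply', Env.setReg_arr, ih h, ihN]

/-- Loop invariants. The body may use that everything it does not modify has its initial value. -/
theorem Stmt.eval_loop_induct {V i m : ℕ} {p : Stmt} {s : Env} (hi : p.modReg i = false)
    (I : ℕ → Env → Prop) (h0 : I 0 (s.setReg i 0))
    (hs : ∀ k s', k < s.reg m → s'.reg i = k →
      (∀ x, x ≠ i → p.modReg x = false → s'.reg x = s.reg x) →
      (∀ a, p.modArr a = false → s'.arr a = s.arr a) → I k s' →
      I (k + 1) ((p.eval V s').setReg i (k + 1))) :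
    I (s.reg m) ((Stmt.loop i m p).eval V s) := by
  simp only [eval]
  suffices h : ∀ N ≤ s.reg m, ∀ s', s' = (fun s => (p.eval V s).setReg i
      ((p.eval V s).reg i + 1))^[N] (s.setReg i 0) → s'.reg i = N ∧
      (∀ x, x ≠ i → p.modReg x = false → s'.reg x = s.reg x) ∧
      (∀ a, p.modArr a = false → s'.arr a = s.arr a) ∧ I N s' from (h _ le_rfl _ rfl).2.2.2
  intro N
  induction N with
  | zero =>
    rintro - s' rfl
    exact ⟨by simp, fun x hx _ => by simp [Function.update_of_ne hx], fun a _ => rfl, h0⟩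
  | succ N ih =>
    rintro hN s' rfl
    rw [Function.iterate_succ_apply']
    obtain ⟨h1, h2, h3, h4⟩ := ih (by omega) _ rfl
    refine ⟨by rw [Env.setReg_reg, Function.update_self, eval_reg p hi, h1], fun x hx hm => ?_, fun a ha => ?_, ?_⟩
    · rw [Env.setReg_reg, Function.update_of_ne hx, eval_reg p hm, h2 x hx hm]
    · rw [Env.setReg_arr, eval_arr p ha, h3 a ha]
    · rw [eval_reg p hi, h1]
      exact hs N _ (by omega) h1 h2 h3 h4

/-! ### Correctness of the compilation -/

/-- The machine state `s` represents the environment `h`. -/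
structure Sim (V b : ℕ) (s : State) (h : Env) : Prop where
  reg : ∀ x < 20, s.reg x = h.reg x
  reg20 : s.reg 20 = V
  reg21 : s.reg 21 = b
  reg22 : s.reg 22 = 16
  reg23 : s.reg 23 = 1
  reg24 : s.reg 24 = 0
  raw : ∀ i < b, s.mem i = h.arr 0 i
  zero : ∀ i, ¬ i < b → h.arr 0 i = 0
  mem : ∀ a, a ≠ 0 → a < 16 → ∀ i, s.mem (i * 16 + b + a) = h.arr a i

structure Small (V : ℕ) (h : Env) : Prop where
  reg : ∀ x, h.reg x ≤ V
  arr : ∀ a i, h.arr a i ≤ V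

theorem Sim.congr {V b : ℕ} {s s' : State} {h : Env} (hs : Sim V b s h)
    (hr : ∀ x < 25, s'.reg x = s.reg x) (hm : s'.mem = s.mem) : Sim V b s' h := by
  refine ⟨fun x hx => (hr x (by omega)).trans (hs.reg x hx), (hr _ (by omega)).trans hs.reg20,
    (hr _ (by omega)).trans hs.reg21, (hr _ (by omega)).trans hs.reg22,
    (hr _ (by omega)).trans hs.reg23, (hr _ (by omega)).trans hs.reg24, ?_, hs.zero, ?_⟩
  · rw [hm]; exact hs.raw
  · rw [hm]; exact hs.mem

theorem Exp.eval_le_bound {V b : ℕ} {h : Env} (hV : Small V h) (e : Exp) :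
    e.eval V h ≤ e.bound V b := by
  induction e with
  | lit a => exact le_rfl
  | var x => exact hV.reg x
  | add e f he hf => exact Nat.add_le_add he hf
  | sub e f he hf => simp only [eval, bound]; omega
  | mul e f he hf => exact Nat.mul_le_mul (he.trans (Nat.le_succ _)) (hf.trans (Nat.le_succ _))
  | sadd e f he hf => simp only [eval, bound]; omega
  | read a e he =>
    have := hV.arr a (e.eval V h)
    simp only [eval, bound]; omega

theorem Exp.eval_le_of_small {V : ℕ} (h4 : 4 ≤ V) {h : Env} (hV : Small V h) (e : Exp)
    (he : e.small = true) : e.eval V h ≤ V := by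
  induction e with
  | lit a => simp only [small, decide_eq_true_eq] at he; simp only [eval]; omega
  | var x => exact hV.reg x
  | add e f _ _ => simp [small] at he
  | sub e f ih _ => have := ih he; simp only [eval]; omega
  | mul e f _ _ => simp [small] at he
  | sadd e f _ _ => simp [eval]
  | read a e _ => exact hV.arr a _

@[simp] theorem State.setReg_reg (s : State) (x a : ℕ) :
    (s.setReg x a).reg = Function.update s.reg x a := rfl

@[simp] theorem State.setReg_mem (s : State) (x a : ℕ) : (s.setReg x a).mem = s.mem := rfl

@[simp] theorem State.setMem_reg (s : State) (x a : ℕ) : (s.setMem x a).reg = s.reg := rfl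

@[simp] theorem State.setMem_mem (s : State) (x a : ℕ) :
    (s.setMem x a).mem = Function.update s.mem x a := rfl

/-- The code for `e` leaves its value in register `k` and changes no lower register. -/
def Exp.Computes (W V : ℕ) (h : Env) (e : Exp) (k : ℕ) (s : State) : Prop :=
  ∃ t s', t ≤ e.cost ∧ Run W (e.comp k) s t s' ∧ s'.mem = s.mem ∧
    (∀ x < k, s'.reg x = s.reg x) ∧ s'.reg k = e.eval V h

/-- Code for target `k` leaves lower registers alone, so the first value survives the evaluation of
the second one in register `k + 1`. -/
theorem Exp.computes_pair {W V b : ℕ} {h : Env} {e f : Exp} {k : ℕ} (hk : 25 ≤ k) {s : State}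
    (hs : Sim V b s h) (he : e.Computes W V h k s)
    (hf : ∀ s, Sim V b s h → f.Computes W V h (k + 1) s) :
    ∃ t₁ t₂ s₁ s₂, t₁ + t₂ ≤ e.cost + f.cost ∧ Run W (e.comp k) s t₁ s₁ ∧
      Run W (f.comp (k + 1)) s₁ t₂ s₂ ∧ s₂.mem = s.mem ∧ (∀ x < k, s₂.reg x = s.reg x) ∧
      s₂.reg k = e.eval V h ∧ s₂.reg (k + 1) = f.eval V h ∧ Sim V b s₂ h := by
  obtain ⟨t₁, s₁, h1, h2, h3, h4, h5⟩ := he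
  have hs₁ := hs.congr (fun x hx => h4 x (by omega)) h3
  obtain ⟨t₂, s₂, h6, h7, h8, h9, h10⟩ := hf s₁ hs₁
  exact ⟨t₁, t₂, s₁, s₂, by omega, h2, h7, h8.trans h3,
    fun x hx => (h9 x (by omega)).trans (h4 x hx), (h9 k (by omega)).trans h5, h10,
    hs₁.congr (fun x hx => h9 x (by omega)) h8⟩

theorem Exp.computes {W V b : ℕ} {h : Env} (hV : Small V h) (e : Exp) (hw : e.wf = true)
    (hb : e.bound V b < W) {k : ℕ} (hk : 25 ≤ k) {s : State} (hs : Sim V b s h) :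
    e.Computes W V h k s := by
  induction e generalizing k s with
  | lit a =>
    exact ⟨1, _, le_rfl, .const s k a hb, rfl, fun x hx => by simp [hx.ne], by simp [eval]⟩
  | var x =>
    simp only [wf, decide_eq_true_eq] at hw
    have h1 := hV.reg x
    simp only [bound] at hb
    refine ⟨1, _, le_rfl, .add s k x 24 ?_, rfl, fun x hx => by simp [hx.ne], ?_⟩
    · rw [hs.reg x hw, hs.reg24]; omega
    · simp [hs.reg x hw, hs.reg24, eval]
  | add e f ihe ihf =>
    simp only [wf, Bool.and_eq_true] at hw
    simp only [bound] at hb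
    have h1 := eval_le_bound (b := b) hV e
    have h2 := eval_le_bound (b := b) hV f
    obtain ⟨t₁, t₂, s₁, s₂, ht, r1, r2, hm, hx, hk1, hk2, hs₂⟩ :=
      computes_pair hk hs (ihe hw.1 (by omega) hk hs) fun s hs => ihf hw.2 (by omega) (by omega) hs
    refine ⟨_, _, ?_, r1.seq (r2.seq (.add s₂ k k (k + 1) ?_)), hm,
      fun x hxk => by simp [hxk.ne, hx x hxk], ?_⟩
    · simp only [cost]; omega
    · rw [hk1, hk2]; omega
    · simp [hk1, hk2, eval]
  | sub e f ihe ihf =>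
    simp only [wf, Bool.and_eq_true] at hw
    simp only [bound] at hb
    obtain ⟨t₁, t₂, s₁, s₂, ht, r1, r2, hm, hx, hk1, hk2, hs₂⟩ :=
      computes_pair hk hs (ihe hw.1 (by omega) hk hs) fun s hs => ihf hw.2 (by omega) (by omega) hs
    refine ⟨_, _, ?_, r1.seq (r2.seq (.sub s₂ k k (k + 1))), hm,
      fun x hxk => by simp [hxk.ne, hx x hxk], ?_⟩
    · simp only [cost]; omega
    · simp [hk1, hk2, eval]
  | mul e f ihe ihf =>
    simp only [wf, Bool.and_eq_true] at hw
    simp only [bound] at hb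
    have h1 := eval_le_bound (b := b) hV e
    have h2 := eval_le_bound (b := b) hV f
    have h3 := Nat.mul_le_mul h1 h2
    have h4 : (e.bound V b + 1) * (f.bound V b + 1) =
      e.bound V b * f.bound V b + e.bound V b + f.bound V b + 1 := by ring
    obtain ⟨t₁, t₂, s₁, s₂, ht, r1, r2, hm, hx, hk1, hk2, hs₂⟩ :=
      computes_pair hk hs (ihe hw.1 (by omega) hk hs) fun s hs => ihf hw.2 (by omega) (by omega) hs
    refine ⟨_, _, ?_, r1.seq (r2.seq (.mul s₂ k k (k + 1) ?_)), hm,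
      fun x hxk => by simp [hxk.ne, hx x hxk], ?_⟩
    · simp only [cost]; omega
    · rw [hk1, hk2]; omega
    · simp [hk1, hk2, eval]
  | sadd e f ihe ihf =>
    simp only [wf, Bool.and_eq_true] at hw
    simp only [bound] at hb
    have h1 := eval_le_bound (b := b) hV e
    have h2 := eval_le_bound (b := b) hV f
    obtain ⟨t₁, t₂, s₁, s₂, ht, r1, r2, hm, hx, hk1, hk2, hs₂⟩ :=
      computes_pair hk hs (ihe hw.1 (by omega) hk hs) fun s hs => ihf hw.2 (by omega) (by omega) hs
    have h20 : (20 : ℕ) ≠ k := by omega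
    have h24 : (24 : ℕ) ≠ k := by omega
    have r3 : Run W (.add k k (k + 1)) s₂ 1 (s₂.setReg k (e.eval V h + f.eval V h)) := by
      have := Run.add (W := W) s₂ k k (k + 1) (by rw [hk1, hk2]; omega)
      rwa [hk1, hk2] at this
    by_cases hlt : V < e.eval V h + f.eval V h
    · refine ⟨_, _, ?_, r1.seq (r2.seq (r3.seq (.ite_true ?_ (.add _ k 20 24 ?_)))), hm,
        fun x hxk => by simp [hxk.ne, hx x hxk], ?_⟩
      · simp only [cost]; omega
      · simp [h20, hs₂.reg20, hlt]
      · simp only [State.setReg_reg, Function.update_of_ne h20, Function.update_of_ne h24,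
          hs₂.reg20, hs₂.reg24]
        omega
      · simp [h20, h24, hs₂.reg20, hs₂.reg24, eval, hlt.le]
    · refine ⟨_, _, ?_, r1.seq (r2.seq (r3.seq (.ite_false ?_ (.skip _)))), hm,
        fun x hxk => by simp [hxk.ne, hx x hxk], ?_⟩
      · simp only [cost]; omega
      · simp [h20, hs₂.reg20, not_lt.1 hlt]
      · simp [eval, not_lt.1 hlt]
  | read a e ih =>
    simp only [wf, Bool.and_eq_true, decide_eq_true_eq] at hw
    simp only [bound] at hb
    have h1 := eval_le_bound (b := b) hV e
    obtain ⟨t, s₁, ht, r1, hm, hx, hk1⟩ := ih hw.2 (by omega) hk hs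
    have hs₁ := hs.congr (fun x hxk => hx x (by omega)) hm
    have h21 : (21 : ℕ) ≠ k := by omega
    by_cases ha : a = 0
    · subst ha
      simp only [Computes, comp, if_true]
      by_cases hlt : e.eval V h < b
      · refine ⟨_, _, ?_, r1.seq (.ite_true ?_ (.load _ k k)), hm,
          fun x hxk => by simp [hxk.ne, hx x hxk], ?_⟩
        · simp only [cost]; omega
        · rw [hk1, hs₁.reg21]; exact hlt
        · simp [hk1, hs₁.raw _ hlt, eval]
      · refine ⟨_, _, ?_, r1.seq (.ite_false ?_ (.const _ k 0 (by omega))), hm,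
          fun x hxk => by simp [hxk.ne, hx x hxk], ?_⟩
        · simp only [cost]; omega
        · rw [hk1, hs₁.reg21]; exact hlt
        · simp [hs.zero _ hlt, eval]
    · have h22 : (22 : ℕ) ≠ k := by omega
      have hk' : k ≠ k + 1 := by omega
      simp only [Computes, comp, ha, if_false]
      refine ⟨_, _, ?_, r1.seq (.seq (.mul _ k k 22 ?_) (.seq (.add _ k k 21 ?_)
        (.seq (.const _ (k + 1) a ?_) (.seq (.add _ k k (k + 1) ?_) (.load _ k k))))), ?_,
        fun x hxk => ?_, ?_⟩
      · simp only [cost]; omega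
      · rw [hk1, hs₁.reg22]; omega
      · simp only [State.setReg_reg, Function.update_self, Function.update_of_ne h21, hk1,
          hs₁.reg22, hs₁.reg21]
        omega
      · omega
      · simp only [State.setReg_reg, Function.update_self, Function.update_of_ne h21, hk1,
          hs₁.reg22, hs₁.reg21, Function.update_of_ne hk']
        omega
      · simp [hm]
      · have : x ≠ k + 1 := by omega
        simp [hxk.ne, hx x hxk, this]
      · simp only [State.setReg_reg, State.setReg_mem, Function.update_self,
          Function.update_of_ne h21, hk1, hs₁.reg22, hs₁.reg21, Function.update_of_ne hk', eval]
        exact hs₁.mem a ha hw.1 _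


theorem Sim.setReg {V b : ℕ} {s : State} {h : Env} (hs : Sim V b s h) {x a : ℕ} (hx : x < 20) :
    Sim V b (s.setReg x a) (h.setReg x a) := by
  have hne : ∀ y, 20 ≤ y → y ≠ x := by omega
  refine ⟨fun y hy => ?_, by simp [hne, hs.reg20], by simp [hne, hs.reg21],
    by simp [hne, hs.reg22], by simp [hne, hs.reg23], by simp [hne, hs.reg24], hs.raw, hs.zero,
    hs.mem⟩
  rcases eq_or_ne y x with rfl | h1
  · simp
  · simp [h1, hs.reg y hy]

theorem Small.setReg {V : ℕ} {h : Env} (hV : Small V h) {x a : ℕ} (ha : a ≤ V) :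
    Small V (h.setReg x a) := by
  refine ⟨fun y => ?_, hV.arr⟩
  rcases eq_or_ne y x with rfl | h1
  · simpa using ha
  · simpa [h1] using hV.reg y

theorem Small.setArr {V : ℕ} {h : Env} (hV : Small V h) {a i v : ℕ} (hv : v ≤ V) :
    Small V (h.setArr a i v) := by
  refine ⟨hV.reg, fun c j => ?_⟩
  rcases eq_or_ne c a with rfl | h1
  · rcases eq_or_ne j i with rfl | h2
    · simpa using hv
    · simpa [h2] using hV.arr c j
  · simpa [h1] using hV.arr c j

theorem Sim.setMem_raw {V b : ℕ} {s : State} {h : Env} (hs : Sim V b s h) {i v : ℕ} (hi : i < b) :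
    Sim V b (s.setMem i v) (h.setArr 0 i v) := by
  refine ⟨hs.reg, hs.reg20, hs.reg21, hs.reg22, hs.reg23, hs.reg24, fun j hj => ?_,
    fun j hj => ?_, fun a ha ha' j => ?_⟩
  · rcases eq_or_ne j i with rfl | h1
    · simp
    · simp [h1, hs.raw j hj]
  · have h1 : j ≠ i := by rintro rfl; exact hj hi
    simp [h1, hs.zero j hj]
  · have h1 : j * 16 + b + a ≠ i := by omega
    simp [h1, ha, hs.mem a ha ha' j]

theorem Sim.setMem {V b : ℕ} {s : State} {h : Env} (hs : Sim V b s h) {a i v : ℕ} (ha : a ≠ 0)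
    (ha' : a < 16) : Sim V b (s.setMem (i * 16 + b + a) v) (h.setArr a i v) := by
  refine ⟨hs.reg, hs.reg20, hs.reg21, hs.reg22, hs.reg23, hs.reg24, fun j hj => ?_,
    fun j hj => ?_, fun c hc hc' j => ?_⟩
  · have h1 : j ≠ i * 16 + b + a := by omega
    simp [h1, ha.symm, hs.raw j hj]
  · simp [ha.symm, hs.zero j hj]
  · by_cases h1 : c = a
    · subst h1
      rcases eq_or_ne j i with rfl | h2
      · simp
      · have h3 : j * 16 + b + c ≠ i * 16 + b + c := by omega
        simp [h2, hs.mem c hc hc' j]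
    · have h3 : j * 16 + b + c ≠ i * 16 + b + a := by omega
      simp [h1, h3, hs.mem c hc hc' j]

/-- The code for `p` simulates `p`. -/
theorem Stmt.run_comp {W V N b : ℕ} (p : Stmt) (hw : p.wf = true) (hb : p.bound V b < W)
    (h4 : 4 ≤ V) (hW : 2 ≤ W) {h : Env} {s : State} (hs : Sim V b s h) (hV : Small V h)
    (h0 : b = h.reg 0 * h.reg 0 + h.reg 0) (hN : ∀ m < 2, h.reg m ≤ N) :
    ∃ t s', t ≤ p.cost N ∧ Run W p.comp s t s' ∧ Sim V b s' (p.eval V h) ∧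
      Small V (p.eval V h) ∧ ∀ m < 2, (p.eval V h).reg m = h.reg m := by
  induction p generalizing h s with
  | skip => exact ⟨1, s, le_rfl, .skip s, hs, hV, fun _ _ => rfl⟩
  | assign x e =>
    simp only [wf, Bool.and_eq_true, decide_eq_true_eq] at hw
    simp only [bound] at hb
    have h1 := e.eval_le_bound (b := b) hV
    obtain ⟨t, s₁, ht, r1, hm, hx, hk⟩ := e.computes hV hw.1.2 hb le_rfl hs
    have hs₁ := hs.congr (fun x hxk => hx x hxk) hm
    have r2 := Run.add (W := W) s₁ x 25 24 (by rw [hk, hs₁.reg24]; omega)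
    rw [hk, hs₁.reg24, Nat.add_zero] at r2
    refine ⟨_, _, ?_, r1.seq r2, hs₁.setReg hw.1.1.2,
      hV.setReg (e.eval_le_of_small h4 hV hw.2), fun m hm => ?_⟩
    · simp only [cost]; omega
    · have : m ≠ x := by omega
      simp [eval, this]
  | write a i e =>
    simp only [wf, Bool.and_eq_true, decide_eq_true_eq] at hw
    simp only [bound] at hb
    have h1 := i.eval_le_bound (b := b) hV
    by_cases ha : a = 0
    · subst ha
      obtain ⟨t₁, t₂, s₁, s₂, ht, r1, r2, hm, hx, hk1, hk2, hs₂⟩ :=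
        Exp.computes_pair le_rfl hs (i.computes (W := W) hV hw.1.1.2 (by omega) le_rfl hs)
          fun s hs => e.computes hV hw.1.2 (by omega) (by omega) hs
      simp only [comp, eval, if_true, ← h0]
      by_cases hlt : i.eval V h < b
      · rw [if_neg (by simp [hlt])]
        have r3 := Run.store (W := W) s₂ 25 26
        rw [hk1, hk2] at r3
        refine ⟨_, _, ?_, r1.seq (r2.seq (.ite_true ?_ r3)), hs₂.setMem_raw hlt,
          hV.setArr (e.eval_le_of_small h4 hV hw.2), fun _ _ => rfl⟩
        · simp only [cost]; omega
        · rw [hk1, hs₂.reg21]; exact hlt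
      · rw [if_pos ⟨trivial, hlt⟩]
        refine ⟨_, _, ?_, r1.seq (r2.seq (.ite_false ?_ (.skip _))), hs₂, hV, fun _ _ => rfl⟩
        · simp only [cost]; omega
        · rw [hk1, hs₂.reg21]; exact hlt
    · simp only [comp, eval, ha, if_false, false_and]
      obtain ⟨t, s₁, ht, r1, hm, hx, hk⟩ := i.computes (W := W) hV hw.1.1.2 (by omega) le_rfl hs
      have hs₁ := hs.congr (fun x hxk => hx x hxk) hm
      have r2 := Run.mul (W := W) s₁ 25 25 22 (by rw [hk, hs₁.reg22]; omega)
      rw [hk, hs₁.reg22] at r2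
      have r3 := Run.add (W := W) (s₁.setReg 25 (i.eval V h * 16)) 25 25 21
        (by simp [hs₁.reg21]; omega)
      have r4 := Run.const (W := W) ((s₁.setReg 25 (i.eval V h * 16)).setReg 25
        (i.eval V h * 16 + b)) 26 a (by omega)
      have r5 := Run.add (W := W) (((s₁.setReg 25 (i.eval V h * 16)).setReg 25
        (i.eval V h * 16 + b)).setReg 26 a) 25 25 26 (by simp; omega)
      simp only [State.setReg_reg, Function.update_self, ne_eq, Nat.reduceEqDiff,
        not_false_eq_true, Function.update_of_ne, hs₁.reg21] at r3 r5
      have hs₂ : Sim V b ((((s₁.setReg 25 (i.eval V h * 16)).setReg 25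
          (i.eval V h * 16 + b)).setReg 26 a).setReg 25 (i.eval V h * 16 + b + a)) h := by
        refine hs₁.congr (fun x hx => ?_) rfl
        have h25 : x ≠ 25 := by omega
        have h26 : x ≠ 26 := by omega
        simp [h25, h26]
      obtain ⟨t', s₃, ht', r6, hm', hx', hk'⟩ :=
        e.computes hV hw.1.2 (W := W) (by omega) (k := 26) (by omega) hs₂
      have hs₃ := hs₂.congr (fun x hxk => hx' x (by omega)) hm'
      have r7 := Run.store (W := W) s₃ 25 26
      rw [hk', hx' 25 (by omega), State.setReg_reg, Function.update_self] at r7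
      refine ⟨_, _, ?_, r1.seq (r2.seq (r3.seq (r4.seq (r5.seq (r6.seq r7))))),
        hs₃.setMem ha hw.1.1.1, hV.setArr (e.eval_le_of_small h4 hV hw.2), fun _ _ => rfl⟩
      simp only [cost]; omega
  | seq p q ihp ihq =>
    simp only [wf, Bool.and_eq_true] at hw
    simp only [bound] at hb
    obtain ⟨t₁, s₁, ht₁, r1, hs₁, hV₁, hm₁⟩ := ihp hw.1 (by omega) hs hV h0 hN
    obtain ⟨t₂, s₂, ht₂, r2, hs₂, hV₂, hm₂⟩ := ihq hw.2 (by omega) hs₁ hV₁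
      (by rw [hm₁ 0 (by omega)]; exact h0) (fun m hm => by rw [hm₁ m hm]; exact hN m hm)
    refine ⟨_, _, ?_, r1.seq r2, hs₂, hV₂, fun m hm => (hm₂ m hm).trans (hm₁ m hm)⟩
    simp only [cost]; omega
  | ite e f p q ihp ihq =>
    simp only [wf, Bool.and_eq_true] at hw
    simp only [bound] at hb
    obtain ⟨t₁, t₂, s₁, s₂, ht, r1, r2, -, -, hk1, hk2, hs₂⟩ :=
      Exp.computes_pair le_rfl hs (e.computes (W := W) hV hw.1.1.1 (by omega) le_rfl hs)
        fun s hs => f.computes hV hw.1.1.2 (by omega) (by omega) hs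
    simp only [eval]
    by_cases hlt : e.eval V h < f.eval V h
    · obtain ⟨t₃, s₃, ht₃, r3, h3⟩ := ihp hw.1.2 (by omega) hs₂ hV h0 hN
      rw [if_pos hlt]
      refine ⟨_, _, ?_, r1.seq (r2.seq (.ite_true (by rw [hk1, hk2]; exact hlt) r3)), h3⟩
      simp only [cost]; omega
    · obtain ⟨t₃, s₃, ht₃, r3, h3⟩ := ihq hw.2 (by omega) hs₂ hV h0 hN
      rw [if_neg hlt]
      refine ⟨_, _, ?_, r1.seq (r2.seq (.ite_false (by rw [hk1, hk2]; exact hlt) r3)), h3⟩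
      simp only [cost]; omega
  | loop i m p ih =>
    simp only [wf, Bool.and_eq_true, decide_eq_true_eq, Bool.not_eq_true'] at hw
    simp only [bound] at hb
    obtain ⟨⟨⟨⟨hi2, hi20⟩, hm2⟩, hpi⟩, hpw⟩ := hw
    have hmV := hV.reg m
    set F : Env → Env := fun s => (p.eval V s).setReg i ((p.eval V s).reg i + 1) with hF
    -- Induction on the number `K` of remaining passes. The body changes neither the counter nor the
    -- bound, so `k + K` stays equal to the initial bound.
    have key : ∀ K k (h' : Env) (s' : State), k + K = h.reg m → h'.reg i = k → Sim V b s' h' →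
        Small V h' → (∀ m < 2, h'.reg m = h.reg m) → ∃ t s'', t ≤ K * (p.cost N + 2) + 1 ∧
          Run W (.loop i m (.seq p.comp (.add i i 23))) s' t s'' ∧ Sim V b s'' (F^[K] h') ∧
          Small V (F^[K] h') ∧ ∀ m < 2, (F^[K] h').reg m = h.reg m := by
      intro K
      induction K with
      | zero =>
        intro k h' s' hk hi hs' hV' hm'
        refine ⟨1, s', by omega, .loop_done ?_, hs', hV', hm'⟩
        rw [hs'.reg i hi20, hs'.reg m (by omega), hi, hm' m hm2]
        omega
      | succ K ihK =>
        intro k h' s' hk hi hs' hV' hm'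
        obtain ⟨t₁, s₁, ht₁, r1, hs₁, hV₁, hm₁⟩ := ih hpw (by omega) hs' hV'
          (by rw [hm' 0 (by omega)]; exact h0) fun m hm => by rw [hm' m hm]; exact hN m hm
        have hreg : (p.eval V h').reg i = k := by rw [p.eval_reg hpi, hi]
        have r2 := Run.add (W := W) s₁ i i 23
          (by rw [hs₁.reg i hi20, hs₁.reg23, hreg]; omega)
        rw [hs₁.reg i hi20, hs₁.reg23, hreg] at r2
        have hFh : F h' = (p.eval V h').setReg i (k + 1) := by simp only [hF]; rw [hreg]
        obtain ⟨t₂, s₂, ht₂, r3, h3⟩ := ihK (k + 1) (F h') (s₁.setReg i (k + 1)) (by omega)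
          (by rw [hFh]; simp) (by rw [hFh]; exact hs₁.setReg hi20)
          (by rw [hFh]; exact hV₁.setReg (by omega)) (fun m hm => by
            have : m ≠ i := by omega
            rw [hFh, Env.setReg_reg, Function.update_of_ne this, hm₁ m hm, hm' m hm])
        refine ⟨_, _, ?_, .loop_step ?_ (r1.seq r2) r3, h3⟩
        · have : (K + 1) * (p.cost N + 2) = K * (p.cost N + 2) + (p.cost N + 2) := by ring
          omega
        · rw [hs'.reg i hi20, hs'.reg m (by omega), hi, hm' m hm2]
          omega
    obtain ⟨t, s', ht, r, h1, h2, h3⟩ := key (h.reg m) 0 (h.setReg i 0) (s.setReg i 0) (by omega)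
      (by simp) (hs.setReg hi20) (hV.setReg (by omega)) fun m hm => by
        have : m ≠ i := by omega
        simp [this]
    refine ⟨_, _, ?_, (Run.const s i 0 (by omega)).seq r, h1, h2, h3⟩
    have := Nat.mul_le_mul_right (p.cost N + 2) (hN m hm2)
    simp only [cost]
    omega

/-! ### Polynomial bounds -/

/-- The function is bounded by a polynomial of the form `c * (n + 1) ^ c`. -/
def PolyBdd (f : ℕ → ℕ) : Prop := ∃ c, ∀ n, f n ≤ c * (n + 1) ^ c

theorem mul_pow_le_mul_pow {a b c d : ℕ} (h : a ≤ b) (h' : c ≤ d) (n : ℕ) :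
    a * (n + 1) ^ c ≤ b * (n + 1) ^ d :=
  Nat.mul_le_mul h (Nat.pow_le_pow_right (Nat.succ_pos n) h')

theorem PolyBdd.add {f g : ℕ → ℕ} (hf : PolyBdd f) (hg : PolyBdd g) :
    PolyBdd fun n => f n + g n := by
  obtain ⟨c, hc⟩ := hf
  obtain ⟨d, hd⟩ := hg
  refine ⟨c + d, fun n => ?_⟩
  have h1 := (hc n).trans (mul_pow_le_mul_pow le_rfl (Nat.le_add_right c d) n)
  have h2 := (hd n).trans (mul_pow_le_mul_pow le_rfl (Nat.le_add_left d c) n)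
  calc f n + g n ≤ _ := Nat.add_le_add h1 h2
    _ = _ := (Nat.add_mul _ _ _).symm

theorem PolyBdd.mul {f g : ℕ → ℕ} (hf : PolyBdd f) (hg : PolyBdd g) :
    PolyBdd fun n => f n * g n := by
  obtain ⟨c, hc⟩ := hf
  obtain ⟨d, hd⟩ := hg
  refine ⟨c * d + (c + d), fun n => ?_⟩
  calc f n * g n ≤ (c * (n + 1) ^ c) * (d * (n + 1) ^ d) := Nat.mul_le_mul (hc n) (hd n)
    _ = (c * d) * (n + 1) ^ (c + d) := by ring
    _ ≤ _ := mul_pow_le_mul_pow (Nat.le_add_right _ _) (Nat.le_add_left _ _) n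

theorem PolyBdd.const (a : ℕ) : PolyBdd fun _ => a :=
  ⟨a, fun n => Nat.le_mul_of_pos_right _ (Nat.pow_pos (Nat.succ_pos n))⟩

theorem PolyBdd.id : PolyBdd fun n => n := ⟨1, fun n => by simp⟩

theorem Exp.polyBdd_bound {V b : ℕ → ℕ} (hV : PolyBdd V) (hb : PolyBdd b) (e : Exp) :
    PolyBdd fun n => e.bound (V n) (b n) := by
  induction e with
  | lit a => exact .const a
  | var x => exact hV
  | add e f he hf => exact he.add hf
  | sub e f he hf => exact he.add hf
  | mul e f he hf => exact (he.add (.const 1)).mul (hf.add (.const 1))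
  | sadd e f he hf => exact (he.add hf).add hV
  | read a e he => exact ((hV.add hb).add ((PolyBdd.const 16).mul he)).add (.const 16)

theorem Stmt.polyBdd_bound {V b : ℕ → ℕ} (hV : PolyBdd V) (hb : PolyBdd b) (p : Stmt) :
    PolyBdd fun n => p.bound (V n) (b n) := by
  induction p with
  | skip => exact .const 0
  | assign x e => exact e.polyBdd_bound hV hb
  | write a i e =>
    exact ((((PolyBdd.const 16).mul (i.polyBdd_bound hV hb)).add hb).add (.const 16)).add
      (e.polyBdd_bound hV hb)
  | seq p q hp hq => exact hp.add hq
  | ite e f p q hp hq =>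
    exact (((e.polyBdd_bound hV hb).add (f.polyBdd_bound hV hb)).add hp).add hq
  | loop i m p hp => exact hp.add hV

/-- A loop has at most `2n + 1 ≤ 2(n + 1)` passes, so every nesting level costs one factor `n + 1`.
-/
theorem Stmt.cost_le (p : Stmt) : ∃ C, ∀ n, p.cost (2 * n + 1) ≤ C * (n + 1) ^ p.depth := by
  induction p with
  | skip => exact ⟨1, fun n => by simp [cost, depth]⟩
  | assign x e => exact ⟨e.cost + 1, fun n => by simp [cost, depth]⟩
  | write a i e => exact ⟨i.cost + e.cost + 5, fun n => by simp [cost, depth]⟩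
  | seq p q hp hq =>
    obtain ⟨c, hc⟩ := hp
    obtain ⟨d, hd⟩ := hq
    refine ⟨c + d, fun n => ?_⟩
    have h1 := (hc n).trans (mul_pow_le_mul_pow le_rfl (le_max_left p.depth q.depth) n)
    have h2 := (hd n).trans (mul_pow_le_mul_pow le_rfl (le_max_right p.depth q.depth) n)
    simp only [cost, depth, Nat.add_mul]
    omega
  | ite e f p q hp hq =>
    obtain ⟨c, hc⟩ := hp
    obtain ⟨d, hd⟩ := hq
    refine ⟨(e.cost + f.cost + 1) + c + d, fun n => ?_⟩
    have h0 := Nat.le_mul_of_pos_right (e.cost + f.cost + 1)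
      (Nat.pow_pos (n := max p.depth q.depth) (Nat.succ_pos n))
    have h1 := (hc n).trans (mul_pow_le_mul_pow le_rfl (le_max_left p.depth q.depth) n)
    have h2 := (hd n).trans (mul_pow_le_mul_pow le_rfl (le_max_right p.depth q.depth) n)
    simp only [cost, depth]
    rw [Nat.add_mul, Nat.add_mul]
    exact Nat.add_le_add (Nat.add_le_add h0 h1) h2
  | loop i m p hp =>
    obtain ⟨c, hc⟩ := hp
    refine ⟨2 * (c + 2) + 2, fun n => ?_⟩
    have h0 : 1 ≤ (n + 1) ^ p.depth := Nat.one_le_pow _ _ (Nat.succ_pos n)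
    have h1 : p.cost (2 * n + 1) + 2 ≤ (c + 2) * (n + 1) ^ p.depth := by
      have := hc n
      rw [Nat.add_mul]
      omega
    simp only [cost, depth]
    calc (2 * n + 1) * (p.cost (2 * n + 1) + 2) + 2
        ≤ (2 * (n + 1)) * ((c + 2) * (n + 1) ^ p.depth) + 2 * (n + 1) ^ (p.depth + 1) := by
          refine Nat.add_le_add (Nat.mul_le_mul (by omega) h1) ?_
          exact Nat.le_mul_of_pos_right _ (Nat.pow_pos (Nat.succ_pos n))
      _ = (2 * (c + 2) + 2) * (n + 1) ^ (p.depth + 1) := by ring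

end BCS

namespace BCS

/-! ### The input in memory, and programs of cubic running time -/

section Input

variable {n : ℕ} {G : SimpleGraph (Fin n)} {B : Finset (Fin n)}

/-- The environment in which the input is presented to a statement. -/
noncomputable def inputEnv (G : SimpleGraph (Fin n)) (B : Finset (Fin n)) : Env where
  reg x := if x = 0 then n else if x = 1 then 2 * n + 1 else 0
  arr a i := if a = 0 then (inputState G B).mem i else 0

theorem mul_add_lt_sq (u v : Fin n) : (u : ℕ) * n + v < n * n := by
  have h1 : ((u : ℕ) + 1) * n ≤ n * n := Nat.mul_le_mul_right _ u.2
  have := v.2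
  rw [Nat.add_mul] at h1
  omega

theorem inputState_mem_eq_zero {i : ℕ} (hi : ¬ i < n * n + n) : (inputState G B).mem i = 0 := by
  simp only [inputState]
  rw [if_neg]
  rintro (⟨u, v, rfl, -⟩ | ⟨v, -, rfl⟩)
  · have := mul_add_lt_sq u v; omega
  · have := v.2; omega

theorem inputState_mem_le (i : ℕ) : (inputState G B).mem i ≤ 1 := by
  simp only [inputState]
  split_ifs <;> simp

open Classical in
theorem inputEnv_adj (u v : Fin n) :
    (inputEnv G B).arr 0 (u * n + v) = if G.Adj u v then 1 else 0 := by
  simp only [inputEnv, if_true, inputState]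
  have h0 := mul_add_lt_sq u v
  refine if_congr ⟨?_, fun h => .inl ⟨u, v, rfl, h⟩⟩ rfl rfl
  rintro (⟨u', v', h1, h2⟩ | ⟨v', -, h1⟩)
  · have hn : 0 < n := by have := u.2; omega
    have h3 : ((u : ℕ) * n + v) % n = (u' * n + v') % n := congrArg (· % n) h1
    have h4 : ((u : ℕ) * n + v) / n = (u' * n + v') / n := congrArg (· / n) h1
    rw [Nat.mul_add_mod_self_right, Nat.mul_add_mod_self_right, Nat.mod_eq_of_lt v.2,
      Nat.mod_eq_of_lt v'.2] at h3
    rw [Nat.mul_comm, Nat.mul_add_div hn, Nat.mul_comm, Nat.mul_add_div hn,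
      Nat.div_eq_of_lt v.2, Nat.div_eq_of_lt v'.2] at h4
    rw [Fin.ext h3, show u = u' from Fin.ext (by omega)]
    exact h2
  · omega

open Classical in
theorem inputEnv_color (v : Fin n) :
    (inputEnv G B).arr 0 (n * n + v) = if v ∈ B then 1 else 0 := by
  simp only [inputEnv, if_true, inputState]
  refine if_congr ⟨?_, fun h => .inr ⟨v, h, rfl⟩⟩ rfl rfl
  rintro (⟨u', v', h1, h2⟩ | ⟨v', h1, h2⟩)
  · have := mul_add_lt_sq u' v'; omega
  · rwa [show v = v' from Fin.ext (by omega)]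

end Input

/-- The machine code that sets up the constants used by compiled statements. -/
def prologue : Prog :=
  .seq (.const 23 1) (.seq (.const 22 16) (.seq (.mul 21 0 0) (.seq (.add 21 21 0)
    (.seq (.add 1 0 0) (.seq (.add 20 1 1) (.seq (.const 25 4) (.seq (.add 20 20 25)
      (.add 1 1 23))))))))

theorem run_prologue {n W : ℕ} (G : SimpleGraph (Fin n)) (B : Finset (Fin n))
    (hW : 16 + n * n + n + (4 * n + 4) < W) :
    ∃ s, Run W prologue (inputState G B) 9 s ∧ Sim (4 * n + 4) (n * n + n) s (inputEnv G B) := by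
  have h0 : (inputState G B).reg 0 = n := rfl
  have hne : ∀ x, x ≠ 0 → (inputState G B).reg x = 0 := fun x hx => by simp [inputState, hx]
  -- The nine instructions leave `n² + n` in register `21`, `2n + 1` in register `1` and `4n + 4` in
  -- register `20`.
  refine ⟨_, Run.seq (t₁ := 1) (t₂ := 8) (.const _ _ _ (by omega))
    (Run.seq (t₁ := 1) (t₂ := 7) (.const _ _ _ (by omega))
    (Run.seq (t₁ := 1) (t₂ := 6) (.mul _ _ _ _ (by simp [h0]; omega))
    (Run.seq (t₁ := 1) (t₂ := 5) (.add _ _ _ _ (by simp [h0]; omega))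
    (Run.seq (t₁ := 1) (t₂ := 4) (.add _ _ _ _ (by simp [h0]; omega))
    (Run.seq (t₁ := 1) (t₂ := 3) (.add _ _ _ _ (by simp [h0]; omega))
    (Run.seq (t₁ := 1) (t₂ := 2) (.const _ _ _ (by omega))
    (Run.seq (t₁ := 1) (t₂ := 1) (.add _ _ _ _ (by simp [h0]; omega))
    (.add _ _ _ _ (by simp [h0]; omega))))))))), ?_⟩
  refine ⟨fun x hx => ?_, ?_, ?_, ?_, ?_, ?_, ?_, ?_, ?_⟩
  · by_cases hx0 : x = 0
    · subst hx0; simp [h0, inputEnv]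
    by_cases hx1 : x = 1
    · subst hx1; simp [h0, inputEnv]; omega
    have h2 : x ≠ 20 ∧ x ≠ 21 ∧ x ≠ 22 ∧ x ≠ 23 ∧ x ≠ 25 := by omega
    simp [h2, hx0, hx1, hne, inputEnv]
  · simp [h0]; omega
  · simp [h0]
  · simp
  · simp
  · simp [hne]
  · intro i _; simp [inputEnv]
  · intro i hi; simp [inputEnv, inputState_mem_eq_zero hi]
  · intro a ha ha' i
    simp only [State.setReg_mem]
    rw [inputState_mem_eq_zero (by omega)]
    simp [inputEnv, ha]

theorem small_inputEnv {n : ℕ} (G : SimpleGraph (Fin n)) (B : Finset (Fin n)) :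
    Small (4 * n + 4) (inputEnv G B) := by
  refine ⟨fun x => ?_, fun a i => ?_⟩
  · simp only [inputEnv]; split_ifs <;> omega
  · have := inputState_mem_le (G := G) (B := B) i
    simp only [inputEnv]; split_ifs <;> omega

/-- A statement with loops of nesting depth at most three is run by the machine in cubic time. -/
theorem exists_prog_of_stmt (p : Stmt) (hw : p.wf = true) (hd : p.depth ≤ 3) :
    ∃ (P : Prog) (c : ℕ) (T : ℕ → ℕ),
      (fun n => (T n : ℝ)) =O[atTop] (fun n : ℕ => (n : ℝ) ^ 3) ∧
      ∀ (n : ℕ) (G : SimpleGraph (Fin n)) (B : Finset (Fin n)), ∃ (t : ℕ) (s : State), t ≤ T n ∧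
        Run (c * (n + 1) ^ c) P (inputState G B) t s ∧
        ∀ i < n * n + n, s.mem i = (p.eval (4 * n + 4) (inputEnv G B)).arr 0 i := by
  have hV : PolyBdd fun n => 4 * n + 4 := ((PolyBdd.const 4).mul .id).add (.const 4)
  have hb : PolyBdd fun n => n * n + n := (PolyBdd.id.mul .id).add .id
  obtain ⟨c, hc⟩ := ((p.polyBdd_bound hV hb).add hb).add (hV.add (.const 16))
  obtain ⟨C, hC⟩ := p.cost_le
  -- The summand `9` is the running time of the prologue. Passing from `c` to `c + 1` makes the
  -- bound on the intermediate values strict, as the word size requires.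
  refine ⟨.seq prologue p.comp, c + 1, fun n => 9 + C * (n + 1) ^ 3, ?_, fun n G B => ?_⟩
  · refine IsBigO.of_bound (9 + 8 * C) ?_
    filter_upwards [eventually_ge_atTop 1] with n hn
    have h1 : 9 + C * (n + 1) ^ 3 ≤ (9 + 8 * C) * n ^ 3 := by
      have h2 : (n + 1) ^ 3 ≤ (2 * n) ^ 3 := Nat.pow_le_pow_left (by omega) 3
      have h3 : 1 ≤ n ^ 3 := Nat.one_le_pow _ _ hn
      calc 9 + C * (n + 1) ^ 3 ≤ 9 * n ^ 3 + C * (2 * n) ^ 3 :=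
            Nat.add_le_add (by omega) (Nat.mul_le_mul_left _ h2)
        _ = (9 + 8 * C) * n ^ 3 := by ring
    rw [Real.norm_of_nonneg (by positivity), Real.norm_of_nonneg (by positivity)]
    exact_mod_cast h1
  · have h1 := hc n
    beta_reduce at h1
    have h2 : c * (n + 1) ^ c < (c + 1) * (n + 1) ^ (c + 1) := by
      have h3 : 1 ≤ (n + 1) ^ c := Nat.one_le_pow _ _ (Nat.succ_pos n)
      calc c * (n + 1) ^ c < (c + 1) * (n + 1) ^ c := by rw [Nat.add_mul]; omega
        _ ≤ _ := mul_pow_le_mul_pow le_rfl (Nat.le_succ c) n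
    generalize (c + 1) * (n + 1) ^ (c + 1) = W at h2
    obtain ⟨s, hs, hsim⟩ := run_prologue (W := W) G B (by omega)
    obtain ⟨t, s', ht, hr, hsim', -, -⟩ := p.run_comp (W := W) (N := 2 * n + 1) hw (by omega)
      (by omega) (by omega) hsim (small_inputEnv G B) (by simp [inputEnv])
      (by
        intro m hm
        simp only [inputEnv]
        split_ifs <;> omega)
    refine ⟨_, s', ?_, hs.seq hr, hsim'.raw⟩
    have h3 := (hC n).trans (mul_pow_le_mul_pow le_rfl hd n)
    change _ ≤ 9 + C * (n + 1) ^ 3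
    omega

end BCS

namespace BCS

/-! ### Rules for loops that fill an array or count -/

section LoopRules

variable {V N i m a : ℕ} {p : Stmt} {s : Env}

/-- A loop whose `k`-th pass sets the cell `f k` of an array to `g k`. -/
theorem Stmt.eval_loop_map (hi : p.modReg i = false) (hN : s.reg m = N) {f g : Fin N → ℕ}
    (hf : Function.Injective f)
    (hs : ∀ (k : Fin N) (s' : Env), s'.reg i = k →
      (∀ x, x ≠ i → p.modReg x = false → s'.reg x = s.reg x) →
      (∀ b, p.modArr b = false → s'.arr b = s.arr b) →
      (∀ k' < k, s'.arr a (f k') = g k') →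
      (∀ x, (∀ k' < k, f k' ≠ x) → s'.arr a x = s.arr a x) →
      (p.eval V s').arr a (f k) = g k ∧
        ∀ x, x ≠ f k → (p.eval V s').arr a x = s'.arr a x) :
    (∀ k, ((Stmt.loop i m p).eval V s).arr a (f k) = g k) ∧
      ∀ x, (∀ k, f k ≠ x) → ((Stmt.loop i m p).eval V s).arr a x = s.arr a x := by
  subst hN
  have := Stmt.eval_loop_induct (V := V) (m := m) (s := s) hi
    (fun k s' => (∀ k' : Fin (s.reg m), (k' : ℕ) < k → s'.arr a (f k') = g k') ∧
      ∀ x, (∀ k' : Fin (s.reg m), (k' : ℕ) < k → f k' ≠ x) → s'.arr a x = s.arr a x)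
    ⟨fun k' hk' => absurd hk' (by omega), fun x _ => rfl⟩ ?_
  · exact ⟨fun k => this.1 k k.2, fun x hx => this.2 x fun k _ => hx k⟩
  · rintro k s' hk hik hreg harr ⟨h1, h2⟩
    obtain ⟨h3, h4⟩ := hs ⟨k, hk⟩ s' hik hreg harr (fun k' hk' => h1 k' hk') fun x hx =>
      h2 x fun k' hk' => hx k' hk'
    simp only [Env.setReg_arr]
    refine ⟨fun k' hk' => ?_, fun x hx => ?_⟩
    · rcases Nat.lt_succ_iff_lt_or_eq.1 hk' with h5 | h5
      · have : f k' ≠ f ⟨k, hk⟩ := fun hc => by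
          have := congrArg Fin.val (hf hc)
          simp only at this
          omega
        rw [h4 _ this, h1 k' h5]
      · obtain rfl : k' = ⟨k, hk⟩ := Fin.ext h5
        exact h3
    · rw [h4 x (hx ⟨k, hk⟩ (Nat.lt_succ_self k)).symm]
      exact h2 x fun k' hk' => hx k' (Nat.lt_succ_of_lt hk')

theorem card_filter_lt_succ {n k : ℕ} (hk : k < n) (Q : Fin n → Prop) [DecidablePred Q] :
    (Finset.univ.filter fun x : Fin n => (x : ℕ) < k + 1 ∧ Q x).card =
      (Finset.univ.filter fun x : Fin n => (x : ℕ) < k ∧ Q x).card + if Q ⟨k, hk⟩ then 1 else 0 := by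
  have h1 : (Finset.univ.filter fun x : Fin n => (x : ℕ) < k + 1 ∧ Q x) =
      (Finset.univ.filter fun x : Fin n => (x : ℕ) < k ∧ Q x) ∪
        (if Q ⟨k, hk⟩ then {⟨k, hk⟩} else ∅) := by
    ext x
    simp only [Finset.mem_filter, Finset.mem_univ, true_and, Finset.mem_union]
    by_cases hx : (x : ℕ) = k
    · obtain rfl : x = ⟨k, hk⟩ := Fin.ext hx
      by_cases hq : Q ⟨k, hk⟩ <;> simp [hq]
    · have h2 : x ≠ ⟨k, hk⟩ := fun hc => hx (congrArg Fin.val hc)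
      have h3 : (x : ℕ) < k + 1 ↔ (x : ℕ) < k := by omega
      rw [h3]
      split_ifs <;> simp [h2]
  rw [h1, Finset.card_union_of_disjoint]
  · split_ifs <;> simp
  · rw [Finset.disjoint_left]
    intro x hx
    simp only [Finset.mem_filter, Finset.mem_univ, true_and] at hx
    split_ifs
    · simp only [Finset.mem_singleton]
      rintro rfl
      simp at hx
    · simp

theorem card_filter_le_fin {n : ℕ} (Q : Fin n → Prop) [DecidablePred Q] :
    (Finset.univ.filter Q).card ≤ n := by
  have := Finset.card_filter_le (Finset.univ : Finset (Fin n)) Q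
  simpa using this

/-- A loop that increments one cell in the passes `k` with `Q k`. -/
theorem Stmt.eval_loop_count {j : ℕ} (hi : p.modReg i = false) (hN : s.reg m = N)
    {Q : Fin N → Prop} [DecidablePred Q] (hV : s.arr a j + N ≤ V)
    (hs : ∀ (k : Fin N) (s' : Env), s'.reg i = k →
      (∀ x, x ≠ i → p.modReg x = false → s'.reg x = s.reg x) →
      (∀ b, p.modArr b = false → s'.arr b = s.arr b) →
      (∀ x, x ≠ j → s'.arr a x = s.arr a x) →
      (p.eval V s').arr a =
        if Q k then Function.update (s'.arr a) j (min (s'.arr a j + 1) V) else s'.arr a) :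
    ((Stmt.loop i m p).eval V s).arr a =
      Function.update (s.arr a) j (s.arr a j + (Finset.univ.filter Q).card) := by
  subst hN
  have := Stmt.eval_loop_induct (V := V) (m := m) (s := s) hi
    (fun k s' => s'.arr a = Function.update (s.arr a) j (s.arr a j +
      (Finset.univ.filter fun x : Fin (s.reg m) => (x : ℕ) < k ∧ Q x).card)) ?_ ?_
  · rw [this]
    congr 3
    ext x
    simp
  · simp
  · intro k s' hk hik hreg harr h1
    have h2 := hs ⟨k, hk⟩ s' hik hreg harr fun x hx => by rw [h1, Function.update_of_ne hx]
    rw [Env.setReg_arr, h2, card_filter_lt_succ hk]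
    have h3 := card_filter_le_fin fun x : Fin (s.reg m) => (x : ℕ) < k + 1 ∧ Q x
    rw [card_filter_lt_succ hk] at h3
    split_ifs with hq
    · rw [if_pos hq] at h3
      rw [h1, Function.update_idem, Function.update_self, min_eq_left (by omega), Nat.add_assoc]
    · rw [h1]; simp

end LoopRules

/-! ### The sweeps -/

section Program

open Exp Stmt

/-- Positive if and only if the vertices in the given variables are adjacent. -/
def adjExp (x y : ℕ) : Exp := read 0 (add (mul (var x) (var 0)) (var y))

/-- Zero if and only if the two values are equal. -/
def distExp (e f : Exp) : Exp := add (sub e f) (sub f e)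

def labelExp (x : ℕ) : Exp := read 2 (var x)

def clearCount : Stmt := loop 4 0 (write 3 (var 4) (lit 0))

/-- Count the vertex in variable `4` in the number of vertices that keep their label. -/
def countCell : Stmt :=
  ite (labelExp 4) (labelExp 3)
    (ite (adjExp 4 3) (lit 1) (write 3 (labelExp 4) (sadd (read 3 (labelExp 4)) (lit 1))) skip)
    (ite (labelExp 3) (labelExp 4)
      (ite (lit 0) (adjExp 4 3) (write 3 (labelExp 4) (sadd (read 3 (labelExp 4)) (lit 1))) skip)
      skip)

/-- If no vertex of the class stays, all of them are shifted by zero. Only a positive count is a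
change of label, so only then is the flag in variable `5` raised. -/
def moveVertex : Stmt :=
  seq (ite (lit 0) (read 3 (labelExp 4)) (assign 5 (lit 1)) skip)
    (write 2 (var 4) (sadd (labelExp 4) (read 3 (labelExp 4))))

def moveCell : Stmt :=
  ite (labelExp 4) (labelExp 3) (ite (lit 0) (adjExp 4 3) moveVertex skip)
    (ite (labelExp 3) (labelExp 4) (ite (adjExp 4 3) (lit 1) moveVertex skip) skip)

/-- Split the classes with the pivot in variable `3`; variable `5` is set if a label changes. -/
def pivotStmt : Stmt := seq clearCount (seq (loop 4 0 countCell) (loop 4 0 moveCell))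

def freshCell : Stmt :=
  ite (distExp (labelExp 4) (var 8)) (lit 1)
    (ite (lit 0) (distExp (var 4) (var 7)) (write 2 (var 7) (sadd (labelExp 7) (lit 1))) skip) skip

/-- Move the vertex with index `6` in the given order to the end of its class. -/
def freshStmt : Stmt :=
  seq (assign 7 (read 1 (var 6))) (seq (assign 6 (sadd (var 6) (lit 1)))
    (seq (assign 8 (labelExp 7)) (loop 4 0 freshCell)))

def sweepBody : Stmt :=
  seq (assign 5 (lit 0)) (seq (loop 3 0 pivotStmt)
    (ite (var 5) (lit 1) (ite (var 6) (var 0) freshStmt skip) skip))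

def sweepStmt : Stmt :=
  seq (loop 4 0 (write 2 (var 4) (lit 0))) (seq (assign 6 (lit 0)) (loop 2 1 sweepBody))

def invertStmt : Stmt := loop 4 0 (write 1 (labelExp 4) (var 4))

end Program

/-! ### Correctness of a pivot -/

section SweepCorrect

variable {n : ℕ} {G : SimpleGraph (Fin n)} {B : Finset (Fin n)}

/-- The registers and the array for the input are intact. -/
structure Base (G : SimpleGraph (Fin n)) (B : Finset (Fin n)) (s : Env) : Prop where
  reg0 : s.reg 0 = n
  reg1 : s.reg 1 = 2 * n + 1
  arr0 : s.arr 0 = (inputEnv G B).arr 0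

theorem Base.congr {s s' : Env} (h : Base G B s) (h0 : s'.reg 0 = s.reg 0)
    (h1 : s'.reg 1 = s.reg 1) (h2 : s'.arr 0 = s.arr 0) : Base G B s' :=
  ⟨h0.trans h.reg0, h1.trans h.reg1, h2.trans h.arr0⟩

theorem Base.eval {s : Env} (h : Base G B s) {V : ℕ} (p : Stmt)
    (hp : (!p.modReg 0 && !p.modReg 1 && !p.modArr 0) = true) : Base G B (p.eval V s) := by
  simp only [Bool.and_eq_true, Bool.not_eq_true'] at hp
  exact h.congr (p.eval_reg hp.1.1 s) (p.eval_reg hp.1.2 s) (p.eval_arr hp.2 s)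

theorem Base.setReg {s : Env} (h : Base G B s) {x a : ℕ} (hx : 2 ≤ x) : Base G B (s.setReg x a) :=
  h.congr (by simp [show (0 : ℕ) ≠ x by omega]) (by simp [show (1 : ℕ) ≠ x by omega]) rfl

/-- The array `a` holds the values of `c`. -/
def Holds (s : Env) (a : ℕ) (c : Fin n → ℕ) : Prop := ∀ v : Fin n, s.arr a v = c v

open Classical in
theorem Base.eval_adjExp {s : Env} (h : Base G B s) {V x y : ℕ} {u v : Fin n} (hu : s.reg x = u)
    (hv : s.reg y = v) : (adjExp x y).eval V s = if G.Adj u v then 1 else 0 := by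
  simp only [adjExp, Exp.eval, hu, hv, h.reg0, h.arr0]
  exact inputEnv_adj u v

theorem Holds.eval_labelExp {s : Env} {c : Fin n → ℕ} (h : Holds s 2 c) {V x : ℕ} {u : Fin n}
    (hu : s.reg x = u) : (labelExp x).eval V s = c u := by
  simp only [labelExp, Exp.eval, hu, h u]

variable {V : ℕ} {c : Fin n → ℕ} {s : Env} {q u : Fin n}

open Classical in
theorem eval_countCell (hb : Base G B s) (hc : Holds s 2 c) (h3 : s.reg 3 = q)
    (h4 : s.reg 4 = u) : countCell.eval V s = if c u ≠ c q ∧ ¬ Later G c q u then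
      s.setArr 3 (c u) (min (s.arr 3 (c u) + 1) V) else s := by
  have e1 : (labelExp 4).eval V s = c u := hc.eval_labelExp h4
  have e2 : (labelExp 3).eval V s = c q := hc.eval_labelExp h3
  have e3 := hb.eval_adjExp (V := V) h4 h3
  simp only [countCell, Stmt.eval, e1, e2, e3, Exp.eval, Later]
  rcases lt_trichotomy (c u) (c q) with h | h | h
  · by_cases ha : G.Adj u q <;> simp [ha, h, h.ne, h.not_gt]
  · simp [h]
  · by_cases ha : G.Adj u q <;> simp [ha, h, h.ne', h.not_gt]

open Classical in
theorem eval_moveCell (hb : Base G B s) (hc : s.arr 2 u = c u) (hq : s.arr 2 q = c q)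
    (h3 : s.reg 3 = q) (h4 : s.reg 4 = u) : moveCell.eval V s =
      if Later G c q u then
        (if 0 < s.arr 3 (c u) then s.setReg 5 1 else s).setArr 2 u (min (c u + s.arr 3 (c u)) V)
      else s := by
  have e1 : (labelExp 4).eval V s = c u := by simp only [labelExp, Exp.eval, h4, hc]
  have e2 : (labelExp 3).eval V s = c q := by simp only [labelExp, Exp.eval, h3, hq]
  have e3 := hb.eval_adjExp (V := V) h4 h3
  have e4 : moveVertex.eval V s =
      (if 0 < s.arr 3 (c u) then s.setReg 5 1 else s).setArr 2 u (min (c u + s.arr 3 (c u)) V) := by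
    simp only [moveVertex, Stmt.eval, Exp.eval, e1]
    split_ifs <;> simp_all [labelExp, Exp.eval]
  simp only [moveCell, Stmt.eval, e1, e2, e3, e4, Exp.eval, Later]
  by_cases ha : G.Adj u q <;> rcases lt_trichotomy (c u) (c q) with h | h | h <;>
    simp [ha, h, h.not_gt]


theorem split_of_later {q u : Fin n} (h : ¬ Later G c q u) : split c (Later G c q) u = c u := by
  simp [split, h]

/-- The pivot keeps its label, so comparisons with it remain valid while the labels of the other
vertices are being overwritten. -/
theorem not_later_self : ¬ Later G c q q := by
  unfold Later; omega

theorem pivotStmt_spec (hb : Base G B s) (hc : Holds s 2 c) (hval : ValidLabel c)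
    (h3 : s.reg 3 = q) (hV : n ≤ V) :
    Holds (pivotStmt.eval V s) 2 (split c (Later G c q)) ∧
      (split c (Later G c q) = c → (pivotStmt.eval V s).reg 5 = s.reg 5) ∧
      (split c (Later G c q) ≠ c → (pivotStmt.eval V s).reg 5 = 1) := by
  classical
  have hlt : ∀ v, c v < n := fun v => by simpa using hval.lt_card v
  set s₁ := clearCount.eval V s with hs₁
  set s₂ := (Stmt.loop 4 0 countCell).eval V s₁ with hs₂
  have hP : pivotStmt.eval V s = (Stmt.loop 4 0 moveCell).eval V s₂ := rfl
  have hb₁ : Base G B s₁ := hb.eval _ rfl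
  have hb₂ : Base G B s₂ := hb₁.eval _ rfl
  have hc₁ : Holds s₁ 2 c := fun v => by
    rw [hs₁, Stmt.eval_arr _ (by rfl)]; exact hc v
  have hc₂ : Holds s₂ 2 c := fun v => by
    rw [hs₂, Stmt.eval_arr _ (by rfl)]; exact hc₁ v
  have h3₁ : s₁.reg 3 = q := by rw [hs₁, Stmt.eval_reg _ (by rfl)]; exact h3
  have h3₂ : s₂.reg 3 = q := by rw [hs₂, Stmt.eval_reg _ (by rfl)]; exact h3₁
  have h5₂ : s₂.reg 5 = s.reg 5 := by
    rw [hs₂, Stmt.eval_reg _ (by rfl), hs₁, Stmt.eval_reg _ (by rfl)]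
  have hclear : ∀ x < n, s₁.arr 3 x = 0 := by
    have := (Stmt.eval_loop_map (V := V) (i := 4) (m := 0) (a := 3) (s := s) (N := n)
      (p := .write 3 (.var 4) (.lit 0)) rfl hb.reg0 (f := fun k => k) (g := fun _ => 0)
      Fin.val_injective (fun k s' hk _ _ _ _ => by
        simp only [Stmt.eval, Exp.eval]
        simp +contextual [hk])).1
    exact fun x hx => this ⟨x, hx⟩
  have hcount : ∀ x < n, s₂.arr 3 x =
      (Finset.univ.filter fun v : Fin n => c v = x ∧ c v ≠ c q ∧ ¬ Later G c q v).card := by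
    have := Stmt.eval_loop_induct (V := V) (i := 4) (m := 0) (s := s₁) (p := countCell) rfl
      (fun k s' => ∀ x < n, s'.arr 3 x = (Finset.univ.filter fun v : Fin n =>
        (v : ℕ) < k ∧ (c v = x ∧ c v ≠ c q ∧ ¬ Later G c q v)).card) ?_ ?_
    · intro x hx
      rw [hs₂, this x hx]
      congr 1
      ext v
      simp [hb₁.reg0]
    · intro x hx
      simp [hclear x hx]
    · intro k s' hk hik hreg harr ih x hx
      rw [hb₁.reg0] at hk
      have hb' : Base G B s' := hb₁.congr (hreg 0 (by decide) rfl) (hreg 1 (by decide) rfl)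
        (harr 0 rfl)
      have hc' : Holds s' 2 c := fun v => by rw [harr 2 rfl]; exact hc₁ v
      have h3' : s'.reg 3 = q := by rw [hreg 3 (by decide) rfl]; exact h3₁
      rw [Env.setReg_arr, eval_countCell (u := ⟨k, hk⟩) hb' hc' h3' hik, card_filter_lt_succ hk,
        ← ih x hx]
      by_cases hQ : c ⟨k, hk⟩ ≠ c q ∧ ¬ Later G c q ⟨k, hk⟩
      · rw [if_pos hQ]
        by_cases hxk : x = c ⟨k, hk⟩
        · subst hxk
          have h6 := card_filter_le_fin fun v : Fin n => (v : ℕ) < k + 1 ∧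
            (c v = c ⟨k, hk⟩ ∧ c v ≠ c q ∧ ¬ Later G c q v)
          rw [card_filter_lt_succ hk, ← ih _ hx, if_pos ⟨rfl, hQ⟩] at h6
          simp only [Env.setArr_arr, Function.update_self]
          rw [if_pos ⟨trivial, hQ⟩]
          omega
        · rw [if_neg fun hc => hxk hc.1.symm]
          simp [hxk]
      · rw [if_neg hQ, if_neg fun hc => hQ hc.2]
        rfl
  -- The count leaves out the class of the pivot, but a vertex that is moved is never in that class,
  -- so for it the count is the one in `split`.
  have hcount' : ∀ v, Later G c q v → c v + s₂.arr 3 (c v) = split c (Later G c q) v := by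
    intro v hv
    rw [hcount _ (hlt v)]
    simp only [split, hv, if_true]
    congr 2
    ext x
    simp only [Finset.mem_filter, Finset.mem_univ, true_and]
    have : c v ≠ c q := by unfold Later at hv; omega
    constructor
    · exact fun h => ⟨h.1, h.2.2⟩
    · exact fun h => ⟨h.1, h.1 ▸ this, h.2⟩
  have hsplit_lt : ∀ v, split c (Later G c q) v < n := fun v => by
    simpa using (hval.split _).lt_card v
  have := Stmt.eval_loop_induct (V := V) (i := 4) (m := 0) (s := s₂) (p := moveCell) rfl
    (fun k s' => (∀ v : Fin n, s'.arr 2 v = if (v : ℕ) < k then split c (Later G c q) v else c v) ∧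
      ((∀ v : Fin n, (v : ℕ) < k → split c (Later G c q) v = c v) → s'.reg 5 = s.reg 5) ∧
      ((∃ v : Fin n, (v : ℕ) < k ∧ split c (Later G c q) v ≠ c v) → s'.reg 5 = 1)) ?_ ?_
  · rw [← hP, hb₂.reg0] at this
    refine ⟨fun v => by rw [this.1 v, if_pos v.2], fun h => this.2.1 fun v _ => congrFun h v,
      fun h => ?_⟩
    obtain ⟨v, hv⟩ := Function.ne_iff.1 h
    exact this.2.2 ⟨v, v.2, hv⟩
  · refine ⟨fun v => by simp [hc₂ v], fun _ => by simpa using h5₂, ?_⟩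
    rintro ⟨v, hv, -⟩
    omega
  · rintro k s' hk hik hreg harr ⟨ih1, ih2, ih3⟩
    rw [hb₂.reg0] at hk
    have hb' : Base G B s' := hb₂.congr (hreg 0 (by decide) rfl) (hreg 1 (by decide) rfl)
      (harr 0 rfl)
    have h3' : s'.reg 3 = q := by rw [hreg 3 (by decide) rfl]; exact h3₂
    have hcu : s'.arr 2 (⟨k, hk⟩ : Fin n) = c ⟨k, hk⟩ := by rw [ih1]; simp
    have hcq : s'.arr 2 q = c q := by
      rw [ih1, split_of_later not_later_self]; simp
    have hne : ∀ v : Fin n, (v : ℕ) < k + 1 → v ≠ ⟨k, hk⟩ → (v : ℕ) < k := fun v hv hv' => by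
      have : (v : ℕ) ≠ k := fun h => hv' (Fin.ext h)
      omega
    have hne' : ∀ v : Fin n, v ≠ ⟨k, hk⟩ → (v : ℕ) ≠ k := fun v hv' h => hv' (Fin.ext h)
    rw [eval_moveCell (u := ⟨k, hk⟩) hb' hcu hcq h3' hik, harr 3 rfl]
    by_cases hL : Later G c q ⟨k, hk⟩
    · rw [if_pos hL, hcount' _ hL, min_eq_left ((hsplit_lt _).le.trans hV)]
      have hpos : 0 < s₂.arr 3 (c ⟨k, hk⟩) ↔ split c (Later G c q) ⟨k, hk⟩ ≠ c ⟨k, hk⟩ := by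
        have := hcount' _ hL
        omega
      refine ⟨fun v => ?_, fun h => ?_, fun h => ?_⟩
      · by_cases hv : v = ⟨k, hk⟩
        · subst hv
          simp
        · have h7 : (v : ℕ) < k + 1 ↔ (v : ℕ) < k := by have := hne' v hv; omega
          have h8 : ((if 0 < s₂.arr 3 (c ⟨k, hk⟩) then s'.setReg 5 1 else s').arr 2) = s'.arr 2 := by
            split_ifs <;> rfl
          simp only [Env.setReg_arr, Env.setArr_arr, Function.update_self, h8]
          rw [Function.update_of_ne (hne' v hv), ih1]
          simp only [h7]
      · rw [if_neg (by rw [hpos]; simp [h ⟨k, hk⟩ (Nat.lt_succ_self k)])]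
        simpa using ih2 fun v hv => h v (Nat.lt_succ_of_lt hv)
      · by_cases hch : split c (Later G c q) ⟨k, hk⟩ = c ⟨k, hk⟩
        · rw [if_neg (by rw [hpos]; simp [hch])]
          obtain ⟨v, hv, hv'⟩ := h
          have := ih3 ⟨v, hne v hv (by rintro rfl; exact hv' hch), hv'⟩
          simpa using this
        · rw [if_pos (hpos.2 hch)]
          simp
    · rw [if_neg hL]
      have hch := split_of_later hL
      refine ⟨fun v => ?_, fun h => ?_, ?_⟩
      · rw [Env.setReg_arr, ih1]
        by_cases hv : v = ⟨k, hk⟩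
        · subst hv; simp [hch]
        · have h7 : (v : ℕ) < k + 1 ↔ (v : ℕ) < k := by have := hne' v hv; omega
          simp only [h7]
      · simpa using ih2 fun v hv => h v (Nat.lt_succ_of_lt hv)
      · rintro ⟨v, hv, hv'⟩
        have := ih3 ⟨v, hne v hv (by rintro rfl; exact hv' hch), hv'⟩
        simpa using this

end SweepCorrect

end BCS

namespace BCS

/-! ### Correctness and termination of a sweep -/

section SweepLoop

variable {n : ℕ} {G : SimpleGraph (Fin n)} {B : Finset (Fin n)} {V : ℕ} {c : Fin n → ℕ} {s : Env}

theorem freshStmt_spec (hb : Base G B s) (hc : Holds s 2 c) (hval : ValidLabel c) {v : Fin n}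
    (h1 : s.arr 1 (s.reg 6) = v) (hV : 2 * n ≤ V) (hV' : s.reg 6 + 1 ≤ V) :
    Holds (freshStmt.eval V s) 2 (split c (· = v)) ∧
      (freshStmt.eval V s).reg 6 = s.reg 6 + 1 := by
  classical
  have hlt : ∀ v, c v < n := fun v => by simpa using hval.lt_card v
  set s₁ : Env := ((s.setReg 7 v).setReg 6 (s.reg 6 + 1)).setReg 8 (c v) with hs₁
  have hP : freshStmt.eval V s = (Stmt.loop 4 0 freshCell).eval V s₁ := by
    simp only [freshStmt, Stmt.eval, Exp.eval, h1, labelExp]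
    simp [hs₁, min_eq_left hV', hc v]
  have hb₁ : Base G B s₁ :=
    ((hb.setReg (by omega)).setReg (by omega)).setReg (by omega)
  constructor
  -- Each other member of the class raises the label of `v` by one. The old label is kept in
  -- variable `8`, and the pass for `v` itself changes nothing.
  · have := Stmt.eval_loop_count (V := V) (i := 4) (m := 0) (a := 2) (j := v) (s := s₁) (N := n)
      (p := freshCell) rfl hb₁.reg0 (Q := fun k => c k = c v ∧ ¬ k = v)
      (by have := hc v; have := hlt v; simp [hs₁]; omega) (fun k s' hk hreg harr hx => ?_)
    · intro u
      rw [hP, this]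
      by_cases huv : u = v
      · subst huv
        simp [split, hs₁, hc u]
      · have : (u : ℕ) ≠ v := fun h => huv (Fin.ext h)
        simp [split, huv, this, hs₁, hc u]
    · have h7 : s'.reg 7 = v := by rw [hreg 7 (by decide) rfl]; simp [hs₁]
      have h8 : s'.reg 8 = c v := by rw [hreg 8 (by decide) rfl]; simp [hs₁]
      simp only [freshCell, Stmt.eval, distExp, Exp.eval, h7, h8, hk, labelExp]
      by_cases hkv : k = v
      · subst hkv
        simp
      · have h9 : (k : ℕ) ≠ v := fun h => hkv (Fin.ext h)
        have h10 : 0 < (k : ℕ) - v + (v - k) := by omega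
        rw [hx k h9, show s₁.arr 2 k = c k from hc k]
        by_cases hck : c k = c v
        · simp [hck, hkv, h10]
        · rw [if_neg (by omega), if_neg fun h => hck h.1]
  · rw [hP, Stmt.eval_reg _ (by rfl)]
    simp [hs₁]

theorem pivotLoop_spec {ok : (Fin n → ℕ) → Fin n → Prop} (hb : Base G B s) (hc : Holds s 2 c)
    (hr : Reach G ok c) (h5 : s.reg 5 = 0) (hV : n ≤ V) :
    ∃ c', Holds ((Stmt.loop 3 0 pivotStmt).eval V s) 2 c' ∧ Reach G ok c' ∧
      (∀ u v, c' u = c' v → c u = c v) ∧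
      ((((Stmt.loop 3 0 pivotStmt).eval V s).reg 5 = 0 ∧ c' = c ∧
        ∀ p, split c (Later G c p) = c) ∨
      (((Stmt.loop 3 0 pivotStmt).eval V s).reg 5 = 1 ∧
        (Finset.univ.image c).card < (Finset.univ.image c').card)) := by
  have := Stmt.eval_loop_induct (V := V) (i := 3) (m := 0) (s := s) (p := pivotStmt) rfl
    (fun k s' => ∃ c', Holds s' 2 c' ∧ Reach G ok c' ∧ (∀ u v, c' u = c' v → c u = c v) ∧
      ((s'.reg 5 = 0 ∧ c' = c ∧ ∀ p : Fin n, (p : ℕ) < k → split c (Later G c p) = c) ∨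
      (s'.reg 5 = 1 ∧ (Finset.univ.image c).card < (Finset.univ.image c').card))) ?_ ?_
  · rw [hb.reg0] at this
    obtain ⟨c', h1, h2, h3, h4⟩ := this
    exact ⟨c', h1, h2, h3, h4.imp_left fun h => ⟨h.1, h.2.1, fun p => h.2.2 p p.2⟩⟩
  · exact ⟨c, hc, hr, fun u v h => h, .inl ⟨by simpa using h5, rfl, fun p hp => absurd hp (by omega)⟩⟩
  · rintro k s' hk hik hreg harr ⟨c', h1, h2, h3, h4⟩
    rw [hb.reg0] at hk
    have hb' : Base G B s' := hb.congr (hreg 0 (by decide) rfl) (hreg 1 (by decide) rfl)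
      (harr 0 rfl)
    obtain ⟨h6, h7, h8⟩ := pivotStmt_spec (q := ⟨k, hk⟩) hb' h1 h2.valid hik hV
    have hreg5 : ((pivotStmt.eval V s').setReg 3 (k + 1)).reg 5 = (pivotStmt.eval V s').reg 5 := by
      simp
    refine ⟨split c' (Later G c' ⟨k, hk⟩), h6, h2.pivot _, fun u v huv =>
      h3 u v (h2.valid.split_eq_split.1 huv).1, ?_⟩
    rw [hreg5]
    by_cases hch : split c' (Later G c' ⟨k, hk⟩) = c'
    · rw [h7 hch, hch]
      refine h4.imp_left fun h => ⟨h.1, h.2.1, fun p hp => ?_⟩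
      rcases Nat.lt_succ_iff_lt_or_eq.1 hp with h9 | h9
      · exact h.2.2 p h9
      · obtain rfl : p = ⟨k, hk⟩ := Fin.ext h9
        rwa [h.2.1] at hch
    · right
      rw [h8 hch]
      have h9 := h2.valid.card_image_lt hch
      rcases h4 with h4 | h4
      · rw [h4.2.1] at h9 ⊢
        exact ⟨rfl, h9⟩
      · exact ⟨rfl, h4.2.trans h9⟩

/-- The invariant of a sweep after `k` rounds. -/
def SweepInv (G : SimpleGraph (Fin n)) (key : Fin n → ℕ) (k : ℕ) (s : Env) : Prop :=
  ∃ c : Fin n → ℕ, Holds s 2 c ∧ Reach G (IsFirstByKey key) c ∧ s.reg 6 ≤ n ∧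
    (∀ v, key v < s.reg 6 → ∀ u, c u = c v → u = v) ∧
    (k ≤ (Finset.univ.image c).card + s.reg 6 ∨ s.reg 6 = n)

/-- Every round either creates a class or, when no pivot splits, advances the pointer in variable
`6` unless it is already `n`. So the number of classes plus the pointer grows until all vertices
have been chosen. -/
theorem sweepBody_spec {key : Fin n → ℕ} (hkey : Function.Injective key) (hlt : ∀ v, key v < n)
    (hb : Base G B s) (h1 : ∀ v : Fin n, s.arr 1 (key v) = v) (hV : 2 * n + 1 ≤ V) {k : ℕ}
    (h : SweepInv G key k s) : SweepInv G key (k + 1) (sweepBody.eval V s) := by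
  obtain ⟨c, hc, hr, h6, hsing, hk⟩ := h
  set s₁ := s.setReg 5 0 with hs₁
  set s₂ := (Stmt.loop 3 0 pivotStmt).eval V s₁ with hs₂
  have hP : sweepBody.eval V s = if s₂.reg 5 < 1 then (if s₂.reg 6 < s₂.reg 0 then
    freshStmt.eval V s₂ else s₂) else s₂ := rfl
  have hb₁ : Base G B s₁ := hb.setReg (by omega)
  have hb₂ : Base G B s₂ := hb₁.eval _ rfl
  obtain ⟨c', hc', hr', href, hcase⟩ := pivotLoop_spec (V := V) (s := s₁) hb₁ hc hr
    (by simp [hs₁]) (by omega)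
  have h62 : s₂.reg 6 = s.reg 6 := by
    rw [hs₂, Stmt.eval_reg _ (by rfl)]; simp [hs₁]
  have hsing' : ∀ v, key v < s.reg 6 → ∀ u, c' u = c' v → u = v := fun v hv u hu =>
    hsing v hv u (href u v hu)
  rw [hP]
  rcases hcase with ⟨h5, rfl, hall⟩ | ⟨h5, hcard⟩
  · rw [if_pos (by rw [h5]; omega), hb₂.reg0, h62]
    split_ifs with h6n
    · obtain ⟨v, hv⟩ := exists_pos_eq hkey hlt h6n
      have h12 : s₂.arr 1 (s₂.reg 6) = v := by
        rw [hs₂, Stmt.eval_arr _ (by rfl), ← hs₂, h62, ← hv]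
        exact h1 v
      obtain ⟨h7, h8⟩ := freshStmt_spec (V := V) hb₂ hc' hr'.valid h12 (by omega) (by omega)
      -- Vertices of smaller key have been chosen before and are alone in their classes.
      have hfirst : IsFirstByKey key c' v := by
        intro u hu
        by_contra hlt'
        have := hsing' u (by omega) v hu.symm
        rw [this] at hlt'
        omega
      have hself : ∀ u, split c' (· = v) u = split c' (· = v) v → u = v := fun u hu =>
        (hr'.valid.split_eq_split.1 hu).2.2 rfl
      refine ⟨_, h7, hr'.fresh v hfirst (isModuleIn_of_split_eq hall v), by omega, ?_, ?_⟩
      · intro w hw u hu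
        rw [h8, h62] at hw
        by_cases hwv : w = v
        · rw [hwv] at hu ⊢; exact hself u hu
        · have : key w ≠ key v := fun h => hwv (hkey h)
          exact hsing' w (by omega) u (hr'.valid.split_eq_split.1 hu).1
      · rw [h8, h62]
        have := Finset.card_le_card (image_subset_image_split (c := c') (· = v))
        omega
    · exact ⟨c', hc', hr', by omega, fun v hv => hsing' v (by omega), by omega⟩
  · rw [if_neg (by rw [h5]; omega)]
    exact ⟨c', hc', hr', by omega, fun v hv => hsing' v (by omega), by omega⟩

theorem sweepStmt_spec {key : Fin n → ℕ} (hkey : Function.Injective key) (hlt : ∀ v, key v < n)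
    (hb : Base G B s) (h1 : ∀ v : Fin n, s.arr 1 (key v) = v) (hV : 2 * n + 1 ≤ V) :
    ∃ c : Fin n → ℕ, Holds (sweepStmt.eval V s) 2 c ∧ Reach G (IsFirstByKey key) c ∧
      Function.Injective c := by
  set s₀ := (Stmt.loop 4 0 (.write 2 (.var 4) (.lit 0))).eval V s with hs₀
  set s₁ := s₀.setReg 6 0 with hs₁
  have hP : sweepStmt.eval V s = (Stmt.loop 2 1 sweepBody).eval V s₁ := rfl
  have hb₁ : Base G B s₁ := (hb.eval _ rfl).setReg (by omega)
  have hzero := (Stmt.eval_loop_map (V := V) (i := 4) (m := 0) (a := 2) (s := s) (N := n)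
      (p := .write 2 (.var 4) (.lit 0)) rfl hb.reg0 (f := fun k => k) (g := fun _ => 0)
      Fin.val_injective (fun k s' hk _ _ _ _ => by
        simp only [Stmt.eval, Exp.eval]
        simp +contextual [hk])).1
  have h11 : ∀ v : Fin n, s₁.arr 1 (key v) = v := fun v => by
    rw [hs₁, Env.setReg_arr, hs₀, Stmt.eval_arr _ (by rfl)]; exact h1 v
  have := Stmt.eval_loop_induct (V := V) (i := 2) (m := 1) (s := s₁) (p := sweepBody) rfl
    (fun k s' => SweepInv G key k s') ?_ ?_
  · rw [hb₁.reg1, ← hP] at this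
    obtain ⟨c, hc, hr, h6, hsing, hk⟩ := this
    -- Classes and pointer are both at most `n`, so after `2n + 1` rounds the second alternative of
    -- the invariant holds: the pointer is `n`, and all classes are singletons.
    refine ⟨c, hc, hr, fun u v huv => hsing v ?_ u huv⟩
    have h7 : (Finset.univ.image c).card ≤ n := by
      simpa using Finset.card_image_le (s := Finset.univ) (f := c)
    have := hlt v
    omega
  · exact ⟨fun _ => 0, fun v => by simpa [hs₁] using hzero v, .zero, by simp [hs₁],
      fun v hv => absurd hv (by simp [hs₁]), .inl (by omega)⟩
  · intro k s' hk hik hreg harr hinv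
    have hb' : Base G B s' := hb₁.congr (hreg 0 (by decide) rfl) (hreg 1 (by decide) rfl)
      (harr 0 rfl)
    have h := sweepBody_spec (V := V) hkey hlt hb' (fun v => by rw [harr 1 rfl]; exact h11 v) hV hinv
    obtain ⟨c, hc, hr, h6, hsing, hk⟩ := h
    exact ⟨c, hc, hr, by simpa using h6, by simpa using hsing, by simpa using hk⟩

theorem invertStmt_spec (hb : Base G B s) (hc : Holds s 2 c) (hinj : Function.Injective c)
    (v : Fin n) : (invertStmt.eval V s).arr 1 (c v) = v :=
  (Stmt.eval_loop_map (V := V) (i := 4) (m := 0) (a := 1) (s := s) (N := n)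
    (p := .write 1 (labelExp 4) (.var 4)) rfl hb.reg0 (f := c) (g := fun v => v) hinj
    (fun k s' hk _ harr _ _ => by
      have : s'.arr 2 k = c k := by rw [harr 2 rfl]; exact hc k
      simp only [Stmt.eval, Exp.eval, labelExp, hk, this]
      simp +contextual)).1 v

end SweepLoop

section Program

open Exp Stmt

/-- Two sweeps; array `2` holds the labels of the second one. -/
def twoSweepsStmt : Stmt :=
  seq (loop 4 0 (write 1 (var 4) (var 4))) (seq sweepStmt (seq invertStmt sweepStmt))

end Program

theorem twoSweepsStmt_spec {n : ℕ} {G : SimpleGraph (Fin n)} {B : Finset (Fin n)} {V : ℕ} {s : Env}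
    (hG : IsIntervalGraph G) (hb : Base G B s) (hV : 2 * n + 1 ≤ V) :
    ∃ c : Fin n → ℕ, Holds (twoSweepsStmt.eval V s) 2 c ∧ Function.Injective c ∧
      IsTransOrient G Set.univ fun u w => c u < c w ∧ ¬ G.Adj u w := by
  set s₁ := (Stmt.loop 4 0 (.write 1 (.var 4) (.var 4))).eval V s with hs₁
  set s₂ := sweepStmt.eval V s₁ with hs₂
  set s₃ := invertStmt.eval V s₂ with hs₃
  have hP : twoSweepsStmt.eval V s = sweepStmt.eval V s₃ := rfl
  have hb₁ : Base G B s₁ := hb.eval _ rfl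
  have hb₂ : Base G B s₂ := hb₁.eval _ rfl
  have hb₃ : Base G B s₃ := hb₂.eval _ rfl
  have hid := (Stmt.eval_loop_map (V := V) (i := 4) (m := 0) (a := 1) (s := s) (N := n)
      (p := .write 1 (.var 4) (.var 4)) rfl hb.reg0 (f := fun k => k) (g := fun k => k)
      Fin.val_injective (fun k s' hk _ _ _ _ => by
        simp only [Stmt.eval, Exp.eval]
        simp +contextual [hk])).1
  obtain ⟨c₁, hc₁, hr₁, hinj₁⟩ := sweepStmt_spec (V := V) (G := G) Fin.val_injective
    (fun v => v.2) hb₁ hid hV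
  obtain ⟨c₂, hc₂, hr₂, hinj₂⟩ := sweepStmt_spec (V := V) (G := G) hinj₁
    (fun v => by simpa using hr₁.valid.lt_card v) hb₃ (invertStmt_spec hb₂ hc₁ hinj₁) hV
  exact ⟨c₂, hP ▸ hc₂, hinj₂, isTransOrient_of_two_sweeps hG hr₁ hinj₁ hr₂ hinj₂⟩

end BCS

namespace BCS

/-! ### Computing an interval representation from the labels -/

section Program

open Exp Stmt

def predStmt : Stmt :=
  loop 4 0 (seq (write 6 (var 4) (lit 0)) (loop 3 0 (ite (labelExp 3) (labelExp 4)
    (ite (adjExp 3 4) (lit 1) (write 6 (var 4) (sadd (read 6 (var 4)) (lit 1))) skip) skip)))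

def keyExp (x : ℕ) : Exp := add (mul (read 6 (var x)) (var 0)) (var x)

def posStmt : Stmt :=
  loop 4 0 (seq (write 7 (var 4) (lit 0)) (loop 3 0 (ite (keyExp 3) (keyExp 4)
    (write 7 (var 4) (sadd (read 7 (var 4)) (lit 1))) skip)))

def orderStmt : Stmt := loop 4 0 (write 9 (read 7 (var 4)) (var 4))

def reachCell : Stmt :=
  ite (lit 0) (adjExp 4 3) (ite (read 8 (var 4)) (read 7 (var 3)) (write 8 (var 4) (read 7 (var 3)))
    skip) skip

def reachStmt : Stmt :=
  loop 4 0 (seq (write 8 (var 4) (read 7 (var 4))) (loop 3 0 reachCell))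

/-- From the labels in array `2`, compute the interval representation: positions in array `7`,
right ends in array `8`, and the vertices by position in array `9`. -/
def repStmt : Stmt := seq predStmt (seq posStmt (seq orderStmt reachStmt))

end Program

section RepCorrect

variable {n : ℕ} {G : SimpleGraph (Fin n)} {B : Finset (Fin n)} {V : ℕ} {c : Fin n → ℕ} {s : Env}

/-- A double loop that counts, for every vertex, the vertices in relation to it. -/
theorem eval_loop_loop_count {a : ℕ} {p : Stmt} {Q : Fin n → Fin n → Prop}
    [∀ u, DecidablePred (Q u)] (hb : Base G B s) (ha : a ≠ 0) (hV : n ≤ V)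
    (hp : p.modReg 0 = false ∧ p.modReg 3 = false ∧ p.modReg 4 = false)
    (hs : ∀ (u k : Fin n) (s' : Env), s'.reg 4 = u → s'.reg 3 = k → s'.reg 0 = n →
      (∀ b, b ≠ a → p.modArr b = false → s'.arr b = s.arr b) →
      (p.eval V s').arr a = if Q u k then
        Function.update (s'.arr a) u (min (s'.arr a u + 1) V) else s'.arr a) :
    ∀ u : Fin n, ((Stmt.loop 4 0 (.seq (.write a (.var 4) (.lit 0)) (.loop 3 0 p))).eval V s).arr a u
      = (Finset.univ.filter (Q u)).card := by
  refine (Stmt.eval_loop_map (V := V) (i := 4) (m := 0) (a := a) (s := s) (N := n)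
    (by simp [Stmt.modReg, hp]) hb.reg0 (f := fun k => k)
    (g := fun u => (Finset.univ.filter (Q u)).card) Fin.val_injective ?_).1
  intro u s' hu hreg harr _ _
  have hn : s'.reg 0 = n := by rw [hreg 0 (by decide) (by simp [Stmt.modReg, hp])]; exact hb.reg0
  set s₁ := s'.setArr a u 0 with hs₁
  have hP : (Stmt.seq (.write a (.var 4) (.lit 0)) (.loop 3 0 p)).eval V s' =
      (Stmt.loop 3 0 p).eval V s₁ := by
    simp only [Stmt.eval, Exp.eval, hu, ha, false_and, if_false, hs₁]
  have := Stmt.eval_loop_count (V := V) (i := 3) (m := 0) (a := a) (j := u) (s := s₁) (N := n)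
    (p := p) (Q := Q u) hp.2.1 (by simpa [hs₁] using hn) (by simpa [hs₁] using hV) ?_
  · rw [hP, this]
    constructor
    · simp [hs₁]
    · intro x hx
      simp [hs₁, hx]
  · intro k s₂ hk hreg' harr' _
    refine hs u k s₂ ?_ hk ?_ fun b hb hpb => ?_
    · rw [hreg' 4 (by decide) hp.2.2]; simpa [hs₁] using hu
    · rw [hreg' 0 (by decide) hp.1]; simpa [hs₁] using hn
    · rw [harr' b hpb, hs₁, Env.setArr_arr, Function.update_of_ne hb,
        harr b (by simp [Stmt.modArr, hpb, hb.symm])]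

theorem predStmt_spec (hb : Base G B s) (hc : Holds s 2 c) (hV : n ≤ V) :
    Holds (predStmt.eval V s) 6 (predCount G c) := by
  classical
  refine eval_loop_loop_count hb (by decide) hV (by decide) ?_
  intro u k s' hu hk hn harr
  have hadj : (adjExp 3 4).eval V s' = if G.Adj k u then 1 else 0 := by
    simp only [adjExp, Exp.eval, hu, hk, hn, harr 0 (by decide) rfl, hb.arr0]
    exact inputEnv_adj k u
  have hc' : Holds s' 2 c := fun v => by rw [harr 2 (by decide) rfl]; exact hc v
  simp only [Stmt.eval, hadj, hc'.eval_labelExp hu, hc'.eval_labelExp hk, Exp.eval, hu]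
  by_cases h1 : c k < c u <;> by_cases h2 : G.Adj k u <;> simp [h1, h2]

theorem posStmt_spec (hb : Base G B s) (hc : Holds s 6 (predCount G c)) (hV : n ≤ V) :
    Holds (posStmt.eval V s) 7 (position G c) := by
  refine eval_loop_loop_count hb (by decide) hV (by decide) ?_
  intro u k s' hu hk hn harr
  have hc' : Holds s' 6 (predCount G c) := fun v => by
    rw [harr 6 (by decide) rfl]; exact hc v
  simp only [Stmt.eval, keyExp, Exp.eval, hu, hk, hn, hc' u, hc' k]
  split_ifs <;> simp_all

theorem orderStmt_spec (hb : Base G B s) {pos : Fin n → ℕ} (hc : Holds s 7 pos)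
    (hinj : Function.Injective pos) (v : Fin n) : (orderStmt.eval V s).arr 9 (pos v) = v :=
  (Stmt.eval_loop_map (V := V) (i := 4) (m := 0) (a := 9) (s := s) (N := n)
    (p := .write 9 (.read 7 (.var 4)) (.var 4)) rfl hb.reg0 (f := pos) (g := fun v => v) hinj
    (fun k s' hk _ harr _ _ => by
      have : s'.arr 7 k = pos k := by rw [harr 7 rfl]; exact hc k
      simp only [Stmt.eval, Exp.eval, hk, this]
      simp +contextual)).1 v

theorem reachStmt_spec (hb : Base G B s) {pos : Fin n → ℕ} (hc : Holds s 7 pos) :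
    Holds (reachStmt.eval V s) 8 (reachPos G pos) := by
  classical
  refine (Stmt.eval_loop_map (V := V) (i := 4) (m := 0) (a := 8) (s := s) (N := n)
    rfl hb.reg0 (f := fun k => k) (g := reachPos G pos) Fin.val_injective ?_).1
  intro u s' hu hreg harr _ _
  have hb' : Base G B s' := hb.congr (hreg 0 (by decide) rfl) (hreg 1 (by decide) rfl) (harr 0 rfl)
  have hc' : Holds s' 7 pos := fun v => by rw [harr 7 rfl]; exact hc v
  set s₁ := s'.setArr 8 u (pos u) with hs₁
  have hP : (Stmt.seq (.write 8 (.var 4) (.read 7 (.var 4))) (.loop 3 0 reachCell)).eval V s' =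
      (Stmt.loop 3 0 reachCell).eval V s₁ := by
    simp [Stmt.eval, Exp.eval, hu, hc' u, hs₁]
  rw [hP]
  -- The cell dominates the neighbours seen so far and is always the position of a member of the
  -- closed neighbourhood, so at the end it is the maximum.
  have := Stmt.eval_loop_induct (V := V) (i := 3) (m := 0) (s := s₁) (p := reachCell) rfl
    (fun k s' => (∀ x, x ≠ (u : ℕ) → s'.arr 8 x = s₁.arr 8 x) ∧
      (∀ x : Fin n, (x = u ∨ ((x : ℕ) < k ∧ G.Adj u x)) → pos x ≤ s'.arr 8 u) ∧
      ∃ x, (x = u ∨ G.Adj u x) ∧ s'.arr 8 u = pos x) ?_ ?_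
  · obtain ⟨h1, h2, x, h3, h4⟩ := this
    constructor
    · refine le_antisymm ?_ (Finset.sup_le fun x hx => ?_)
      · rw [h4]
        exact Finset.le_sup (f := pos) (by simpa using h3)
      · refine h2 x ?_
        have hn : s₁.reg 0 = n := hb'.reg0
        simpa [hn] using hx
    · intro x hx
      rw [h1 x hx]
      simp [hs₁, hx]
  · refine ⟨fun x _ => rfl, ?_, u, .inl rfl, by simp [hs₁]⟩
    rintro x (rfl | h)
    · simp [hs₁]
    · omega
  · rintro k s₂ hk hik hreg' harr' ⟨h1, h2, y, h3, h4⟩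
    have hb₂ : Base G B s₂ := hb'.congr (hreg' 0 (by decide) rfl) (hreg' 1 (by decide) rfl)
      (harr' 0 rfl)
    have hk' : k < n := by rwa [show s₁.reg 0 = n from hb'.reg0] at hk
    have hc₂ : Holds s₂ 7 pos := fun v => by rw [harr' 7 rfl]; exact hc' v
    have hu₂ : s₂.reg 4 = u := by rw [hreg' 4 (by decide) rfl]; exact hu
    have hadj := hb₂.eval_adjExp (V := V) (v := ⟨k, hk'⟩) hu₂ hik
    have hcell : reachCell.eval V s₂ = if G.Adj u ⟨k, hk'⟩ ∧ s₂.arr 8 u < pos ⟨k, hk'⟩ then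
        s₂.setArr 8 u (pos ⟨k, hk'⟩) else s₂ := by
      have := hc₂ ⟨k, hk'⟩
      simp only at this
      simp only [reachCell, Stmt.eval, hadj, Exp.eval, hu₂, hik, this]
      by_cases h5 : G.Adj u ⟨k, hk'⟩ <;> simp [h5]
    have hsplit : ∀ x : Fin n, (x : ℕ) < k + 1 → (x : ℕ) < k ∨ x = ⟨k, hk'⟩ := fun x hx =>
      (Nat.lt_succ_iff_lt_or_eq.1 hx).imp_right Fin.ext
    rw [hcell]
    split_ifs with h5
    · refine ⟨fun x hx => by simpa [hx] using h1 x hx, fun x hx => ?_, ⟨k, hk'⟩, .inr h5.1, by simp⟩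
      simp only [Env.setReg_arr, Env.setArr_arr, Function.update_self]
      rcases hx with hx | ⟨hx, hxu⟩
      · exact (h2 x (.inl hx)).trans h5.2.le
      · rcases hsplit x hx with h6 | rfl
        · exact (h2 x (.inr ⟨h6, hxu⟩)).trans h5.2.le
        · rfl
    · refine ⟨h1, fun x hx => ?_, y, h3, h4⟩
      rcases hx with hx | ⟨hx, hxu⟩
      · exact h2 x (.inl hx)
      · rcases hsplit x hx with h6 | rfl
        · exact h2 x (.inr ⟨h6, hxu⟩)
        · exact not_lt.1 fun h => h5 ⟨hxu, h⟩

theorem repStmt_spec (hb : Base G B s) (hc : Holds s 2 c) (hV : n ≤ V) :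
    Holds (repStmt.eval V s) 8 (reachPos G (position G c)) ∧
      ∀ v : Fin n, (repStmt.eval V s).arr 9 (position G c v) = v := by
  have hb₁ : Base G B (predStmt.eval V s) := hb.eval _ rfl
  have hb₂ : Base G B (posStmt.eval V (predStmt.eval V s)) := hb₁.eval _ rfl
  have h2 := posStmt_spec hb₁ (predStmt_spec hb hc hV) hV
  have hb₃ : Base G B (orderStmt.eval V (posStmt.eval V (predStmt.eval V s))) := hb₂.eval _ rfl
  have h3 : Holds (orderStmt.eval V (posStmt.eval V (predStmt.eval V s))) 7 (position G c) :=
    fun v => by rw [Stmt.eval_arr orderStmt (by rfl)]; exact h2 v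
  refine ⟨reachStmt_spec hb₃ h3, fun v => ?_⟩
  have h4 := orderStmt_spec (V := V) hb₂ h2 (position_injective c) v
  rw [← h4]
  exact congrFun (Stmt.eval_arr reachStmt (by rfl) _) _

end RepCorrect

end BCS

namespace BCS

/-! ### Filling the tables -/

section Program

open Exp Stmt

/-- The address of the entry `(i, k, d)` of a table. -/
def idxExp (i k d : Exp) : Exp := add (mul (add (mul i (var 1)) k) (var 1)) d

def nextExp : Exp := add (var 2) (lit 1)

def colorExp (x : ℕ) : Exp := read 0 (add (mul (var 0) (var 0)) (var x))

def copyStmt : Stmt :=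
  loop 3 1 (loop 4 1 (write 4 (idxExp nextExp (var 3) (var 4))
    (read 4 (idxExp (var 2) (var 3) (var 4)))))

def mergeStmt : Stmt :=
  ite (distExp (var 3) (var 0)) (lit 1) (assign 9 (var 8))
    (ite (var 3) (var 8) (assign 9 (var 8)) (assign 9 (var 3)))

def shiftStmt : Stmt :=
  ite (lit 0) (colorExp 7) (assign 11 (sadd (var 4) (lit 1))) (assign 11 (sub (var 4) (lit 1)))

def cellUpdate : Stmt :=
  seq (write 4 (idxExp nextExp (var 9) (var 11)) (sadd (var 10) (lit 1)))
    (write 5 (idxExp nextExp (var 9) (var 11)) (sadd (var 3) (lit 1)))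

def cellStmt : Stmt :=
  seq (assign 10 (read 4 (idxExp (var 2) (var 3) (var 4))))
    (ite (lit 0) (var 10) (seq shiftStmt
      (ite (read 4 (idxExp nextExp (var 9) (var 11))) (sadd (var 10) (lit 1)) cellUpdate skip)) skip)

/-- Sets with `k` below the current position end before the new interval and are skipped. The
available loop bounds are `n` and `2n + 1`; the second is needed to include `k = n`, the empty set.
-/
def extendStmt : Stmt :=
  loop 3 1 (ite (var 3) (var 2) skip (seq mergeStmt (loop 4 1 cellStmt)))

def rowStmt : Stmt :=
  seq (assign 7 (read 9 (var 2))) (seq (assign 8 (read 8 (var 7))) (seq copyStmt extendStmt))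

/-- Fill the tables of sizes (array `4`) and parent pointers (array `5`). -/
def tableStmt : Stmt :=
  seq (write 4 (idxExp (lit 0) (var 0) (var 0)) (lit 1)) (loop 2 0 rowStmt)

end Program

section TableCorrect

/-- The address of the entry `(i, k, d)`. -/
def idx (n i k d : ℕ) : ℕ := (i * (2 * n + 1) + k) * (2 * n + 1) + d

theorem idx_inj {n i k d i' k' d' : ℕ} (hk : k < 2 * n + 1) (hd : d < 2 * n + 1)
    (hk' : k' < 2 * n + 1) (hd' : d' < 2 * n + 1) :
    idx n i k d = idx n i' k' d' ↔ i = i' ∧ k = k' ∧ d = d' := by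
  have key : ∀ {a b a' b' : ℕ}, b < 2 * n + 1 → b' < 2 * n + 1 →
      a * (2 * n + 1) + b = a' * (2 * n + 1) + b' → a = a' ∧ b = b' := by
    intro a b a' b' hb hb' h
    have h1 : (a * (2 * n + 1) + b) % (2 * n + 1) = (a' * (2 * n + 1) + b') % (2 * n + 1) :=
      congrArg (· % (2 * n + 1)) h
    rw [Nat.mul_add_mod_self_right, Nat.mul_add_mod_self_right, Nat.mod_eq_of_lt hb,
      Nat.mod_eq_of_lt hb'] at h1
    subst h1
    exact ⟨Nat.eq_of_mul_eq_mul_right (Nat.succ_pos (2 * n)) (Nat.add_right_cancel h), rfl⟩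
  constructor
  · intro h
    obtain ⟨h1, h2⟩ := key hd hd' h
    obtain ⟨h3, h4⟩ := key hk hk' h1
    exact ⟨h3, h4, h2⟩
  · rintro ⟨rfl, rfl, rfl⟩; rfl

variable {n : ℕ} {G : SimpleGraph (Fin n)} {B : Finset (Fin n)} {V : ℕ} {s : Env}

/-- The table stored in the array `a`. -/
def tab (n : ℕ) (s : Env) (a i k d : ℕ) : ℕ := s.arr a (idx n i k d)

/-- The conditions `TableRow` while the row is extended; `done` tells which entries of the
previous row have been used. -/
structure PartialRow (n : ℕ) (B : Finset (Fin n)) (r : Fin n → ℕ) (v : Fin n) (i : ℕ)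
    (done : ℕ → ℕ → Prop) (D D' P : ℕ → ℕ → ℕ) : Prop where
  mono : ∀ k < 2 * n + 1, ∀ d < 2 * n + 1, D k d ≤ D' k d
  extend : ∀ k < 2 * n + 1, i ≤ k → ∀ d < 2 * n + 1, done k d → 0 < D k d →
    D k d + 1 ≤ D' (mergeEnd n k (r v)) (shiftDiff B v d)
  keep : ∀ k < 2 * n + 1, ∀ d < 2 * n + 1, P k d = 0 → D' k d = D k d
  parent : ∀ k < 2 * n + 1, ∀ d < 2 * n + 1, ∀ q, P k d = q + 1 → i ≤ q ∧ q < 2 * n + 1 ∧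
    mergeEnd n q (r v) = k ∧
    ∃ d' < 2 * n + 1, shiftDiff B v d' = d ∧ 0 < D q d' ∧ D' k d = D q d' + 1

theorem PartialRow.imp {r : Fin n → ℕ} {v : Fin n} {i : ℕ} {done done' : ℕ → ℕ → Prop}
    {D D' P : ℕ → ℕ → ℕ} (h : PartialRow n B r v i done D D' P)
    (hd : ∀ k < 2 * n + 1, i ≤ k → ∀ d < 2 * n + 1, 0 < D k d → done' k d → done k d) :
    PartialRow n B r v i done' D D' P :=
  ⟨h.mono, fun k hk hik d hd' hdone hp => h.extend k hk hik d hd' (hd k hk hik d hd' hp hdone) hp,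
    h.keep, h.parent⟩

theorem mergeEnd_lt {k ρ : ℕ} (hk : k ≤ n) (hρ : ρ < n) : mergeEnd n k ρ < 2 * n + 1 := by
  unfold mergeEnd; split_ifs <;> omega

theorem shiftDiff_lt {v : Fin n} {i d : ℕ} (hi : i < n) (hd : d ≤ n + i) :
    shiftDiff B v d < 2 * n + 1 := by
  unfold shiftDiff; split_ifs <;> omega

/-- Size and pointer are overwritten together, so pointers stay truthful. The new size is larger
than the old one, so extensions recorded earlier remain dominated. -/
theorem PartialRow.update {r : Fin n → ℕ} {v : Fin n} {i : ℕ} (hr : ∀ v, r v < n) (hi : i < n)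
    {done : ℕ → ℕ → Prop} {D D' P D'' P'' : ℕ → ℕ → ℕ} (hD : RowSupport n i D)
    (h : PartialRow n B r v i done D D' P) {k d : ℕ} (hk : k < 2 * n + 1) (hik : i ≤ k)
    (hd : d < 2 * n + 1) (hpos : 0 < D k d)
    (hlt : D' (mergeEnd n k (r v)) (shiftDiff B v d) < D k d + 1)
    (hD'' : ∀ a < 2 * n + 1, ∀ b < 2 * n + 1, D'' a b =
      if a = mergeEnd n k (r v) ∧ b = shiftDiff B v d then D k d + 1 else D' a b)
    (hP'' : ∀ a < 2 * n + 1, ∀ b < 2 * n + 1, P'' a b =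
      if a = mergeEnd n k (r v) ∧ b = shiftDiff B v d then k + 1 else P a b) :
    PartialRow n B r v i (fun a b => done a b ∨ (a = k ∧ b = d)) D D'' P'' := by
  have hle : ∀ a < 2 * n + 1, ∀ b < 2 * n + 1, D' a b ≤ D'' a b := by
    intro a ha b hb
    rw [hD'' a ha b hb]
    split_ifs with h1
    · rw [h1.1, h1.2]; exact hlt.le
    · rfl
  refine ⟨fun a ha b hb => (h.mono a ha b hb).trans (hle a ha b hb), ?_, ?_, ?_⟩
  · intro a ha hia b hb hdone hp
    have h1 := hD a ha b hb hp
    have h2 := mergeEnd_lt h1.1 (hr v)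
    have h3 := shiftDiff_lt (B := B) (v := v) hi h1.2.2.1
    rcases hdone with hdone | ⟨rfl, rfl⟩
    · exact (h.extend a ha hia b hb hdone hp).trans (hle _ h2 _ h3)
    · rw [hD'' _ h2 _ h3, if_pos ⟨rfl, rfl⟩]
  · intro a ha b hb h1
    rw [hP'' a ha b hb] at h1
    rw [hD'' a ha b hb]
    split_ifs at h1 ⊢ with h2
    exact h.keep a ha b hb h1
  · intro a ha b hb q h1
    rw [hP'' a ha b hb] at h1
    rw [hD'' a ha b hb]
    split_ifs at h1 ⊢ with h2
    · obtain rfl : k = q := by omega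
      exact ⟨hik, hk, h2.1.symm, d, hd, h2.2.symm, hpos, rfl⟩
    · exact h.parent a ha b hb q h1

open Classical in
theorem Base.eval_colorExp (hb : Base G B s) {x : ℕ} {v : Fin n} (hv : s.reg x = v) :
    (colorExp x).eval V s = if v ∈ B then 1 else 0 := by
  simp only [colorExp, Exp.eval, hb.reg0, hv, hb.arr0]
  exact inputEnv_color v

theorem eval_idxExp (h1 : s.reg 1 = 2 * n + 1) (i k d : Exp) :
    (idxExp i k d).eval V s = idx n (i.eval V s) (k.eval V s) (d.eval V s) := by
  simp only [idxExp, Exp.eval, h1, idx]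

theorem copyStmt_spec (hb : Base G B s) {i : ℕ} (hi : s.reg 2 = i) :
    ∀ i' k d, k < 2 * n + 1 → d < 2 * n + 1 →
      tab n (copyStmt.eval V s) 4 i' k d = if i' = i + 1 then tab n s 4 i k d else tab n s 4 i' k d := by
  have := Stmt.eval_loop_induct (V := V) (i := 3) (m := 1) (s := s)
    (p := .loop 4 1 (.write 4 (idxExp nextExp (.var 3) (.var 4))
      (.read 4 (idxExp (.var 2) (.var 3) (.var 4))))) rfl
    (fun K s' => ∀ i' k d, k < 2 * n + 1 → d < 2 * n + 1 →
      tab n s' 4 i' k d = if i' = i + 1 ∧ k < K then tab n s 4 i k d else tab n s 4 i' k d) ?_ ?_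
  · intro i' k d hk hd
    rw [copyStmt, this i' k d hk hd, hb.reg1]
    simp [hk]
  · intro i' k d _ _
    simp [tab]
  · intro K s' hK hiK hreg harr ih i' k d hk hd
    rw [hb.reg1] at hK
    have h1 : s'.reg 1 = 2 * n + 1 := by rw [hreg 1 (by decide) rfl]; exact hb.reg1
    have h2 : s'.reg 2 = i := by rw [hreg 2 (by decide) rfl]; exact hi
    have hmap := Stmt.eval_loop_map (V := V) (i := 4) (m := 1) (a := 4) (s := s')
      (N := 2 * n + 1) (p := .write 4 (idxExp nextExp (.var 3) (.var 4))
      (.read 4 (idxExp (.var 2) (.var 3) (.var 4)))) rfl h1 (f := fun d => idx n (i + 1) K d)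
      (g := fun d => tab n s 4 i K d)
      (fun a b hab => Fin.ext ((idx_inj hK a.2 hK b.2).1 hab).2.2) ?_
    · change ((Stmt.loop 4 1 _).eval V s').arr 4 (idx n i' k d) = _
      by_cases hc : i' = i + 1 ∧ k = K
      · obtain ⟨rfl, rfl⟩ := hc
        rw [if_pos ⟨rfl, by omega⟩]
        exact hmap.1 ⟨d, hd⟩
      · rw [hmap.2 _ fun b hb => hc ?_]
        · rw [show s'.arr 4 (idx n i' k d) = tab n s' 4 i' k d from rfl, ih i' k d hk hd]
          refine if_congr ?_ rfl rfl
          constructor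
          · exact fun h => ⟨h.1, by omega⟩
          · exact fun h => ⟨h.1, by have : k ≠ K := fun hk => hc ⟨h.1, hk⟩
                                    omega⟩
        · have := (idx_inj hK b.2 hk hd).1 hb
          exact ⟨this.1.symm, this.2.1.symm⟩
    · intro d s₂ hd₂ hreg' harr' _ hun
      have h1' : s₂.reg 1 = 2 * n + 1 := by rw [hreg' 1 (by decide) rfl]; exact h1
      have h2' : s₂.reg 2 = i := by rw [hreg' 2 (by decide) rfl]; exact h2
      have h3' : s₂.reg 3 = K := by rw [hreg' 3 (by decide) rfl]; exact hiK
      have h4 : s₂.arr 4 (idx n i K d) = tab n s 4 i K d := by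
        rw [hun]
        · rw [show s'.arr 4 (idx n i K d) = tab n s' 4 i K d from rfl, ih i K d hK d.2,
            if_neg (by omega)]
        · intro k' _ hc
          have := ((idx_inj hK k'.2 hK d.2).1 hc).1
          omega
      simp only [Stmt.eval, eval_idxExp h1', nextExp, Exp.eval, h2', h3', hd₂, h4]
      simp +contextual

theorem mergeStmt_eval (hb : Base G B s) {k ρ : ℕ} (h3 : s.reg 3 = k) (h8 : s.reg 8 = ρ) :
    mergeStmt.eval V s = s.setReg 9 (mergeEnd n k ρ) := by
  simp only [mergeStmt, Stmt.eval, distExp, Exp.eval, h3, h8, hb.reg0, mergeEnd]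
  by_cases h1 : k = n
  · subst h1; simp
  · rw [if_neg (by omega), if_neg h1]
    split_ifs with h2
    · rw [max_eq_right h2.le]
    · rw [max_eq_left (not_lt.1 h2)]

theorem shiftStmt_eval (hb : Base G B s) {v : Fin n} {d : ℕ} (h4 : s.reg 4 = d)
    (h7 : s.reg 7 = v) (hV : d + 1 ≤ V) : shiftStmt.eval V s = s.setReg 11 (shiftDiff B v d) := by
  simp only [shiftStmt, Stmt.eval, hb.eval_colorExp h7]
  simp only [Exp.eval, h4, min_eq_left hV, shiftDiff]
  by_cases h : v ∈ B <;> simp [h]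

theorem cellStmt_arr (hb : Base G B s) {v : Fin n} {i k d κ : ℕ} (h2 : s.reg 2 = i)
    (h3 : s.reg 3 = k) (h4 : s.reg 4 = d) (h7 : s.reg 7 = v) (h9 : s.reg 9 = κ) (hV : d + 1 ≤ V)
    (hV' : tab n s 4 i k d + 1 ≤ V) (hk : k + 1 ≤ V) (a : ℕ) :
    (cellStmt.eval V s).arr a =
      if 0 < tab n s 4 i k d ∧
        tab n s 4 (i + 1) κ (shiftDiff B v d) < tab n s 4 i k d + 1 then
      (if a = 4 then Function.update (s.arr 4) (idx n (i + 1) κ (shiftDiff B v d))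
          (tab n s 4 i k d + 1) else if a = 5 then
        Function.update (s.arr 5) (idx n (i + 1) κ (shiftDiff B v d)) (k + 1) else s.arr a)
      else s.arr a := by
  set s₁ := s.setReg 10 (tab n s 4 i k d) with hs₁
  have e1 : (Exp.read 4 (idxExp (.var 2) (.var 3) (.var 4))).eval V s = tab n s 4 i k d := by
    simp only [Exp.eval, eval_idxExp hb.reg1, h2, h3, h4]; rfl
  have hb₁ : Base G B s₁ := hb.setReg (by omega)
  have e2 := shiftStmt_eval (V := V) (s := s₁) (v := v) (d := d) hb₁ (by simpa [hs₁] using h4)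
    (by simpa [hs₁] using h7) hV
  have e3 : (s₁.setReg 11 (shiftDiff B v d)).reg 1 = 2 * n + 1 := by simpa using hb₁.reg1
  have e4 : (Exp.read 4 (idxExp nextExp (.var 9) (.var 11))).eval V
      (s₁.setReg 11 (shiftDiff B v d)) = tab n s 4 (i + 1) κ (shiftDiff B v d) := by
    simp only [Exp.eval, eval_idxExp e3, nextExp]
    simp [hs₁, h2, h9, tab]
  have e5 : (Exp.sadd (.var 10) (.lit 1)).eval V (s₁.setReg 11 (shiftDiff B v d)) =
      tab n s 4 i k d + 1 := by
    simp [Exp.eval, hs₁, hV']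
  have e6 : (cellUpdate.eval V (s₁.setReg 11 (shiftDiff B v d))).arr a =
      if a = 4 then Function.update (s.arr 4) (idx n (i + 1) κ (shiftDiff B v d))
          (tab n s 4 i k d + 1) else if a = 5 then
        Function.update (s.arr 5) (idx n (i + 1) κ (shiftDiff B v d)) (k + 1) else s.arr a := by
    simp only [cellUpdate, Stmt.eval, e5, eval_idxExp e3]
    simp only [nextExp, Exp.eval, OfNat.ofNat_ne_zero, false_and, if_false, Env.setArr_reg,
      eval_idxExp (show ((s₁.setReg 11 (shiftDiff B v d)).setArr _ _ _).reg 1 = 2 * n + 1 from e3)]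
    by_cases h4 : a = 4
    · subst h4; simp [hs₁, h2, h9]
    · by_cases h5 : a = 5
      · subst h5; simp [hs₁, h2, h9, h3, hk]
      · simp [h4, h5, hs₁]
  simp only [cellStmt, Stmt.eval, e1, ← hs₁, e2, e4, e5]
  simp only [Exp.eval]
  have e7 : s₁.reg 10 = tab n s 4 i k d := by simp [hs₁]
  simp only [e7]
  by_cases h5 : 0 < tab n s 4 i k d
  · by_cases h6 : tab n s 4 (i + 1) κ (shiftDiff B v d) < tab n s 4 i k d + 1
    · rw [if_pos h5, if_pos h6, if_pos ⟨h5, h6⟩, e6]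
    · rw [if_pos h5, if_neg h6, if_neg fun h => h6 h.2]; simp [hs₁]
  · rw [if_neg h5, if_neg fun h => h5 h.1]; simp [hs₁]

/-- The state while row `i + 1` is extended from row `i`. -/
structure ExtendInv (n : ℕ) (B : Finset (Fin n)) (r : Fin n → ℕ) (v : Fin n) (i : ℕ) (s : Env)
    (done : ℕ → ℕ → Prop) (s' : Env) : Prop where
  other : ∀ i', i' ≠ i + 1 → ∀ k < 2 * n + 1, ∀ d < 2 * n + 1, ∀ a, a = 4 ∨ a = 5 →
    tab n s' a i' k d = tab n s a i' k d
  row : PartialRow n B r v i done (tab n s 4 i) (tab n s' 4 (i + 1)) (tab n s' 5 (i + 1))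

theorem cellStmt_spec {r : Fin n → ℕ} {v : Fin n} {i k d : ℕ} {s' : Env} {done : ℕ → ℕ → Prop}
    (hr : ∀ v, r v < n) (hi : i < n) (hD : RowSupport n i (tab n s 4 i)) (hb : Base G B s')
    (h2 : s'.reg 2 = i) (h3 : s'.reg 3 = k) (h4 : s'.reg 4 = d) (h7 : s'.reg 7 = v)
    (h9 : s'.reg 9 = mergeEnd n k (r v)) (hV : 2 * n + 2 ≤ V) (hk : k < 2 * n + 1) (hik : i ≤ k)
    (hd : d < 2 * n + 1) (h : ExtendInv n B r v i s done s') :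
    ExtendInv n B r v i s (fun a b => done a b ∨ (a = k ∧ b = d)) (cellStmt.eval V s') := by
  have hold := h.other i (by omega) k hk d hd 4 (.inl rfl)
  by_cases hpos : 0 < tab n s 4 i k d
  swap
  · have harr : ∀ a, (cellStmt.eval V s').arr a = s'.arr a := fun a => by
      rw [cellStmt_arr hb h2 h3 h4 h7 h9 (by omega) (by omega) (by omega), if_neg (by omega)]
    have htab : ∀ a i' k' d', tab n (cellStmt.eval V s') a i' k' d' = tab n s' a i' k' d' :=
      fun a i' k' d' => by simp only [tab, harr]
    have htab' : ∀ a i', tab n (cellStmt.eval V s') a i' = tab n s' a i' :=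
      fun a i' => by ext k' d'; exact htab a i' k' d'
    refine ⟨fun i' hi' k' hk' d' hd' a ha => by rw [htab]; exact h.other i' hi' k' hk' d' hd' a ha, ?_⟩
    rw [htab', htab']
    refine h.row.imp fun a ha hia b hb hp hdone => hdone.resolve_right ?_
    rintro ⟨rfl, rfl⟩
    exact hpos hp
  -- A positive entry obeys the support bounds, so its target lies inside the table, where addresses
  -- are injective.
  have hsup := hD k hk d hd hpos
  have hm := mergeEnd_lt hsup.1 (hr v)
  have hs := shiftDiff_lt (B := B) (v := v) hi hsup.2.2.1
  have harr := cellStmt_arr hb h2 h3 h4 h7 h9 (V := V) (by omega) (by omega) (by omega)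
  rw [hold] at harr
  by_cases hlt : tab n s' 4 (i + 1) (mergeEnd n k (r v)) (shiftDiff B v d) < tab n s 4 i k d + 1
  · have hc : 0 < tab n s 4 i k d ∧
      tab n s' 4 (i + 1) (mergeEnd n k (r v)) (shiftDiff B v d) < tab n s 4 i k d + 1 := ⟨hpos, hlt⟩
    have h4' : ∀ i', ∀ a < 2 * n + 1, ∀ b < 2 * n + 1, tab n (cellStmt.eval V s') 4 i' a b =
        if i' = i + 1 ∧ a = mergeEnd n k (r v) ∧ b = shiftDiff B v d then tab n s 4 i k d + 1
        else tab n s' 4 i' a b := by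
      intro i' a ha b hb
      rw [tab, harr 4, if_pos hc, if_pos rfl, Function.update_apply]
      exact if_congr (idx_inj ha hb hm hs) rfl rfl
    have h5' : ∀ i', ∀ a < 2 * n + 1, ∀ b < 2 * n + 1, tab n (cellStmt.eval V s') 5 i' a b =
        if i' = i + 1 ∧ a = mergeEnd n k (r v) ∧ b = shiftDiff B v d then k + 1
        else tab n s' 5 i' a b := by
      intro i' a ha b hb
      rw [tab, harr 5, if_pos hc, if_neg (by omega), if_pos rfl, Function.update_apply]
      exact if_congr (idx_inj ha hb hm hs) rfl rfl
    refine ⟨fun i' hi' k' hk' d' hd' a ha => ?_, h.row.update hr hi hD hk hik hd hpos hlt ?_ ?_⟩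
    · rw [← h.other i' hi' k' hk' d' hd' a ha]
      rcases ha with rfl | rfl
      · rw [h4' i' k' hk' d' hd', if_neg fun hc => hi' hc.1]
      · rw [h5' i' k' hk' d' hd', if_neg fun hc => hi' hc.1]
    · intro a ha b hb
      rw [h4' _ a ha b hb]
      simp
    · intro a ha b hb
      rw [h5' _ a ha b hb]
      simp
  · have harr : ∀ a, (cellStmt.eval V s').arr a = s'.arr a := fun a => by
      rw [harr, if_neg fun hc => hlt hc.2]
    have htab : ∀ a i' k' d', tab n (cellStmt.eval V s') a i' k' d' = tab n s' a i' k' d' :=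
      fun a i' k' d' => by simp only [tab, harr]
    have htab' : ∀ a i', tab n (cellStmt.eval V s') a i' = tab n s' a i' :=
      fun a i' => by ext k' d'; exact htab a i' k' d'
    refine ⟨fun i' hi' k' hk' d' hd' a ha => by rw [htab]; exact h.other i' hi' k' hk' d' hd' a ha, ?_⟩
    rw [htab', htab']
    refine ⟨h.row.mono, fun a ha hia b hb hdone hp => ?_, h.row.keep, h.row.parent⟩
    rcases hdone with hdone | ⟨rfl, rfl⟩
    · exact h.row.extend a ha hia b hb hdone hp
    · exact not_lt.1 hlt

theorem ExtendInv.congr {r : Fin n → ℕ} {v : Fin n} {i : ℕ} {s' s'' : Env}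
    {done done' : ℕ → ℕ → Prop} (h : ExtendInv n B r v i s done s')
    (h4 : s''.arr 4 = s'.arr 4) (h5 : s''.arr 5 = s'.arr 5)
    (hd : ∀ k < 2 * n + 1, i ≤ k → ∀ d < 2 * n + 1, done' k d → done k d) :
    ExtendInv n B r v i s done' s'' := by
  have htab : ∀ a, a = 4 ∨ a = 5 → ∀ i', tab n s'' a i' = tab n s' a i' := by
    rintro a (rfl | rfl) i' <;> ext k d <;> simp only [tab, h4, h5]
  refine ⟨fun i' hi' k hk d hd a ha => by rw [htab a ha]; exact h.other i' hi' k hk d hd a ha, ?_⟩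
  rw [htab 4 (.inl rfl), htab 5 (.inr rfl)]
  exact h.row.imp fun k hk hik d hd' _ => hd k hk hik d hd'

theorem extendStmt_spec {r : Fin n → ℕ} {v : Fin n} {i : ℕ} {s₀ : Env}
    (hr : ∀ v, r v < n) (hi : i < n) (hD : RowSupport n i (tab n s₀ 4 i)) (hb : Base G B s)
    (h2 : s.reg 2 = i) (h7 : s.reg 7 = v) (h8 : s.reg 8 = r v) (hV : 2 * n + 2 ≤ V)
    (h : ExtendInv n B r v i s₀ (fun _ _ => False) s) :
    ExtendInv n B r v i s₀ (fun _ _ => True) (extendStmt.eval V s) := by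
  have := Stmt.eval_loop_induct (V := V) (i := 3) (m := 1) (s := s)
    (p := .ite (.var 3) (.var 2) .skip (.seq mergeStmt (.loop 4 1 cellStmt))) rfl
    (fun K s' => ExtendInv n B r v i s₀ (fun k _ => k < K) s') ?_ ?_
  · rw [hb.reg1] at this
    exact this.congr rfl rfl fun k hk _ d _ _ => hk
  · exact h.congr rfl rfl fun k hk _ d _ h => absurd h (by omega)
  · intro K s' hK hiK hreg harr ih
    rw [hb.reg1] at hK
    have hb' : Base G B s' := hb.congr (hreg 0 (by decide) rfl) (hreg 1 (by decide) rfl)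
      (harr 0 rfl)
    have h2' : s'.reg 2 = i := by rw [hreg 2 (by decide) rfl]; exact h2
    have h7' : s'.reg 7 = v := by rw [hreg 7 (by decide) rfl]; exact h7
    have h8' : s'.reg 8 = r v := by rw [hreg 8 (by decide) rfl]; exact h8
    have hP : (Stmt.ite (.var 3) (.var 2) .skip (.seq mergeStmt (.loop 4 1 cellStmt))).eval V s' =
        if K < i then s' else (Stmt.loop 4 1 cellStmt).eval V (s'.setReg 9 (mergeEnd n K (r v))) := by
      simp only [Stmt.eval, Exp.eval, hiK, h2', mergeStmt_eval hb' hiK h8']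
    rw [hP]
    split_ifs with hKi
    · exact ih.congr rfl rfl fun k hk hik d _ h => by omega
    set s₁ := s'.setReg 9 (mergeEnd n K (r v)) with hs₁
    have hb₁ : Base G B s₁ := hb'.setReg (by omega)
    have := Stmt.eval_loop_induct (V := V) (i := 4) (m := 1) (s := s₁) (p := cellStmt) rfl
      (fun d s'' => ExtendInv n B r v i s₀ (fun a b => a < K ∨ (a = K ∧ b < d)) s'') ?_ ?_
    · rw [hb₁.reg1] at this
      exact this.congr rfl rfl fun k hk hik d hd h => by omega
    · exact ih.congr rfl rfl fun k hk hik d hd h => by omega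
    · intro d s₂ hd hid hreg' harr' ih'
      rw [hb₁.reg1] at hd
      have hb₂ : Base G B s₂ := hb₁.congr (hreg' 0 (by decide) rfl) (hreg' 1 (by decide) rfl)
        (harr' 0 rfl)
      refine (cellStmt_spec (V := V) hr hi hD hb₂ ?_ ?_ hid ?_ ?_ hV hK (not_lt.1 hKi) hd ih').congr
        rfl rfl fun a _ _ b _ h => ?_
      · rw [hreg' 2 (by decide) rfl]; simpa [hs₁] using h2'
      · rw [hreg' 3 (by decide) rfl]; simpa [hs₁] using hiK
      · rw [hreg' 7 (by decide) rfl]; simpa [hs₁] using h7'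
      · rw [hreg' 9 (by decide) rfl]; simp [hs₁]
      · omega

theorem rowStmt_spec {pos r : Fin n → ℕ} (hlt : ∀ v, pos v < n) (hr : ∀ v, r v < n)
    (hb : Base G B s) {v : Fin n} (h2 : s.reg 2 = pos v) (h9 : s.arr 9 (pos v) = v)
    (h8 : Holds s 8 r) (hV : 2 * n + 2 ≤ V) (hD : RowSupport n (pos v) (tab n s 4 (pos v)))
    (h5 : ∀ k < 2 * n + 1, ∀ d < 2 * n + 1, tab n s 5 (pos v + 1) k d = 0) :
    (∀ i', i' ≠ pos v + 1 → ∀ k < 2 * n + 1, ∀ d < 2 * n + 1, ∀ a, a = 4 ∨ a = 5 →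
      tab n (rowStmt.eval V s) a i' k d = tab n s a i' k d) ∧
    TableRow n B r v (pos v) (tab n s 4 (pos v)) (tab n (rowStmt.eval V s) 4 (pos v + 1))
      (tab n (rowStmt.eval V s) 5 (pos v + 1)) := by
  set s₁ := (s.setReg 7 v).setReg 8 (r v) with hs₁
  set s₂ := copyStmt.eval V s₁ with hs₂
  have hP : rowStmt.eval V s = extendStmt.eval V s₂ := by
    simp only [rowStmt, Stmt.eval, Exp.eval, h2, h9]
    rw [hs₂, hs₁]
    congr 3
    simp [h8 v]
  have hb₁ : Base G B s₁ := (hb.setReg (by omega)).setReg (by omega)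
  have hb₂ : Base G B s₂ := hb₁.eval _ rfl
  have hcopy := copyStmt_spec (V := V) (s := s₁) hb₁ (i := pos v) (by simpa [hs₁] using h2)
  have ht : ∀ a i' k d, tab n s₁ a i' k d = tab n s a i' k d := fun a i' k d => rfl
  have ht5 : ∀ i' k d, tab n s₂ 5 i' k d = tab n s 5 i' k d := fun i' k d => by
    simp only [tab, hs₂]
    rw [Stmt.eval_arr copyStmt (by rfl)]
    rfl
  have hinv : ExtendInv n B r v (pos v) s (fun _ _ => False) s₂ := by
    refine ⟨?_, ?_, fun _ _ _ _ _ h => h.elim, ?_, ?_⟩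
    · rintro i' hi' k hk d hd a (rfl | rfl)
      · rw [hs₂, hcopy i' k d hk hd, if_neg hi', ht]
      · exact ht5 i' k d
    · intro k hk d hd
      rw [hs₂, hcopy _ k d hk hd, if_pos rfl, ht]
    · intro k hk d hd _
      rw [hs₂, hcopy _ k d hk hd, if_pos rfl, ht]
    · intro k hk d hd q hq
      rw [ht5, h5 k hk d hd] at hq
      omega
  have hfin := extendStmt_spec (V := V) hr (hlt v) hD hb₂
    (by rw [hs₂, Stmt.eval_reg copyStmt (by rfl)]; simpa [hs₁] using h2)
    (by rw [hs₂, Stmt.eval_reg copyStmt (by rfl)]; simp [hs₁])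
    (by rw [hs₂, Stmt.eval_reg copyStmt (by rfl)]; simp [hs₁]) hV hinv
  rw [hP]
  exact ⟨hfin.other, hfin.row.mono, fun k hk hik d hd hp => hfin.row.extend k hk hik d hd trivial hp,
    hfin.row.keep, hfin.row.parent⟩

theorem TableRow.congr {r : Fin n → ℕ} {v : Fin n} {i : ℕ} {D D' P E E' P' : ℕ → ℕ → ℕ}
    (h : TableRow n B r v i D D' P) (hr : ∀ v, r v < n) (hi : i < n) (hD : RowSupport n i D)
    (hE : ∀ k < 2 * n + 1, ∀ d < 2 * n + 1, E k d = D k d)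
    (hE' : ∀ k < 2 * n + 1, ∀ d < 2 * n + 1, E' k d = D' k d)
    (hP' : ∀ k < 2 * n + 1, ∀ d < 2 * n + 1, P' k d = P k d) : TableRow n B r v i E E' P' := by
  refine ⟨fun k hk d hd => ?_, fun k hk hik d hd hp => ?_, fun k hk d hd hp => ?_,
    fun k hk d hd q hq => ?_⟩
  · rw [hE k hk d hd, hE' k hk d hd]; exact h.mono k hk d hd
  · rw [hE k hk d hd] at hp ⊢
    have h1 := hD k hk d hd hp
    rw [hE' _ (mergeEnd_lt h1.1 (hr v)) _ (shiftDiff_lt hi h1.2.2.1)]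
    exact h.extend k hk hik d hd hp
  · rw [hE k hk d hd, hE' k hk d hd]
    exact h.keep k hk d hd (hP' k hk d hd ▸ hp)
  · obtain ⟨h1, h2, h3, d', h4, h5, h6, h7⟩ := h.parent k hk d hd q (hP' k hk d hd ▸ hq)
    refine ⟨h1, h2, h3, d', h4, h5, ?_, ?_⟩
    · rwa [hE q h2 d' h4]
    · rwa [hE q h2 d' h4, hE' k hk d hd]

theorem RowSupport.congr {i : ℕ} {D E : ℕ → ℕ → ℕ} (h : RowSupport n i D)
    (hE : ∀ k < 2 * n + 1, ∀ d < 2 * n + 1, E k d = D k d) : RowSupport n i E :=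
  fun k hk d hd hp => by rw [hE k hk d hd] at hp ⊢; exact h k hk d hd hp

theorem tableStmt_spec {pos r : Fin n → ℕ} (hinj : Function.Injective pos) (hlt : ∀ v, pos v < n)
    (hr : ∀ v, r v < n) (hb : Base G B s) (h9 : ∀ v : Fin n, s.arr 9 (pos v) = v)
    (h8 : Holds s 8 r) (hV : 2 * n + 2 ≤ V) (h4 : ∀ x, s.arr 4 x = 0) (h5 : ∀ x, s.arr 5 x = 0) :
    IsTable n B pos r (tab n (tableStmt.eval V s) 4) (tab n (tableStmt.eval V s) 5) := by
  set s₁ := s.setArr 4 (idx n 0 n n) 1 with hs₁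
  have hP : tableStmt.eval V s = (Stmt.loop 2 0 rowStmt).eval V s₁ := by
    simp only [tableStmt, Stmt.eval, eval_idxExp hb.reg1]
    simp [Exp.eval, hb.reg0, hs₁]
  have hb₁ : Base G B s₁ := hb.congr rfl rfl (by simp [hs₁])
  have hinit : ∀ i, ∀ k < 2 * n + 1, ∀ d < 2 * n + 1,
      tab n s₁ 4 i k d = if i = 0 ∧ k = n ∧ d = n then 1 else 0 := by
    intro i k hk d hd
    simp only [tab, hs₁, Env.setArr_arr, Function.update_self, Function.update_apply, h4]
    exact if_congr (idx_inj hk hd (by omega) (by omega)) rfl rfl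
  -- Pointers of later rows must still be zero, since a new row copies only the sizes and relies on
  -- the pointer `0` to mean that the last vertex is not used.
  have := Stmt.eval_loop_induct (V := V) (i := 2) (m := 0) (s := s₁) (p := rowStmt) rfl
    (fun I s' => (∀ i, I < i → ∀ k < 2 * n + 1, ∀ d < 2 * n + 1, tab n s' 5 i k d = 0) ∧
      (∀ i ≤ I, RowSupport n i (tab n s' 4 i)) ∧
      (∀ k < 2 * n + 1, ∀ d < 2 * n + 1, tab n s' 4 0 k d = if k = n ∧ d = n then 1 else 0) ∧
      ∀ v, pos v < I → TableRow n B r v (pos v) (tab n s' 4 (pos v)) (tab n s' 4 (pos v + 1))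
        (tab n s' 5 (pos v + 1))) ?_ ?_
  · rw [← hP, hb₁.reg0] at this
    exact ⟨this.2.2.1, fun v => this.2.2.2 v (hlt v)⟩
  · refine ⟨fun i _ k _ d _ => ?_, fun i hi k hk d hd hp => ?_, fun k hk d hd => ?_,
      fun v hv => absurd hv (by omega)⟩
    · simp [tab, hs₁, h5]
    · obtain rfl : i = 0 := by omega
      have h1 : tab n (s₁.setReg 2 0) 4 0 k d = if 0 = 0 ∧ k = n ∧ d = n then 1 else 0 :=
        hinit 0 k hk d hd
      rw [h1] at hp ⊢
      split_ifs at hp ⊢ with h2 <;> omega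
    · have h1 : tab n (s₁.setReg 2 0) 4 0 k d = if 0 = 0 ∧ k = n ∧ d = n then 1 else 0 :=
        hinit 0 k hk d hd
      rw [h1]
      simp
  · rintro I s' hI hiI hreg harr ⟨ih1, ih2, ih3, ih4⟩
    rw [hb₁.reg0] at hI
    obtain ⟨v, rfl⟩ := exists_pos_eq hinj hlt hI
    have hb' : Base G B s' := hb₁.congr (hreg 0 (by decide) rfl) (hreg 1 (by decide) rfl)
      (harr 0 rfl)
    obtain ⟨hother, hrow⟩ := rowStmt_spec (V := V) hlt hr hb' hiI
      (by rw [harr 9 rfl]; simpa [hs₁] using h9 v)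
      (fun u => by rw [harr 8 rfl]; simpa [hs₁] using h8 u) hV (ih2 _ le_rfl)
      (ih1 _ (Nat.lt_succ_self _))
    have ht : ∀ a i, tab n ((rowStmt.eval V s').setReg 2 (pos v + 1)) a i =
      tab n (rowStmt.eval V s') a i := fun _ _ => rfl
    simp only [ht]
    refine ⟨fun i hi k hk d hd => ?_, fun i hi => ?_, fun k hk d hd => ?_, fun u hu => ?_⟩
    · rw [hother i (by omega) k hk d hd 5 (.inr rfl)]
      exact ih1 i (by omega) k hk d hd
    · rcases hi.lt_or_eq with hi | rfl
      · exact (ih2 i (by omega)).congr fun k hk d hd => hother i hi.ne k hk d hd 4 (.inl rfl)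
      · exact hrow.support hr (ih2 _ le_rfl)
    · rw [hother 0 (by omega) k hk d hd 4 (.inl rfl)]
      exact ih3 k hk d hd
    · have ho : ∀ k < 2 * n + 1, ∀ d < 2 * n + 1, tab n (rowStmt.eval V s') 4 (pos u) k d =
          tab n s' 4 (pos u) k d :=
        fun k hk d hd => hother _ hu.ne k hk d hd 4 (.inl rfl)
      by_cases huv : pos u = pos v
      · obtain rfl := hinj huv
        exact hrow.congr hr hI (ih2 _ le_rfl) ho (fun _ _ _ _ => rfl) fun _ _ _ _ => rfl
      · exact (ih4 u (by omega)).congr hr (hlt u) (ih2 _ (by omega)) ho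
          (fun k hk d hd => hother _ (by omega) k hk d hd 4 (.inl rfl))
          fun k hk d hd => hother _ (by omega) k hk d hd 5 (.inr rfl)

end TableCorrect

end BCS

namespace BCS

/-! ### Tracing back an optimal set, and the complete program -/

section Program

open Exp Stmt

/-- Find the largest right end point of an optimal balanced set. -/
def bestStmt : Stmt :=
  seq (assign 12 (var 0)) (loop 3 0
    (ite (read 4 (idxExp (var 0) (var 12) (var 0))) (read 4 (idxExp (var 0) (var 3) (var 0)))
      (assign 12 (var 3)) skip))

def takeStmt : Stmt :=
  seq (assign 7 (read 9 (var 15))) (seq (write 10 (var 7) (lit 1))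
    (seq (assign 13 (sub (var 16) (lit 1))) (ite (lit 0) (colorExp 7)
      (assign 14 (sub (var 14) (lit 1))) (assign 14 (sadd (var 14) (lit 1))))))

def traceCell : Stmt :=
  seq (assign 15 (sub (sub (var 0) (lit 1)) (var 2)))
    (seq (assign 16 (read 5 (idxExp (add (var 15) (lit 1)) (var 13) (var 14))))
      (ite (lit 0) (var 16) takeStmt skip))

/-- Follow the parent pointers and mark the vertices of an optimal set in the array `10`. -/
def traceStmt : Stmt :=
  seq (assign 13 (var 12)) (seq (assign 14 (var 0)) (loop 2 0 traceCell))

def outStmt : Stmt := loop 4 0 (write 0 (var 4) (read 10 (var 4)))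

def bcsStmt : Stmt :=
  seq twoSweepsStmt (seq repStmt (seq tableStmt (seq bestStmt (seq traceStmt outStmt))))

end Program

section BcsCorrect

variable {n : ℕ} {G : SimpleGraph (Fin n)} {B : Finset (Fin n)} {V : ℕ} {s : Env}

theorem bestStmt_spec (hb : Base G B s) :
    (bestStmt.eval V s).reg 12 ≤ n ∧
      ∀ k ≤ n, tab n s 4 n k n ≤ tab n s 4 n ((bestStmt.eval V s).reg 12) n := by
  set s₁ := s.setReg 12 n with hs₁
  have hP : bestStmt.eval V s = (Stmt.loop 3 0 (.ite (.read 4 (idxExp (.var 0) (.var 12) (.var 0)))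
      (.read 4 (idxExp (.var 0) (.var 3) (.var 0))) (.assign 12 (.var 3)) .skip)).eval V s₁ := by
    simp only [bestStmt, Stmt.eval, Exp.eval, hb.reg0, hs₁]
  have hb₁ : Base G B s₁ := hb.setReg (by omega)
  have := Stmt.eval_loop_induct (V := V) (i := 3) (m := 0) (s := s₁)
    (p := .ite (.read 4 (idxExp (.var 0) (.var 12) (.var 0)))
      (.read 4 (idxExp (.var 0) (.var 3) (.var 0))) (.assign 12 (.var 3)) .skip) rfl
    (fun k s' => s'.reg 12 ≤ n ∧ tab n s 4 n n n ≤ tab n s 4 n (s'.reg 12) n ∧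
      ∀ k' < k, tab n s 4 n k' n ≤ tab n s 4 n (s'.reg 12) n) ?_ ?_
  · rw [← hP, hb₁.reg0] at this
    refine ⟨this.1, fun k hk => ?_⟩
    -- The loop visits only `k < n`; the remaining value `k = n` is the initial choice.
    rcases hk.lt_or_eq with hk | rfl
    · exact this.2.2 k hk
    · exact this.2.1
  · refine ⟨by simp [hs₁], by simp [hs₁], fun k' hk' => absurd hk' (by omega)⟩
  · rintro k s' hk hik hreg harr ⟨h1, h2, h3⟩
    have hb' : Base G B s' := hb₁.congr (hreg 0 (by decide) rfl) (hreg 1 (by decide) rfl)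
      (harr 0 rfl)
    rw [hb₁.reg0] at hk
    have ht : ∀ i k d, s'.arr 4 (idx n i k d) = tab n s 4 i k d := fun i k d => by
      rw [harr 4 rfl]; rfl
    simp only [Stmt.eval, Exp.eval, eval_idxExp hb'.reg1, hb'.reg0, hik, ht]
    split_ifs with h4
    · refine ⟨by simpa using hk.le, ?_, fun k' hk' => ?_⟩
      · simpa using h2.trans h4.le
      · rcases Nat.lt_succ_iff_lt_or_eq.1 hk' with h5 | rfl
        · simpa using (h3 k' h5).trans h4.le
        · simp
    · refine ⟨by simpa using h1, by simpa using h2, fun k' hk' => ?_⟩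
      rcases Nat.lt_succ_iff_lt_or_eq.1 hk' with h5 | rfl
      · simpa using h3 k' h5
      · simpa using not_lt.1 h4

theorem takeStmt_eval (hb : Base G B s) {v : Fin n} {d q : ℕ} (h9 : s.arr 9 (s.reg 15) = v)
    (h14 : s.reg 14 = d) (h16 : s.reg 16 = q + 1) (hV : d + 1 ≤ V) :
    (takeStmt.eval V s).reg 13 = q ∧
      (takeStmt.eval V s).reg 14 = (if v ∈ B then d - 1 else d + 1) ∧
      (takeStmt.eval V s).arr 10 = Function.update (s.arr 10) v 1 := by
  set s₁ := ((s.setReg 7 v).setArr 10 v 1).setReg 13 q with hs₁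
  have hb₁ : Base G B s₁ := hb.congr (by simp [hs₁]) (by simp [hs₁]) (by simp [hs₁])
  have hP : takeStmt.eval V s = s₁.setReg 14 (if v ∈ B then d - 1 else d + 1) := by
    have e1 : s₁.reg 14 = d := by simpa [hs₁] using h14
    have e2 : takeStmt.eval V s = (Stmt.ite (.lit 0) (colorExp 7)
        (.assign 14 (.sub (.var 14) (.lit 1))) (.assign 14 (.sadd (.var 14) (.lit 1)))).eval V s₁ := by
      simp only [takeStmt, Stmt.eval, Exp.eval, h9]
      simp [hs₁, h16]
    rw [e2]
    simp only [Stmt.eval, hb₁.eval_colorExp (x := 7) (v := v) (by simp [hs₁])]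
    simp only [Exp.eval, e1, min_eq_left hV]
    by_cases h : v ∈ B <;> simp [h]
  rw [hP]
  simp [hs₁]

theorem traceStmt_spec {pos r : Fin n → ℕ} (hrep : IsIntervalRep G pos r)
    (hinj : Function.Injective pos) (hlt : ∀ v, pos v < n) (hr : ∀ v, r v < n) (hb : Base G B s)
    (h : IsTable n B pos r (tab n s 4) (tab n s 5)) (h9 : ∀ v : Fin n, s.arr 9 (pos v) = v)
    (h10 : ∀ x, s.arr 10 x = 0) (hV : 2 * n + 2 ≤ V) (h12 : s.reg 12 ≤ n)
    (hmax : ∀ k ≤ n, tab n s 4 n k n ≤ tab n s 4 n (s.reg 12) n) :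
    ∃ T, IsBCSSolution G B T ∧
      ∀ v : Fin n, (traceStmt.eval V s).arr 10 v = if v ∈ T then 1 else 0 := by
  set s₁ := (s.setReg 13 (s.reg 12)).setReg 14 n with hs₁
  have hb₁ : Base G B s₁ := (hb.setReg (by omega)).setReg (by omega)
  have hP : traceStmt.eval V s = (Stmt.loop 2 0 traceCell).eval V s₁ := by
    simp only [traceStmt, Stmt.eval, Exp.eval]
    simp [hs₁, hb.reg0]
  have := Stmt.eval_loop_induct (V := V) (i := 2) (m := 0) (s := s₁) (p := traceCell) rfl
    (fun k s' => ∃ T, Tracing G B pos r (tab n s 4) (s.reg 12) (n - k) (s'.reg 13) (s'.reg 14) T ∧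
      ∀ v : Fin n, s'.arr 10 v = if v ∈ T then 1 else 0) ?_ ?_
  · obtain ⟨T, h1, h2⟩ := this
    rw [hb₁.reg0, Nat.sub_self] at h1
    exact ⟨T, h1.isBCSSolution h hrep hinj hlt hr hmax, hP ▸ h2⟩
  · refine ⟨∅, ?_, by simp [hs₁, h10]⟩
    have := Tracing.init h hrep hinj hlt hr (by omega) hmax
    simpa [hs₁] using this
  · rintro k s' hk hik hreg harr ⟨T, h1, h2⟩
    rw [hb₁.reg0] at hk
    have hb' : Base G B s' := hb₁.congr (hreg 0 (by decide) rfl) (hreg 1 (by decide) rfl)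
      (harr 0 rfl)
    -- Rows are read backwards: pass `k` uses row `n - k`, which decides on the vertex at position
    -- `n - 1 - k`.
    obtain ⟨v, hv⟩ := exists_pos_eq hinj hlt (i := n - 1 - k) (by omega)
    have hv' : n - k = pos v + 1 := by omega
    have hv'' : n - (k + 1) = pos v := by omega
    rw [hv'] at h1
    rw [hv'']
    generalize hκ : s'.reg 13 = κ at h1
    generalize hδ : s'.reg 14 = δ at h1
    set q := tab n s 5 (pos v + 1) κ δ with hq
    set s₂ := (s'.setReg 15 (pos v)).setReg 16 q with hs₂
    have hb₂ : Base G B s₂ := (hb'.setReg (by omega)).setReg (by omega)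
    have hC : traceCell.eval V s' = if 0 < q then takeStmt.eval V s₂ else s₂ := by
      have e1 : (s'.setReg 15 (pos v)).reg 1 = 2 * n + 1 := by simpa using hb'.reg1
      have e2 : s'.arr 5 = s.arr 5 := harr 5 rfl
      simp only [traceCell, Stmt.eval]
      simp only [Exp.eval, hb'.reg0, hik, ← hv, eval_idxExp e1]
      simp [e2, hκ, hδ, hs₂, hq, tab]
    rw [hC]
    rcases hq0 : q with _ | q'
    · refine ⟨T, ?_, ?_⟩
      · have := h1.keep h (hq ▸ hq0)
        simpa [hs₂, hκ, hδ] using this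
      · simpa [hs₂] using h2
    · have h3 := h1.step h hrep hinj hlt hr (hq ▸ hq0)
      have e3 : s₂.arr 9 (s₂.reg 15) = v := by
        have : s'.arr 9 = s.arr 9 := harr 9 rfl
        simp [hs₂, this, h9]
      obtain ⟨e4, e5, e6⟩ := takeStmt_eval (V := V) (d := δ) (q := q') hb₂ e3 (by simp [hs₂, hδ])
        (by simp [hs₂, hq0]) (by have := h1.d_lt; omega)
      refine ⟨insert v T, ?_, fun u => ?_⟩
      · simpa [e4, e5] using h3
      · simp only [Nat.zero_lt_succ, if_true, Env.setReg_arr, e6]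
        by_cases huv : u = v
        · subst huv; simp
        · have : (u : ℕ) ≠ v := fun hc => huv (Fin.ext hc)
          simp [huv, this, hs₂, h2]

theorem outStmt_spec (hb : Base G B s) (v : Fin n) : (outStmt.eval V s).arr 0 v = s.arr 10 v := by
  refine (Stmt.eval_loop_map (V := V) (i := 4) (m := 0) (a := 0) (s := s) (N := n)
    rfl hb.reg0 (f := fun k => k) (g := fun k => s.arr 10 k) Fin.val_injective ?_).1 v
  intro u s' hu hreg harr _ _
  have h0 : s'.reg 0 = n := by rw [hreg 0 (by decide) rfl]; exact hb.reg0
  -- Writes to array `0` take effect only inside the input region, which contains the `n` output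
  -- cells.
  have hlt : (u : ℕ) < n * n + n := by have := u.2; omega
  simp only [Stmt.eval, Exp.eval, hu, h0, hlt, harr 10 rfl]
  simp +contextual

theorem reachPos_lt {pos : Fin n → ℕ} (hlt : ∀ v, pos v < n) (v : Fin n) :
    reachPos G pos v < n := by
  classical
  exact (Finset.sup_lt_iff (by have := v.2; rw [Nat.bot_eq_zero]; omega)).2 fun u _ => hlt u

theorem position_lt (c : Fin n → ℕ) (v : Fin n) : position G c v < n := by
  simpa [position] using rank_lt_card _ v

theorem bcsStmt_spec (hG : IsIntervalGraph G) (hb : Base G B s) (hV : 4 * n + 4 ≤ V)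
    (h0 : ∀ a, a ≠ 0 → ∀ x, s.arr a x = 0) :
    ∃ T, IsBCSSolution G B T ∧
      ∀ v : Fin n, (bcsStmt.eval V s).arr 0 v = if v ∈ T then 1 else 0 := by
  have hP : bcsStmt.eval V s = outStmt.eval V (traceStmt.eval V (bestStmt.eval V
      (tableStmt.eval V (repStmt.eval V (twoSweepsStmt.eval V s))))) := by
    simp only [bcsStmt, Stmt.eval]
  rw [hP]
  generalize hs₁ : twoSweepsStmt.eval V s = s₁
  generalize hs₂ : repStmt.eval V s₁ = s₂
  generalize hs₃ : tableStmt.eval V s₂ = s₃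
  generalize hs₄ : bestStmt.eval V s₃ = s₄
  generalize hs₅ : traceStmt.eval V s₄ = s₅
  have hb₁ : Base G B s₁ := hs₁ ▸ hb.eval twoSweepsStmt (by rfl)
  have hb₂ : Base G B s₂ := hs₂ ▸ hb₁.eval repStmt (by rfl)
  have hb₃ : Base G B s₃ := hs₃ ▸ hb₂.eval tableStmt (by rfl)
  have hb₄ : Base G B s₄ := hs₄ ▸ hb₃.eval bestStmt (by rfl)
  have hb₅ : Base G B s₅ := hs₅ ▸ hb₄.eval traceStmt (by rfl)
  obtain ⟨c, hc, -, ho⟩ := twoSweepsStmt_spec (V := V) hG hb (by omega)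
  rw [hs₁] at hc
  have hrep := isIntervalRep_position hG ho
  have hlt := position_lt (G := G) c
  have hr := reachPos_lt (G := G) hlt
  have hpos := position_injective (G := G) c
  obtain ⟨h8, h9⟩ := repStmt_spec (V := V) hb₁ hc (by omega)
  rw [hs₂] at h8 h9
  have z : ∀ a, a ≠ 0 → twoSweepsStmt.modArr a = false → repStmt.modArr a = false →
      ∀ x, s₂.arr a x = 0 := fun a ha e1 e2 x => by
    rw [← hs₂, Stmt.eval_arr _ e2, ← hs₁, Stmt.eval_arr _ e1]; exact h0 a ha x
  have ht := tableStmt_spec (V := V) hpos hlt hr hb₂ h9 h8 (by omega) (z 4 (by decide) rfl rfl)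
    (z 5 (by decide) rfl rfl)
  rw [hs₃] at ht
  obtain ⟨h12, hmax⟩ := bestStmt_spec (V := V) hb₃
  rw [hs₄] at h12 hmax
  have e4 : ∀ a, bestStmt.modArr a = false → s₄.arr a = s₃.arr a := fun a ha =>
    hs₄ ▸ Stmt.eval_arr _ ha _
  have t4 : tab n s₄ 4 = tab n s₃ 4 := by unfold tab; rw [e4 4 rfl]
  have t5 : tab n s₄ 5 = tab n s₃ 5 := by unfold tab; rw [e4 5 rfl]
  obtain ⟨T, hT, h10⟩ := traceStmt_spec (V := V) hrep hpos hlt hr hb₄ (by rw [t4, t5]; exact ht)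
    (fun v => by rw [e4 9 rfl, ← hs₃, Stmt.eval_arr tableStmt (a := 9) (by rfl)]; exact h9 v)
    (fun x => by
      rw [e4 10 rfl, ← hs₃, Stmt.eval_arr tableStmt (a := 10) (by rfl)]
      exact z 10 (by decide) rfl rfl x)
    (by omega) h12 (by rw [t4]; exact hmax)
  refine ⟨T, hT, fun v => ?_⟩
  rw [← h10 v, hs₅]
  exact outStmt_spec hb₅ v

theorem base_inputEnv (G : SimpleGraph (Fin n)) (B : Finset (Fin n)) :
    Base G B (inputEnv G B) :=
  ⟨by simp [inputEnv], by simp [inputEnv], rfl⟩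

theorem exists_prog_isBCSSolution :
    ∃ (P : Prog) (c : ℕ) (T : ℕ → ℕ),
      (fun n => (T n : ℝ)) =O[atTop] (fun n : ℕ => (n : ℝ) ^ 3) ∧
      ∀ (n : ℕ) (G : SimpleGraph (Fin n)) (B : Finset (Fin n)), IsIntervalGraph G →
        ∃ (t : ℕ) (s : State) (S : Finset (Fin n)), t ≤ T n ∧
          Run (c * (n + 1) ^ c) P (inputState G B) t s ∧ Outputs s S ∧ IsBCSSolution G B S := by
  -- Well-formedness and nesting depth at most three are checked by computation on the program text;
  -- these syntactic facts yield the word size and the cubic bound.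
  obtain ⟨P, c, T, hT, h⟩ := exists_prog_of_stmt bcsStmt (by rfl) (by decide)
  refine ⟨P, c, T, hT, fun n G B hG => ?_⟩
  obtain ⟨t, s, ht, hrun, hs⟩ := h n G B
  obtain ⟨S, hS, hout⟩ := bcsStmt_spec (V := 4 * n + 4) hG (base_inputEnv G B) le_rfl
    fun a ha x => by simp [inputEnv, ha]
  refine ⟨t, s, S, ht, hrun, fun v => ?_, hS⟩
  rw [hs v (by have := v.2; omega), hout v]

end BcsCorrect

end BCS

theorem mainTheorem3 :
    -- BCS on interval graphs is solved in time `O(n³)`, with words of `O(log n)` bits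
    (∃ (P : BCS.Prog) (c : ℕ) (T : ℕ → ℕ),
      (fun n => (T n : ℝ)) =O[atTop] (fun n : ℕ => (n : ℝ) ^ 3) ∧
      ∀ (n : ℕ) (G : SimpleGraph (Fin n)) (B : Finset (Fin n)), BCS.IsIntervalGraph G →
        ∃ (t : ℕ) (s : BCS.State) (S : Finset (Fin n)), t ≤ T n ∧
          BCS.Run (c * (n + 1) ^ c) P (BCS.inputState G B) t s ∧
          BCS.Outputs s S ∧ BCS.IsBCSSolution G B S) ∧
    -- deleting the interval with the largest left end point keeps a connected set connected
    (∀ (n : ℕ) (G : SimpleGraph (Fin n)) (l r : Fin n → ℝ), BCS.IsIntervalRep G l r →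
      ∀ (S : Finset (Fin n)) (v : Fin n), BCS.ConnectedSet G S → v ∈ S →
        (∀ u ∈ S, l u ≤ l v) → S = {v} ∨ BCS.ConnectedSet G (S.erase v)) ∧
    -- the recurrence over prefix, largest right end point and colour difference
    (∀ (n : ℕ) (G : SimpleGraph (Fin n)) (B : Finset (Fin n)) (l r : Fin n → ℕ),
      BCS.IsSortedRep G l r →
      ∀ (i : Fin n) (k : ℕ) (d : ℤ), 1 ≤ k → k ≤ 2 * n → -(n : ℤ) ≤ d → d ≤ n →
        (r i < k → BCS.bcs G B r (i + 1) k d =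
          max (BCS.bcs G B r i k (d - BCS.colorSign B i) + 1) (BCS.bcs G B r i k d)) ∧
        (k = r i → d ≠ BCS.colorSign B i → BCS.bcs G B r (i + 1) k d =
          (Finset.Ioo (l i) (r i)).sup
            fun k' => BCS.bcs G B r i k' (d - BCS.colorSign B i) + 1) ∧
        (k = r i → d = BCS.colorSign B i → BCS.bcs G B r (i + 1) k d =
          max 1 ((Finset.Ioo (l i) (r i)).sup
            fun k' => BCS.bcs G B r i k' (d - BCS.colorSign B i) + 1)) ∧
        (k < r i → BCS.bcs G B r (i + 1) k d = BCS.bcs G B r i k d)) := by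
  refine ⟨BCS.exists_prog_isBCSSolution, fun n G l r h S v hS hv hmax => hS.erase h hv hmax,
    fun n G B l r h i k d _ _ _ _ => ⟨BCS.bcs_succ_of_lt h i, ?_, ?_, BCS.bcs_succ_of_gt i⟩⟩
  · rintro rfl hd
    exact BCS.bcs_succ_of_eq_of_ne h i hd
  · rintro rfl rfl
    exact BCS.bcs_succ_of_eq_of_eq h i
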